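/- **Theorem 3.1.** Let $d\in\{2,3\}$, $\sigma>0$ and $\gamma_B>0$. There are constants $\tilde\varsigma>0$ and $\tilde\gamma>0$, depending only on $d,\sigma,\gamma_B$ (hence not on the mesh size $h$, the time step $\tau$ or the physical parameters), such that the following holds. *Setting.* Let $\Omega\subset\mathbb R^d$ be a bounded open set whose closure is the union of a finite conforming mesh of $d$-simplices, with $\Omega$ equal to the interior of that union. Let $\Gamma_c,\Gamma_t$ be disjoint relatively open subsets of $\partial\Omega$ of nonzero $(d-1)$-dimensional measure with $\partial\Omega=\overline\Gamma_c\cup\overline\Gamma_t$. Assume that every mesh simplex $T$ contains a ball whose diameter $\rho$ satisfies $\operatorname{diam}T\le\sigma\rho$. Let $\mu>0$, $\lambda\ge0$, $\alpha\ge0$, $M>0$, $\mu_f>0$, $\tau>0$, and let $\boldsymbol K$ be a measurable, symmetric, bounded and uniformly positive definite permeability tensor on $\Omega$. Write $(\cdot,\cdot)$ for the $L^2(\Omega)$ (or Euclidean) inner product and $a(\boldsymbol u,\boldsymbol v)=2\mu\int_\Omega\varepsilon(\boldsymbol u):\varepsilon(\boldsymbol v)+\lambda\int_\Omega \operatorname{div}\boldsymbol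 u\,\operatorname{div}\boldsymbol v$, where $\varepsilon(\boldsymbol u)=\frac12(\nabla\boldsymbol u+\nabla\boldsymbol u^T)$. *Spaces.* Let $V_h=V_{h,1}\oplus V_b$, where $V_{h,1}$ consists of the continuous piecewise linear vector fields vanishing on $\Gamma_c$, and $V_b$ is spanned by the face (edge for $d=2$) bubbles $\boldsymbol\varphi_F=\big(\prod_{v\in F}\lambda_v\big)\boldsymbol n_F$ that vanish on $\Gamma_c$; here $F$ runs over the $(d-1)$-dimensional faces, $\lambda_v$ is the piecewise linear nodal function of the vertex $v$, and $\boldsymbol n_F$ is a unit normal of $F$. Let $Q_h\subset L^2(\Omega)$ and $W_h\subset\{\boldsymbol w\in H(\operatorname{div},\Omega):\boldsymbol w\cdot\boldsymbol n=0\text{ on }\Gamma_c\}$ be finite-dimensional subspaces (for example piecewise constants and lowest-order Raviart–Thomas fields). *Stokes–Biot stability.* The triple $(V_h,W_h,Q_h)$ is Stokes–Biot stable, with Stokes constant $\gamma_B$, if - $a$ is bounded and coercive on $V_h$ in the $H^1(\Omega)$ norm $\|\cdot\|_1$; - $(W_h,Q_h)$ is Poisson stable: $(\boldsymbol w,\boldsymbol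 r)$ and $(\operatorname{div}\boldsymbol w,q)$ are bounded in the $H(\operatorname{div})$ and $L^2$ norms, $(\boldsymbol w,\boldsymbol w)\ge c\|\boldsymbol w\|_{\operatorname{div}}^2$ for some $c>0$ and all $\boldsymbol w\in W_h$ with $(\operatorname{div}\boldsymbol w,q)=0$ for all $q\in Q_h$, and for some $\beta>0$, $\sup_{0\ne \boldsymbol w\in W_h}(\operatorname{div}\boldsymbol w,q)/\|\boldsymbol w\|_{\operatorname{div}}\ge\beta\|q\|$ for all $0\ne q\in Q_h$; - $(V_h,Q_h)$ is Stokes stable: $\sup_{0\neq\boldsymbol v\in V_h}(\operatorname{div}\boldsymbol v,q)/\|\boldsymbol v\|_1\ge\gamma_B\|q\|$ for all $0\ne q\in Q_h$. The constants in the first two conditions are arbitrary; $\tilde\varsigma,\tilde\gamma$ do not depend on them. *Matrices.* Fix bases of $V_{h,1},Q_h,W_h$, and use the $\boldsymbol\varphi_F$ as basis of $V_b$; superscripts $b,l$ denote fields in $V_b$, $V_{h,1}$. Let the matrices $A_{bb}$, $A_{bl}$, $A_{ll}$ represent $a(\boldsymbol u^b,\boldsymbol v^b)$, $a(\boldsymbol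 u^l,\boldsymbol v^b)$, $a(\boldsymbol u^l,\boldsymbol v^l)$; let $B_b,B_l,B_w$ represent $-(\operatorname{div}\boldsymbol u^b,q)$, $-(\operatorname{div}\boldsymbol u^l,q)$, $-(\operatorname{div}\boldsymbol w,q)$; and let $M_p,M_w$ represent $(p,q)$, $(\boldsymbol K^{-1}\mu_f\boldsymbol w,\boldsymbol r)$. Put $D_{bb}=(d+1)\operatorname{diag}(A_{bb})$, $A_w=B_w^TM_p^{-1}B_w$, $\zeta=\sqrt{\lambda+2\mu/d}$, $c_p=(\alpha^2/\zeta^2+1/M)^{-1}$, $$\mathcal A^D=\begin{pmatrix}D_{bb}&A_{bl}&\alpha B_b^T&0\\A_{bl}^T&A_{ll}&\alpha B_l^T&0\\-\alpha B_b&-\alpha B_l&\frac1MM_p&-\tau B_w\\0&0&\tau B_w^T&\tau M_w\end{pmatrix},\qquad A_u^D=\begin{pmatrix}D_{bb}&A_{bl}\\A_{bl}^T&A_{ll}\end{pmatrix},$$ $$\mathcal D=\operatorname{diag}\Big(A_u^D,\ \big(\tfrac{\alpha^2}{\zeta^2}+\tfrac1M\big)M_p,\ \tau M_w+\tau^2c_pA_w\Big).$$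 *Claim.* If $(V_h,W_h,Q_h)$ is Stokes–Biot stable with Stokes constant $\gamma_B$, then $\mathcal D$ is symmetric positive definite and, with $\|x\|_{\mathcal D}^2=(\mathcal Dx,x)$ and $x,y$ ranging over nonzero coefficient vectors, $$\sup_{x\ne0}\sup_{y\ne0}\frac{(\mathcal A^Dx,y)}{\|x\|_{\mathcal D}\|y\|_{\mathcal D}}\le\tilde\varsigma,\qquad \inf_{y\ne0}\sup_{x\ne0}\frac{(\mathcal A^Dx,y)}{\|x\|_{\mathcal D}\|y\|_{\mathcal D}}\ge\tilde\gamma .$$ -/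

import Mathlib

open MeasureTheory
open scoped Matrix ContDiff

noncomputable section

namespace Biot

/-- Euclidean space `ℝ^d`. -/
abbrev E (d : ℕ) : Type := EuclideanSpace ℝ (Fin d)

variable {d : ℕ}

/-! ### Differential operators and bilinear forms for vector fields -/

/-- The gradient matrix `(∇v)_{ij} = ∂_j v_i`. Below it is only integrated for fields that are
continuous and piecewise polynomial, where the classical derivative exists almost everywhere and
is the weak one. -/
def grad (v : E d → E d) (x : E d) : Matrix (Fin d) (Fin d) ℝ :=
  fun i j => fderiv ℝ v x (EuclideanSpace.single j 1) i

/-- The symmetric gradient `ε(v) = (∇v + ∇vᵀ)/2`. -/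
def symGrad (v : E d → E d) (x : E d) : Matrix (Fin d) (Fin d) ℝ :=
  (1 / 2 : ℝ) • (grad v x + (grad v x)ᵀ)

/-- The divergence, i.e. the trace of the gradient. -/
def divergence (v : E d → E d) (x : E d) : ℝ := (grad v x).trace

/-- The contraction `A : B = ∑ A_{ij} B_{ij}`. -/
def contract (A B : Matrix (Fin d) (Fin d) ℝ) : ℝ := ∑ i, ∑ j, A i j * B i j

/-- The elasticity form `a(u,v) = 2μ ∫ ε(u):ε(v) + λ ∫ div u div v` on `Ω`. -/
def elasticity (Ω : Set (E d)) (lam mu : ℝ) (u v : E d → E d) : ℝ :=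
  2 * mu * (∫ x in Ω, contract (symGrad u x) (symGrad v x))
    + lam * (∫ x in Ω, divergence u x * divergence v x)

/-- The full `H¹(Ω)` norm of a vector field. -/
def H1norm (Ω : Set (E d)) (v : E d → E d) : ℝ :=
  √((∫ x in Ω, ‖v x‖ ^ 2) + ∫ x in Ω, contract (grad v x) (grad v x))

/-- The space `L²(Ω)`. -/
abbrev L2 (Ω : Set (E d)) : Type := Lp ℝ 2 (volume.restrict Ω)

/-- The space `L²(Ω)^d`. -/
abbrev L2vec (Ω : Set (E d)) : Type := Lp (E d) 2 (volume.restrict Ω)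

/-- `w ∈ H(div, Ω)` with weak divergence `g`, and `w · n = 0` on the part of the boundary
that is not in the closure of `Γt`: Green's formula without boundary term, against all test
functions that vanish near `Γt`. (Test functions supported in `Ω` give `g = div w`.) -/
def MemHdiv (Ω Γt : Set (E d)) (w : L2vec Ω) (g : L2 Ω) : Prop :=
  ∀ φ : E d → ℝ, ContDiff ℝ ∞ φ → HasCompactSupport φ → Disjoint (tsupport φ) (closure Γt) →
    ∫ x in Ω, g x * φ x = - ∫ x in Ω, fderiv ℝ φ x (w x)

/-- The norm of `H(div, Ω)` of a field paired with its divergence. -/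
def Hdivnorm {Ω : Set (E d)} (w : L2vec Ω × L2 Ω) : ℝ := √(‖w.1‖ ^ 2 + ‖w.2‖ ^ 2)

/-! ### Piecewise linear nodal functions and face bubbles on a simplicial complex -/

/-- `w` is the vector of barycentric coordinates of `x` in the simplex with vertex set `s`
(extended by zero to the points that are not vertices of `s`). -/
def IsBary (s : Finset (E d)) (x : E d) (w : E d → ℝ) : Prop :=
  (∀ u ∈ s, 0 ≤ w u) ∧ (∀ u ∉ s, w u = 0) ∧ ∑ u ∈ s, w u = 1 ∧ ∑ u ∈ s, w u • u = x

theorem IsBary.mono {s t : Finset (E d)} {x : E d} {w : E d → ℝ} (h : IsBary s x w)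
    (hst : s ⊆ t) : IsBary t x w := by
  obtain ⟨h1, h2, h3, h4⟩ := h
  refine ⟨fun u _ => ?_, fun u hu => h2 u fun hs => hu (hst hs), ?_, ?_⟩
  · by_cases hs : u ∈ s
    · exact h1 u hs
    · exact (h2 u hs).ge
  · rw [← h3]
    exact (Finset.sum_subset hst fun u _ hu => h2 u hu).symm
  · rw [← h4]
    exact (Finset.sum_subset hst fun u _ hu => by simp [h2 u hu]).symm

theorem IsBary.unique {s : Finset (E d)} (hs : AffineIndependent ℝ ((↑) : s → E d)) {x : E d}
    {w w' : E d → ℝ} (h : IsBary s x w) (h' : IsBary s x w') : w = w' := by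
  funext u
  by_cases hu : u ∈ s
  · have key := affineIndependent_iff.1 hs Finset.univ (fun i => w i - w' i)
      (by rw [Finset.sum_coe_sort s (fun i => w i - w' i), Finset.sum_sub_distrib, h.2.2.1,
        h'.2.2.1, sub_self])
      (by rw [Finset.sum_coe_sort s (fun i => (w i - w' i) • i)]
          simp only [sub_smul]
          rw [Finset.sum_sub_distrib, h.2.2.2, h'.2.2.2, sub_self])
      ⟨u, hu⟩ (Finset.mem_univ _)
    exact sub_eq_zero.1 key
  · rw [h.2.1 u hu, h'.2.1 u hu]

theorem IsBary.unique_of_faces {K : Geometry.SimplicialComplex ℝ (E d)} {s s' : Finset (E d)}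
    (hs : s ∈ K.faces) (hs' : s' ∈ K.faces) {x : E d} {w w' : E d → ℝ} (h : IsBary s x w)
    (h' : IsBary s' x w') : w = w' := by
  classical
  have mem : ∀ {t : Finset (E d)} {v : E d → ℝ}, IsBary t x v →
      x ∈ convexHull ℝ (t : Set (E d)) := fun hv =>
    (Finset.mem_convexHull').2 ⟨_, hv.1, hv.2.2.1, hv.2.2.2⟩
  have hx := K.inter_subset_convexHull hs hs' ⟨mem h, mem h'⟩
  rw [← Finset.coe_inter] at hx
  obtain ⟨v, v1, v2, v3⟩ := (Finset.mem_convexHull').1 hx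
  have hv : IsBary (s ∩ s') x (fun u => if u ∈ s ∩ s' then v u else 0) := by
    refine ⟨fun u hu => ?_, fun u hu => if_neg hu, ?_, ?_⟩
    · exact (v1 u hu).trans_eq (if_pos hu).symm
    · rw [← v2]; exact Finset.sum_congr rfl fun u hu => if_pos hu
    · rw [← v3]; exact Finset.sum_congr rfl fun u hu => congrArg (· • u) (if_pos hu)
  exact (h.unique (K.indep hs) (hv.mono Finset.inter_subset_left)).trans
    (h'.unique (K.indep hs') (hv.mono Finset.inter_subset_right)).symm

open Classical in
/-- The nodal ("hat") function of the vertex `v`: the barycentric coordinate of `x` at `v` in a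
simplex of the complex containing `x` (see `hat_eq`), and `0` outside the complex. -/
def hat (K : Geometry.SimplicialComplex ℝ (E d)) (v x : E d) : ℝ :=
  if h : ∃ w : E d → ℝ, ∃ s ∈ K.faces, IsBary s x w then h.choose v else 0

/-- On each simplex of the complex, `hat K v` is the barycentric coordinate at `v`. -/
theorem hat_eq {K : Geometry.SimplicialComplex ℝ (E d)} {s : Finset (E d)} (hs : s ∈ K.faces)
    {x : E d} {w : E d → ℝ} (h : IsBary s x w) (v : E d) : hat K v x = w v := by
  have hex : ∃ w : E d → ℝ, ∃ s ∈ K.faces, IsBary s x w := ⟨w, s, hs, h⟩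
  obtain ⟨s', hs', h'⟩ := hex.choose_spec
  rw [hat, dif_pos hex, IsBary.unique_of_faces hs' hs h' h]

/-- The scalar face bubble: product of the nodal functions of the vertices of `F`. -/
def bubble (K : Geometry.SimplicialComplex ℝ (E d)) (F : Finset (E d)) (x : E d) : ℝ :=
  ∏ v ∈ F, hat K v x

/-! ### The domain with its boundary parts and its triangulation -/

/-- A bounded open set `Ω ⊂ ℝ^d` with boundary parts `Γc`, `Γt`, partitioned into finitely many
`d`-simplices, together with a choice of a unit normal for every `(d-1)`-dimensional face. -/
structure MeshedDomain (d : ℕ) where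
  Ω : Set (E d)
  Γc : Set (E d)
  Γt : Set (E d)
  tri : Geometry.SimplicialComplex ℝ (E d)
  finite_faces : tri.faces.Finite
  /-- every face belongs to a `d`-dimensional simplex -/
  pure : ∀ s ∈ tri.faces, ∃ t ∈ tri.faces, s ⊆ t ∧ t.card = d + 1
  /-- the simplices cover exactly the closure of `Ω` -/
  interior_space : interior tri.space = Ω
  Γc_open : ∃ U, IsOpen U ∧ Γc = U ∩ frontier Ω
  Γt_open : ∃ U, IsOpen U ∧ Γt = U ∩ frontier Ω
  disjoint : Disjoint Γc Γt
  closure_union : closure Γc ∪ closure Γt = frontier Ω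
  Γc_measure : Measure.hausdorffMeasure ((d : ℝ) - 1) Γc ≠ 0
  Γt_measure : Measure.hausdorffMeasure ((d : ℝ) - 1) Γt ≠ 0
  normal : Finset (E d) → E d
  normal_norm : ∀ F ∈ tri.faces, F.card = d → ‖normal F‖ = 1
  normal_orth : ∀ F ∈ tri.faces, F.card = d →
    ∀ x ∈ F, ∀ y ∈ F, inner ℝ (normal F) (x - y) = 0

/-- Shape regularity: the diameter of every `d`-simplex is at most `σ` times the diameter of some
ball that it contains. -/
def MeshedDomain.ShapeRegular (m : MeshedDomain d) (σ : ℝ) : Prop :=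
  ∀ T ∈ m.tri.faces, T.card = d + 1 → ∃ (c : E d) (r : ℝ), 0 < r ∧
    Metric.closedBall c r ⊆ convexHull ℝ (T : Set (E d)) ∧
    Metric.diam (convexHull ℝ (T : Set (E d))) ≤ σ * (2 * r)

/-- The faces (edges for `d = 2`) that carry a bubble: those whose bubble satisfies the
Dirichlet condition on `Γc`. -/
def MeshedDomain.BubbleFace (m : MeshedDomain d) : Type :=
  {F : Finset (E d) // F ∈ m.tri.faces ∧ F.card = d ∧ ∀ x ∈ m.Γc, bubble m.tri F x = 0}

instance (m : MeshedDomain d) : Finite m.BubbleFace :=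
  (m.finite_faces.subset (fun _ h => h.1 :
    {F | F ∈ m.tri.faces ∧ F.card = d ∧ ∀ x ∈ m.Γc, bubble m.tri F x = 0} ⊆ m.tri.faces)).to_subtype

instance (m : MeshedDomain d) : Fintype m.BubbleFace := Fintype.ofFinite _

instance (m : MeshedDomain d) : DecidableEq m.BubbleFace := Classical.decEq _

/-- The vector bubble `b_F n_F`. -/
def MeshedDomain.bubbleField (m : MeshedDomain d) (F : m.BubbleFace) (x : E d) : E d :=
  bubble m.tri F.1 x • m.normal F.1

/-- `V_{h,1}`: continuous, piecewise linear vector fields on the closed domain that vanish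
on `Γc` (extended by zero outside). -/
def MeshedDomain.P1 (m : MeshedDomain d) : Submodule ℝ (E d → E d) where
  carrier := {v | ContinuousOn v m.tri.space ∧
    (∀ T ∈ m.tri.faces, ∃ A : E d →ᵃ[ℝ] E d, Set.EqOn v A (convexHull ℝ (T : Set (E d)))) ∧
    (∀ x ∉ m.tri.space, v x = 0) ∧ ∀ x ∈ m.Γc, v x = 0}
  add_mem' := by
    rintro u v ⟨hu1, hu2, hu3, hu4⟩ ⟨hv1, hv2, hv3, hv4⟩
    refine ⟨hu1.add hv1, fun T hT => ?_, fun x hx => ?_, fun x hx => ?_⟩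
    · obtain ⟨A, hA⟩ := hu2 T hT
      obtain ⟨B, hB⟩ := hv2 T hT
      exact ⟨A + B, fun x hx => by simp [hA hx, hB hx]⟩
    · simp [hu3 x hx, hv3 x hx]
    · simp [hu4 x hx, hv4 x hx]
  zero_mem' := ⟨continuousOn_const, fun _ _ => ⟨0, fun _ _ => by simp⟩,
    fun _ _ => rfl, fun _ _ => rfl⟩
  smul_mem' := by
    rintro c u ⟨hu1, hu2, hu3, hu4⟩
    refine ⟨hu1.const_smul c, fun T hT => ?_, fun x hx => ?_, fun x hx => ?_⟩
    · obtain ⟨A, hA⟩ := hu2 T hT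
      exact ⟨c • A, fun x hx => by simp [hA hx]⟩
    · simp [hu3 x hx]
    · simp [hu4 x hx]

/-- `V_b`: the span of the vector bubbles. -/
def MeshedDomain.Vb (m : MeshedDomain d) : Submodule ℝ (E d → E d) :=
  Submodule.span ℝ (Set.range m.bubbleField)

/-- `V_h = V_{h,1} + V_b`. -/
def MeshedDomain.Vh (m : MeshedDomain d) : Submodule ℝ (E d → E d) := m.P1 ⊔ m.Vb

/-! ### Parameters and discrete spaces -/

/-- The physical parameters (`perm` is the permeability tensor, `muf` the fluid viscosity) and the
time step `tau`. -/
structure BiotParameters (m : MeshedDomain d) where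
  lam : ℝ
  mu : ℝ
  alpha : ℝ
  M : ℝ
  muf : ℝ
  tau : ℝ
  perm : E d → Matrix (Fin d) (Fin d) ℝ
  lam_nonneg : 0 ≤ lam
  mu_pos : 0 < mu
  alpha_nonneg : 0 ≤ alpha
  M_pos : 0 < M
  muf_pos : 0 < muf
  tau_pos : 0 < tau
  perm_measurable : ∀ i j, Measurable fun x => perm x i j
  perm_symm : ∀ x ∈ m.Ω, (perm x).IsSymm
  /-- uniform ellipticity and boundedness -/
  perm_bounds : ∃ k₀ k₁ : ℝ, 0 < k₀ ∧ ∀ x ∈ m.Ω, ∀ ξ : Fin d → ℝ,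
    k₀ * (ξ ⬝ᵥ ξ) ≤ ξ ⬝ᵥ (perm x *ᵥ ξ) ∧ ξ ⬝ᵥ (perm x *ᵥ ξ) ≤ k₁ * (ξ ⬝ᵥ ξ)

/-- `ζ = √(λ + 2μ/d)`. -/
def BiotParameters.zeta {m : MeshedDomain d} (P : BiotParameters m) : ℝ :=
  √(P.lam + 2 * P.mu / d)

/-- `c_p = (α²/ζ² + 1/M)⁻¹`. -/
def BiotParameters.cp {m : MeshedDomain d} (P : BiotParameters m) : ℝ :=
  (P.alpha ^ 2 / P.zeta ^ 2 + 1 / P.M)⁻¹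

/-- Finite-dimensional spaces `Q_h ⊂ L²(Ω)` and `W_h ⊂ W = {w ∈ H(div, Ω) : w·n = 0 on Γc}`, with
bases of `V_{h,1}`, `Q_h`, `W_h`. An element of `W_h` is stored as the pair `(w, div w)`. -/
structure BiotSpaces (m : MeshedDomain d) where
  Qh : Submodule ℝ (L2 m.Ω)
  Wh : Submodule ℝ (L2vec m.Ω × L2 m.Ω)
  Wh_conforming : ∀ w ∈ Wh, MemHdiv m.Ω m.Γt w.1 w.2
  nl : ℕ
  nq : ℕ
  nw : ℕ
  basisL : Module.Basis (Fin nl) ℝ m.P1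
  basisQ : Module.Basis (Fin nq) ℝ Qh
  basisW : Module.Basis (Fin nw) ℝ Wh

/-! ### Stokes–Biot stability -/

/-- Poisson stability of `(W_h, Q_h)`: boundedness of both forms of the mixed
discretization of the Poisson equation, coercivity on the discrete kernel, and the inf-sup
condition. -/
def PoissonStable {Ω : Set (E d)} (Wh : Submodule ℝ (L2vec Ω × L2 Ω)) (Qh : Submodule ℝ (L2 Ω)) :
    Prop :=
  (∃ C : ℝ, ∀ w ∈ Wh, ∀ r ∈ Wh, |inner ℝ w.1 r.1| ≤ C * Hdivnorm w * Hdivnorm r) ∧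
  (∃ C : ℝ, ∀ w ∈ Wh, ∀ q ∈ Qh, |inner ℝ w.2 q| ≤ C * Hdivnorm w * ‖q‖) ∧
  (∃ a : ℝ, 0 < a ∧ ∀ w ∈ Wh, (∀ q ∈ Qh, inner ℝ w.2 q = 0) →
    a * Hdivnorm w ^ 2 ≤ inner ℝ w.1 w.1) ∧
  (∃ β : ℝ, 0 < β ∧ ∀ q ∈ Qh, q ≠ 0 → ∃ w ∈ Wh, w ≠ 0 ∧
    β * Hdivnorm w * ‖q‖ ≤ inner ℝ w.2 q)

/-- Stokes stability of `(V_h, Q_h)` with inf-sup constant `γ`: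
`sup_v (div v, q) / ‖v‖₁ ≥ γ ‖q‖` for all `q ∈ Q_h` (the supremum over a finite-dimensional space
is attained). -/
def StokesStable (Ω : Set (E d)) (Vh : Submodule ℝ (E d → E d)) (Qh : Submodule ℝ (L2 Ω))
    (γ : ℝ) : Prop :=
  ∀ q ∈ Qh, q ≠ 0 → ∃ v ∈ Vh, v ≠ 0 ∧
    γ * ‖q‖ * H1norm Ω v ≤ ∫ x in Ω, divergence v x * q x

/-- Stokes–Biot stability of `(V_h, W_h, Q_h)`: boundedness and coercivity of `a` on `V_h` in the
`H¹` norm, Poisson stability of `(W_h, Q_h)` and Stokes stability of `(V_h, Q_h)`. Only the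
Stokes inf-sup constant `γ` is recorded; the others are arbitrary. -/
structure StokesBiotStable {m : MeshedDomain d} (P : BiotParameters m) (X : BiotSpaces m)
    (γ : ℝ) : Prop where
  bounded : ∃ C : ℝ, ∀ u ∈ m.Vh, ∀ v ∈ m.Vh,
    |elasticity m.Ω P.lam P.mu u v| ≤ C * H1norm m.Ω u * H1norm m.Ω v
  coercive : ∃ a : ℝ, 0 < a ∧ ∀ u ∈ m.Vh,
    a * H1norm m.Ω u ^ 2 ≤ elasticity m.Ω P.lam P.mu u u
  poisson : PoissonStable X.Wh X.Qh
  stokes : StokesStable m.Ω m.Vh X.Qh γ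

/-! ### The matrices (rows: test functions, columns: trial functions) -/

section Matrices

variable {m : MeshedDomain d} (P : BiotParameters m) (X : BiotSpaces m)

def Abb : Matrix m.BubbleFace m.BubbleFace ℝ :=
  fun i j => elasticity m.Ω P.lam P.mu (m.bubbleField j) (m.bubbleField i)

def Abl : Matrix m.BubbleFace (Fin X.nl) ℝ :=
  fun i j => elasticity m.Ω P.lam P.mu (X.basisL j : E d → E d) (m.bubbleField i)

def All : Matrix (Fin X.nl) (Fin X.nl) ℝ :=
  fun i j => elasticity m.Ω P.lam P.mu (X.basisL j : E d → E d) (X.basisL i : E d → E d)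

/-- `D_bb = (d+1) diag(A_bb)`. -/
def Dbb : Matrix m.BubbleFace m.BubbleFace ℝ :=
  ((d : ℝ) + 1) • Matrix.diagonal (Abb P).diag

def Bb : Matrix (Fin X.nq) m.BubbleFace ℝ :=
  fun i j => - ∫ x in m.Ω, divergence (m.bubbleField j) x * (X.basisQ i : L2 m.Ω) x

def Bl : Matrix (Fin X.nq) (Fin X.nl) ℝ :=
  fun i j => - ∫ x in m.Ω, divergence (X.basisL j : E d → E d) x * (X.basisQ i : L2 m.Ω) x

def Mp : Matrix (Fin X.nq) (Fin X.nq) ℝ :=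
  fun i j => ∫ x in m.Ω, (X.basisQ j : L2 m.Ω) x * (X.basisQ i : L2 m.Ω) x

def Bw : Matrix (Fin X.nq) (Fin X.nw) ℝ :=
  fun i j => - ∫ x in m.Ω, (X.basisW j : L2vec m.Ω × L2 m.Ω).2 x * (X.basisQ i : L2 m.Ω) x

/-- `(K⁻¹ μ_f w, r)`. -/
def Mw : Matrix (Fin X.nw) (Fin X.nw) ℝ :=
  fun i j => ∫ x in m.Ω, P.muf *
    (((P.perm x)⁻¹ *ᵥ ((X.basisW j : L2vec m.Ω × L2 m.Ω).1 x).ofLp) ⬝ᵥ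
      ((X.basisW i : L2vec m.Ω × L2 m.Ω).1 x).ofLp)

/-- `A_w = B_wᵀ M_p⁻¹ B_w`. -/
def Aw : Matrix (Fin X.nw) (Fin X.nw) ℝ := (Bw X)ᵀ * (Mp X)⁻¹ * Bw X

/-- The unknowns: bubble and piecewise linear displacement, pressure, Darcy velocity. -/
abbrev Index (X : BiotSpaces m) : Type :=
  (m.BubbleFace ⊕ Fin X.nl) ⊕ (Fin X.nq ⊕ Fin X.nw)

/-- `A_u^D`, the displacement block with `A_bb` replaced by `D_bb`. -/
def AuD : Matrix (m.BubbleFace ⊕ Fin X.nl) (m.BubbleFace ⊕ Fin X.nl) ℝ :=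
  Matrix.fromBlocks (Dbb P) (Abl P X) (Abl P X)ᵀ (All P X)

/-- The system matrix
```
  D_bb     A_bl     α B_bᵀ      0
  A_blᵀ    A_ll     α B_lᵀ      0
 -α B_b   -α B_l   (1/M) M_p  -τ B_w
   0        0       τ B_wᵀ     τ M_w
```
-/
def systemD : Matrix (Index X) (Index X) ℝ :=
  Matrix.fromBlocks
    (AuD P X)
    (Matrix.fromBlocks (P.alpha • (Bb X)ᵀ) 0 (P.alpha • (Bl X)ᵀ) 0)
    (Matrix.fromBlocks (-(P.alpha • Bb X)) (-(P.alpha • Bl X)) 0 0)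
    (Matrix.fromBlocks ((1 / P.M) • Mp X) (-(P.tau • Bw X)) (P.tau • (Bw X)ᵀ) (P.tau • Mw P X))

/-- The block diagonal matrix `𝒟 = diag(A_u^D, (α²/ζ² + 1/M) M_p, τ M_w + τ² c_p A_w)`. -/
def normD : Matrix (Index X) (Index X) ℝ :=
  Matrix.fromBlocks (AuD P X) 0 0
    (Matrix.fromBlocks ((P.alpha ^ 2 / P.zeta ^ 2 + 1 / P.M) • Mp X) 0 0
      (P.tau • Mw P X + (P.tau ^ 2 * P.cp) • Aw X))

/-- `‖x‖_𝒟 = (𝒟 x, x)^{1/2}`. -/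
def weightedNorm (x : Index X → ℝ) : ℝ := √((normD P X *ᵥ x) ⬝ᵥ x)

end Matrices

end Biot

end

/-! The proof combines an abstract argument about three bilinear forms with a finite element
estimate that makes its constants uniform.

Let `a` be the form of A_u^D, `b` the coupling -(div u, p), S = M_p⁻¹ B_w and k = α²/ζ² + 1/M =
c_p⁻¹. The squared norm of (u, p, w) is a(u,u) + k‖p‖² + τ m_w(w,w) + τ² k⁻¹ ‖Sw‖². Boundedness is
Cauchy–Schwarz on each of the seven terms (`sysForm_le`). For the inf-sup bound, taking the trial
vector equal to the test vector (v, q, r) cancels the skew couplings and leaves a(v,v) + ‖q‖²/M + τ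
m_w(r,r). The missing α²/ζ² ‖q‖² comes from adding to v a small multiple of a Stokes lift of q, and
the missing ‖Sr‖² from adding to q a multiple of Sr. Young's inequality absorbs the cross terms
(`exists_le_sysForm`). Two facts are needed: (1) ζ² b(u,q)² ≤ a(u,u) ‖q‖²; (2) each q has a lift z
with -b(z,q) = ‖q‖² and a(z,z) ≤ (Cζ)² ‖q‖².

Fact (1): pointwise, (λ + 2μ/d)(div u)² is at most the elastic density (`le_energyForm`), and the
elastic energy is at most the A_u^D energy, because at almost every point at most d+1 bubbles have
nonzero gradient (`energy_le_AuD`).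

Fact (2): Stokes stability gives a lift bounded in the H¹ norm, so A_u^D must be bounded by ζ²‖·‖₁²
(`AuD_le`). The elastic density is at most dζ²|∇u|², so it remains to control the bubble part by the
H¹ seminorm of the whole field (`exists_sum_bubble_le`). On one simplex, a combination of face
polynomials plus a linear function has zero gradient only if it is trivial (`faceGrad_eq_zero`).
Finite dimension turns this into an estimate on a reference simplex, and affine scaling gives |T|
c_F² ≤ C diam(T)² ∫_T |∇u|². The gradient energy of a bubble on T is at most |T| d (d/r)² if T
contains a ball of radius r, and shape regularity bounds diam(T)/r.

Definiteness of 𝒟 rests on coercivity of the elasticity form together with `dispField_coeff_eq_zero`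
and `fluxField_eq_zero`: fields that vanish have zero coefficients. -/

noncomputable section

namespace Biot

/-! ### Boundedness and inf-sup bound for the abstract three-field form -/

section Abstract

variable {U Q W : Type*} [AddCommGroup U] [Module ℝ U] [AddCommGroup Q] [Module ℝ Q]
  [AddCommGroup W] [Module ℝ W]

/-- The bilinear form of the three-field system, with `S` the discrete divergence. -/
def sysForm (a : LinearMap.BilinForm ℝ U) (mp : LinearMap.BilinForm ℝ Q)
    (mw : LinearMap.BilinForm ℝ W) (b : U →ₗ[ℝ] Q →ₗ[ℝ] ℝ) (S : W →ₗ[ℝ] Q) (α M τ : ℝ)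
    (u : U) (p : Q) (w : W) (v : U) (q : Q) (r : W) : ℝ :=
  a u v + α * b v p - α * b u q + 1 / M * mp p q - τ * mp (S w) q + τ * mp (S r) p + τ * mw w r

/-- The square of the weighted norm. -/
def sqNorm (a : LinearMap.BilinForm ℝ U) (mp : LinearMap.BilinForm ℝ Q)
    (mw : LinearMap.BilinForm ℝ W) (S : W →ₗ[ℝ] Q) (k τ : ℝ) (u : U) (p : Q) (w : W) : ℝ :=
  a u u + k * mp p p + τ * mw w w + τ ^ 2 * k⁻¹ * mp (S w) (S w)

theorem le_sqrt_mul_sqrt_of_sq_le {t x y X Y : ℝ} (h : t ^ 2 ≤ x * y) (hx : 0 ≤ x)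
    (hy : 0 ≤ y) (hX : x ≤ X) (hY : y ≤ Y) : |t| ≤ √X * √Y := by
  rw [← Real.sqrt_mul (hx.trans hX)]
  exact Real.abs_le_sqrt (h.trans (mul_le_mul hX hY hy (hx.trans hX)))

variable {a : LinearMap.BilinForm ℝ U} {mp : LinearMap.BilinForm ℝ Q}
  {mw : LinearMap.BilinForm ℝ W} {b : U →ₗ[ℝ] Q →ₗ[ℝ] ℝ} {S : W →ₗ[ℝ] Q} {α ζ M τ : ℝ}

/-- Each of the seven terms is a pairing of one part of the first norm with one part of the second,
by Cauchy–Schwarz. The weight k dominates both α²/ζ², which the displacement coupling needs, and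
1/M; the flux coupling splits τ as (τ k^(-1/2)) · k^(1/2). -/
theorem sysForm_le (ha : ∀ u, 0 ≤ a u u) (has : LinearMap.IsSymm a)
    (hp : ∀ q, 0 ≤ mp q q) (hps : LinearMap.IsSymm mp)
    (hw : ∀ w, 0 ≤ mw w w) (hws : LinearMap.IsSymm mw)
    (hζ : 0 < ζ) (hM : 0 < M) (hτ : 0 < τ)
    (hb : ∀ u q, ζ ^ 2 * (b u q) ^ 2 ≤ a u u * mp q q) (u : U) (p : Q) (w : W) (v : U)
    (q : Q) (r : W) :
    sysForm a mp mw b S α M τ u p w v q r ≤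
      7 * √(sqNorm a mp mw S (α ^ 2 / ζ ^ 2 + 1 / M) τ u p w) *
        √(sqNorm a mp mw S (α ^ 2 / ζ ^ 2 + 1 / M) τ v q r) := by
  set k := α ^ 2 / ζ ^ 2 + 1 / M with hk
  have hαζ : 0 ≤ α ^ 2 / ζ ^ 2 := by positivity
  have hM' : 0 < 1 / M := by positivity
  have hkpos : 0 < k := by positivity
  have n1 := ha u
  have n2 := ha v
  have n3 := hp p
  have n4 := hp q
  have n5 := hw w
  have n6 := hw r
  have n7 := hp (S w)
  have n8 := hp (S r)
  have part : ∀ u p w, a u u ≤ sqNorm a mp mw S k τ u p w ∧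
      k * mp p p ≤ sqNorm a mp mw S k τ u p w ∧ τ * mw w w ≤ sqNorm a mp mw S k τ u p w ∧
      τ ^ 2 * k⁻¹ * mp (S w) (S w) ≤ sqNorm a mp mw S k τ u p w := by
    intro u p w
    have h1 := ha u
    have h2 : 0 ≤ k * mp p p := mul_nonneg hkpos.le (hp p)
    have h3 : 0 ≤ τ * mw w w := mul_nonneg hτ.le (hw w)
    have h4 : 0 ≤ τ ^ 2 * k⁻¹ * mp (S w) (S w) := mul_nonneg (by positivity) (hp _)
    unfold sqNorm
    refine ⟨?_, ?_, ?_, ?_⟩ <;> linarith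
  obtain ⟨x1, x2, x3, x4⟩ := part u p w
  obtain ⟨y1, y2, y3, y4⟩ := part v q r
  have hbk : ∀ u q, (α * b u q) ^ 2 ≤ a u u * (k * mp q q) := by
    intro u q
    have h := hb u q
    have h' : (α * b u q) ^ 2 ≤ a u u * (α ^ 2 / ζ ^ 2 * mp q q) := by
      have e : (α * b u q) ^ 2 = α ^ 2 / ζ ^ 2 * (ζ ^ 2 * (b u q) ^ 2) := by
        field_simp
      rw [e]
      calc _ ≤ α ^ 2 / ζ ^ 2 * (a u u * mp q q) := mul_le_mul_of_nonneg_left h hαζ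
        _ = _ := by ring
    refine h'.trans (mul_le_mul_of_nonneg_left ?_ (ha u))
    exact mul_le_mul_of_nonneg_right (by linarith) (hp q)
  have hcp : ∀ p q, (mp p q) ^ 2 ≤ mp p p * mp q q := mp.apply_sq_le_of_symm hp hps
  have hS : ∀ w q, (τ * mp (S w) q) ^ 2 ≤ (τ ^ 2 * k⁻¹ * mp (S w) (S w)) * (k * mp q q) := by
    intro w q
    calc _ = τ ^ 2 * (mp (S w) q) ^ 2 := by ring
      _ ≤ τ ^ 2 * (mp (S w) (S w) * mp q q) := by gcongr; exact hcp _ _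
      _ = _ := by field_simp
  have t1 := le_sqrt_mul_sqrt_of_sq_le (a.apply_sq_le_of_symm ha has u v) n1 n2 x1 y1
  have t2 := le_sqrt_mul_sqrt_of_sq_le (hbk v p) n2 (by positivity) y1 x2
  have t3 := le_sqrt_mul_sqrt_of_sq_le (hbk u q) n1 (by positivity) x1 y2
  have t4 := le_sqrt_mul_sqrt_of_sq_le (t := 1 / M * mp p q) (x := k * mp p p) (y := k * mp q q)
    (by
      calc _ = (1 / M) * (1 / M) * (mp p q) ^ 2 := by ring
        _ ≤ k * k * (mp p p * mp q q) := by
          gcongr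
          · linarith
          · linarith
          · exact hcp _ _
        _ = _ := by ring) (by positivity) (by positivity) x2 y2
  have t5 := le_sqrt_mul_sqrt_of_sq_le (hS w q) (by positivity) (by positivity) x4 y2
  have t6 := le_sqrt_mul_sqrt_of_sq_le (hS r p) (by positivity) (by positivity) y4 x2
  have t7 := le_sqrt_mul_sqrt_of_sq_le (t := τ * mw w r) (x := τ * mw w w) (y := τ * mw r r)
    (by
      calc _ = τ * τ * (mw w r) ^ 2 := by ring
        _ ≤ τ * τ * (mw w w * mw r r) := by
          gcongr
          exact mw.apply_sq_le_of_symm hw hws w r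
        _ = _ := by ring) (by positivity) (by positivity) x3 y3
  unfold sysForm
  rw [mul_comm (√_)] at t2 t6
  rw [mul_assoc]
  linarith [le_abs_self (a u v), le_abs_self (α * b v p), neg_abs_le (α * b u q),
    le_abs_self (1 / M * mp p q), neg_abs_le (τ * mp (S w) q), le_abs_self (τ * mp (S r) p),
    le_abs_self (τ * mw w r)]

theorem neg_le_of_sq_le_mul {t s x y : ℝ} (hs : 0 ≤ s) (h : t ^ 2 ≤ x * y)
    (hxy : x * y ≤ s ^ 2) : -s ≤ t :=
  (abs_le.1 (abs_le_of_sq_le_sq (h.trans hxy) hs)).1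

/-- The skew couplings cancel when trial and test agree, so only the diagonal and the terms produced
by the two perturbations survive. -/
theorem sysForm_add_smul (v z : U) (q : Q) (r : W) (s t : ℝ) :
    sysForm a mp mw b S α M τ (v + s • z) (q + t • S r) r v q r =
      a v v + 1 / M * mp q q + τ * mw r r - α * (s * b z q) + τ * (t * mp (S r) (S r)) +
        s * a z v + t * (α * b v (S r)) + t * (1 / M * mp (S r) q) := by
  simp only [sysForm, map_add, LinearMap.add_apply, map_smul, LinearMap.smul_apply, smul_eq_mul]
  ring

theorem bilin_add_smul_self_le (f : LinearMap.BilinForm ℝ U) (hf : ∀ x, 0 ≤ f x x) (x y : U)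
    (c : ℝ) : f (x + c • y) (x + c • y) ≤ 2 * f x x + 2 * (c ^ 2 * f y y) := by
  have := hf (x - c • y)
  simp only [map_add, map_sub, LinearMap.add_apply, LinearMap.sub_apply, map_smul,
    LinearMap.smul_apply, smul_eq_mul] at this ⊢
  nlinarith

/-- The trial vector is (v + s z, q + t S r, r) with z the lift of q. Its squared norm is at most 4
times that of (v, q, r), which turns the quadratic lower bound into the inf-sup bound. The quadratic
bound is kept as a second conclusion because it shows that the trial vector is nonzero. -/
theorem exists_le_sysForm {C : ℝ} (hC : 1 ≤ C) (ha : ∀ u, 0 ≤ a u u) (has : LinearMap.IsSymm a)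
    (hp : ∀ q, 0 ≤ mp q q) (hps : LinearMap.IsSymm mp)
    (hw : ∀ w, 0 ≤ mw w w)
    (hζ : 0 < ζ) (hM : 0 < M) (hτ : 0 < τ)
    (hb : ∀ u q, ζ ^ 2 * (b u q) ^ 2 ≤ a u u * mp q q)
    (hstokes : ∀ q, ∃ u, -b u q = mp q q ∧ a u u ≤ (C * ζ) ^ 2 * mp q q)
    (v : U) (q : Q) (r : W) :
    ∃ u p w, 1 / (8 * C ^ 2) * √(sqNorm a mp mw S (α ^ 2 / ζ ^ 2 + 1 / M) τ u p w) *
        √(sqNorm a mp mw S (α ^ 2 / ζ ^ 2 + 1 / M) τ v q r) ≤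
        sysForm a mp mw b S α M τ u p w v q r ∧
      1 / (4 * C ^ 2) * sqNorm a mp mw S (α ^ 2 / ζ ^ 2 + 1 / M) τ v q r ≤
        sysForm a mp mw b S α M τ u p w v q r := by
  obtain ⟨z, hz1, hz2⟩ := hstokes q
  set k := α ^ 2 / ζ ^ 2 + 1 / M with hk
  have hαζ : 0 ≤ α ^ 2 / ζ ^ 2 := by positivity
  have hM' : 0 < 1 / M := by positivity
  have hkpos : 0 < k := by positivity
  -- This δ satisfies δC² = 1/2, so that s² a(z,z) ≤ (δ/2) G: the lift costs only half of the term
  -- δG that it gains.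
  set δ : ℝ := 1 / (2 * C ^ 2) with hδ
  have hδpos : 0 < δ := by positivity
  have hδC : δ * C ^ 2 = 1 / 2 := by rw [hδ]; field_simp
  have hδle : δ ≤ 1 / 2 := by nlinarith [one_le_pow₀ hC (n := 2)]
  have n2 := ha v
  have n4 := hp q
  have n6 := hw r
  have n8 := hp (S r)
  set A := a v v with hA
  set G := α ^ 2 / ζ ^ 2 * mp q q with hG
  set m := 1 / M * mp q q with hm
  set R := τ ^ 2 * k⁻¹ * mp (S r) (S r) with hR
  set T := τ * mw r r with hT
  have G0 : 0 ≤ G := by positivity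
  have m0 : 0 ≤ m := by positivity
  have R0 : 0 ≤ R := by positivity
  have T0 : 0 ≤ T := by positivity
  have hN : sqNorm a mp mw S k τ v q r = A + (G + m) + T + R := by
    simp only [sqNorm, hA, hG, hm, hR, hT, hk]; ring
  have hcp : ∀ p q, (mp p q) ^ 2 ≤ mp p p * mp q q := mp.apply_sq_le_of_symm hp hps
  -- With these factors -α s b(z,q) = δG and τ t ‖Sr‖² = R/2.
  set s : ℝ := δ * (α / ζ ^ 2) with hs
  set t : ℝ := 1 / 2 * (τ * k⁻¹) with ht
  have hsz : s ^ 2 * a z z ≤ δ / 2 * G := by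
    calc s ^ 2 * a z z ≤ s ^ 2 * ((C * ζ) ^ 2 * mp q q) := by gcongr
      _ = δ * (δ * C ^ 2) * G := by rw [hs, hG]; field_simp
      _ = _ := by rw [hδC]; ring
  have htR : t ^ 2 * (k * mp (S r) (S r)) = R / 4 := by
    rw [ht, hR]; field_simp; ring
  -- The three cross terms together use 3/4 of A, half of m, half of δG and half of R/2. A positive
  -- share of every part remains.
  have e1 : -(A / 4 + δ / 2 * G) ≤ s * a z v := by
    refine neg_le_of_sq_le_mul (by positivity) (x := A) (y := δ / 2 * G) ?_ ?_
    · calc (s * a z v) ^ 2 = s ^ 2 * (a z v) ^ 2 := by ring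
        _ ≤ s ^ 2 * (a z z * a v v) := by gcongr; exact a.apply_sq_le_of_symm ha has z v
        _ = A * (s ^ 2 * a z z) := by rw [hA]; ring
        _ ≤ _ := by gcongr
    · linarith [sq_nonneg (A / 4 - δ / 2 * G)]
  have e2 : -(A / 2 + R / 8) ≤ t * (α * b v (S r)) := by
    refine neg_le_of_sq_le_mul (by positivity) (x := A) (y := R / 4) ?_ ?_
    · have h := hb v (S r)
      calc (t * (α * b v (S r))) ^ 2
          = t ^ 2 * (α ^ 2 / ζ ^ 2 * (ζ ^ 2 * (b v (S r)) ^ 2)) := by field_simp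
        _ ≤ t ^ 2 * (k * (a v v * mp (S r) (S r))) := by
            gcongr
            linarith
        _ = A * (t ^ 2 * (k * mp (S r) (S r))) := by rw [hA]; ring
        _ = _ := by rw [htR]
    · linarith [sq_nonneg (A / 2 - R / 8)]
  have e3 : -(m / 2 + R / 8) ≤ t * (1 / M * mp (S r) q) := by
    refine neg_le_of_sq_le_mul (by positivity) (x := m) (y := R / 4) ?_ ?_
    · calc (t * (1 / M * mp (S r) q)) ^ 2 = t ^ 2 * (1 / M * (1 / M * (mp (S r) q) ^ 2)) := by ring
        _ ≤ t ^ 2 * (k * (1 / M * (mp (S r) (S r) * mp q q))) := by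
            gcongr
            · linarith
            · exact hcp _ _
        _ = m * (t ^ 2 * (k * mp (S r) (S r))) := by rw [hm]; ring
        _ = _ := by rw [htR]
    · linarith [sq_nonneg (m / 2 - R / 8)]
  have hsys : sysForm a mp mw b S α M τ (v + s • z) (q + t • S r) r v q r =
      A + m + T + δ * G + 1 / 2 * R + s * a z v + t * (α * b v (S r)) +
        t * (1 / M * mp (S r) q) := by
    have e : α * (s * b z q) = - (δ * G) := by
      rw [show b z q = - mp q q by linarith, hs, hG]; ring
    have e' : τ * (t * mp (S r) (S r)) = 1 / 2 * R := by rw [ht, hR]; ring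
    rw [sysForm_add_smul, e, e']
    ring
  have hlow : δ / 2 * (A + (G + m) + T + R) ≤
      sysForm a mp mw b S α M τ (v + s • z) (q + t • S r) r v q r := by
    rw [hsys]
    linarith [mul_nonneg (sub_nonneg.2 hδle) n2, mul_nonneg (sub_nonneg.2 hδle) m0,
      mul_nonneg (sub_nonneg.2 hδle) R0, mul_nonneg (sub_nonneg.2 hδle) T0]
  have hup : sqNorm a mp mw S k τ (v + s • z) (q + t • S r) r ≤
      4 * (A + (G + m) + T + R) := by
    have h1 := bilin_add_smul_self_le a ha v z s
    have h2 := mul_le_mul_of_nonneg_left (bilin_add_smul_self_le mp hp q (S r) t) hkpos.le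
    have h3 : k * mp q q = G + m := by rw [hG, hm, hk]; ring
    unfold sqNorm
    have h4 : δ * G ≤ G := mul_le_of_le_one_left G0 (by linarith)
    have h5 : k * (2 * mp q q + 2 * (t ^ 2 * mp (S r) (S r))) = 2 * (G + m) + R / 2 := by
      linear_combination 2 * h3 + 2 * htR
    linarith
  refine ⟨v + s • z, q + t • S r, r, ?_, ?_⟩
  · refine le_trans ?_ hlow
    rw [hN]
    set N := A + (G + m) + T + R
    have N0 : 0 ≤ N := by positivity
    have h2 : √(sqNorm a mp mw S k τ (v + s • z) (q + t • S r) r) ≤ 2 * √N := by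
      refine (Real.sqrt_le_sqrt hup).trans_eq ?_
      rw [Real.sqrt_mul (by norm_num), show (4 : ℝ) = 2 ^ 2 by norm_num,
        Real.sqrt_sq (by norm_num)]
    calc _ ≤ 1 / (8 * C ^ 2) * (2 * √N) * √N := by gcongr
      _ = δ / 2 * (√N * √N) := by rw [hδ]; field_simp; ring
      _ = _ := by rw [Real.mul_self_sqrt N0]
  · rw [hN]
    refine le_trans (le_of_eq ?_) hlow
    rw [hδ]; field_simp; ring

end Abstract

variable {d : ℕ}

/-! ### Face polynomials on a single simplex and affine scaling -/

section Reference

set_option linter.unusedSectionVars false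

variable {ι : Type*} [Fintype ι] [DecidableEq ι]

/-- The product of the barycentric coordinates of all vertices but `i`. -/
def facePoly (b : AffineBasis ι ℝ (E d)) (i : ι) (x : E d) : ℝ :=
  ∏ j ∈ Finset.univ.erase i, b.coord j x

theorem contDiff_facePoly (b : AffineBasis ι ℝ (E d)) (i : ι) : ContDiff ℝ ∞ (facePoly b i) :=
  contDiff_prod fun j _ => (smooth_barycentric_coord b j).of_le (by simp)

theorem differentiable_facePoly (b : AffineBasis ι ℝ (E d)) (i : ι) :
    Differentiable ℝ (facePoly b i) :=
  (contDiff_facePoly b i).differentiable (by simp)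

/-- The derivative of `∑ cᵢ βᵢ + g`, where `βᵢ` are the face polynomials. -/
def faceGrad (b : AffineBasis ι ℝ (E d)) (c : ι → ℝ) (g : E d →L[ℝ] ℝ) (x : E d) : E d →L[ℝ] ℝ :=
  ∑ i, c i • fderiv ℝ (facePoly b i) x + g

theorem continuous_faceGrad (b : AffineBasis ι ℝ (E d)) (c : ι → ℝ) (g : E d →L[ℝ] ℝ) :
    Continuous (faceGrad b c g) :=
  (continuous_finsetSum _ fun i _ =>
    ((contDiff_facePoly b i).continuous_fderiv (by simp)).const_smul (c i)).add continuous_const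

theorem hasFDerivAt_faceSum (b : AffineBasis ι ℝ (E d)) (c : ι → ℝ) (g : E d →L[ℝ] ℝ) (x : E d) :
    HasFDerivAt (fun x => ∑ i, c i * facePoly b i x + g x) (faceGrad b c g x) x :=
  (HasFDerivAt.fun_sum fun i _ =>
    ((differentiable_facePoly b i x).hasFDerivAt.const_mul (c i))).add g.hasFDerivAt

/-- With at least three vertices there is an index j different from i and k, and its factor vanishes
at vertex k. In dimension one this fails, since a face polynomial is then a single coordinate. -/
theorem facePoly_vertex (b : AffineBasis ι ℝ (E d)) (hd : 2 < Fintype.card ι) (i k : ι) :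
    facePoly b i (b k) = 0 := by
  obtain ⟨j, hj⟩ : ∃ j, j ∉ ({i, k} : Finset ι) := by
    by_contra! h
    have := Finset.card_le_card (Finset.subset_iff.2 fun j (_ : j ∈ Finset.univ) => h j)
    have h2 := Finset.card_le_two (a := i) (b := k)
    rw [Finset.card_univ] at this
    omega
  simp only [Finset.mem_insert, Finset.mem_singleton, not_or] at hj
  exact Finset.prod_eq_zero (Finset.mem_erase.2 ⟨hj.1, Finset.mem_univ j⟩)
    (b.coord_apply_ne hj.2)

theorem compact_hull (b : AffineBasis ι ℝ (E d)) : IsCompact (convexHull ℝ (Set.range b)) :=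
  (Set.finite_range b).isCompact_convexHull ℝ

theorem hull_subset_closure_interior (b : AffineBasis ι ℝ (E d)) :
    convexHull ℝ (Set.range b) ⊆ closure (interior (convexHull ℝ (Set.range b))) := by
  have hne : (interior (convexHull ℝ (Set.range b))).Nonempty :=
    interior_convexHull_nonempty_iff_affineSpan_eq_top.2 b.tot
  rw [(convex_convexHull ℝ _).closure_interior_eq_closure_of_nonempty_interior hne]
  exact subset_closure

/-- The function ∑ cᵢβᵢ + g is constant on the simplex. At the vertices the βᵢ vanish, so g takes
one value there, and by linearity the same value at the centroid of face i. At that centroid only βᵢ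
is nonzero, which forces cᵢ = 0. -/
theorem faceGrad_eq_zero (b : AffineBasis ι ℝ (E d)) (hd : 2 < Fintype.card ι) {c : ι → ℝ}
    {g : E d →L[ℝ] ℝ} (h : ∀ x ∈ convexHull ℝ (Set.range b), faceGrad b c g x = 0) :
    c = 0 ∧ g = 0 := by
  have hconst : ∀ x ∈ convexHull ℝ (Set.range b), ∀ y ∈ convexHull ℝ (Set.range b),
      ∑ i, c i * facePoly b i y + g y = ∑ i, c i * facePoly b i x + g x := by
    intro x hx y hy
    have := (convex_convexHull ℝ (Set.range b)).norm_image_sub_le_of_norm_hasFDerivWithin_le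
      (C := 0) (fun x _ => (hasFDerivAt_faceSum b c g x).hasFDerivWithinAt)
      (fun x hx => by rw [h x hx, norm_zero]) hx hy
    rw [zero_mul] at this
    exact sub_eq_zero.1 (norm_le_zero_iff.1 this)
  obtain ⟨k₀⟩ := b.nonempty
  have hmem : ∀ k, b k ∈ convexHull ℝ (Set.range b) := fun k =>
    subset_convexHull ℝ _ (Set.mem_range_self k)
  have hg : ∀ k, g (b k) = g (b k₀) := by
    intro k
    have := hconst _ (hmem k₀) _ (hmem k)
    simpa [facePoly_vertex b hd] using this
  have hc : ∀ i, c i = 0 := by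
    intro i
    set s := Finset.univ.erase i with hs
    have hcard : s.card = Fintype.card ι - 1 := by
      rw [hs, Finset.card_erase_of_mem (Finset.mem_univ i), Finset.card_univ]
    have hpos : (0 : ℝ) < s.card := by
      rw [hcard]; exact_mod_cast (by omega : 0 < Fintype.card ι - 1)
    have hne : s.Nonempty := Finset.card_pos.1 (by exact_mod_cast hpos)
    set p := s.centroid ℝ b with hp
    have hps : p = ∑ j ∈ s, (s.card : ℝ)⁻¹ • b j := by
      rw [hp, Finset.centroid, Finset.affineCombination_eq_linear_combination _ _ _
        (s.sum_centroidWeights_eq_one_of_nonempty ℝ hne)]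
      simp
    have hpc : ∀ j ∈ s, b.coord j p = (s.card : ℝ)⁻¹ := fun j hj => b.coord_apply_centroid hj
    have hpi : b.coord i p = 0 := by
      rw [hp, Finset.centroid, b.coord_apply_combination_of_notMem (Finset.notMem_erase i _)
        (s.sum_centroidWeights_eq_one_of_nonempty ℝ hne)]
    have hpm : p ∈ convexHull ℝ (Set.range b) := by
      rw [b.convexHull_eq_nonneg_coord]
      intro j
      by_cases hj : j = i
      · rw [hj, hpi]
      · rw [hpc j (Finset.mem_erase.2 ⟨hj, Finset.mem_univ j⟩)]; positivity
    have hgp : g p = g (b k₀) := by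
      rw [hps, map_sum]
      simp only [map_smul, hg, smul_eq_mul, Finset.sum_const, nsmul_eq_mul]
      field_simp
    have h1 := hconst _ (hmem k₀) _ hpm
    rw [hgp] at h1
    simp only [facePoly_vertex b hd, mul_zero, Finset.sum_const_zero, zero_add,
      add_eq_right] at h1
    rw [Finset.sum_eq_single i] at h1
    · have h2 : facePoly b i p ≠ 0 := by
        rw [facePoly, Finset.prod_congr rfl hpc, Finset.prod_const]
        positivity
      exact (mul_eq_zero.1 h1).resolve_right h2
    · intro j _ hj
      rw [facePoly, Finset.prod_eq_zero (Finset.mem_erase.2 ⟨hj.symm, Finset.mem_univ i⟩) hpi,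
        mul_zero]
    · simp
  have hc' : c = 0 := funext hc
  refine ⟨hc', ?_⟩
  have := h _ (hmem k₀)
  simpa [faceGrad, hc'] using this

theorem memLp_faceGrad (b : AffineBasis ι ℝ (E d)) (c : ι → ℝ) (g : E d →L[ℝ] ℝ) :
    MemLp (faceGrad b c g) 2 (volume.restrict (convexHull ℝ (Set.range b))) := by
  have hK := compact_hull b
  have hcont := continuous_faceGrad b c g
  obtain ⟨C, hC⟩ := hK.exists_bound_of_continuousOn hcont.continuousOn
  have : IsFiniteMeasure (volume.restrict (convexHull ℝ (Set.range b))) :=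
    ⟨by rw [Measure.restrict_apply_univ]; exact hK.measure_lt_top⟩
  exact MemLp.of_bound hcont.aestronglyMeasurable C
    ((ae_restrict_iff' hK.measurableSet).2 (ae_of_all _ hC))

theorem norm_toLp_sq {X F : Type*} [MeasurableSpace X] [NormedAddCommGroup F] {μ : Measure X}
    {f : X → F} (hf : MemLp f 2 μ) : ‖hf.toLp f‖ ^ 2 = ∫ x, ‖f x‖ ^ 2 ∂μ := by
  rw [Lp.norm_toLp, hf.eLpNorm_eq_integral_rpow_norm (by simp) (by simp),
    ENNReal.toReal_ofReal (by positivity), ← Real.rpow_natCast, ← Real.rpow_mul (by positivity)]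
  simp

/-- The bubble coefficients are controlled by the gradient on a fixed simplex. -/
theorem exists_coeff_sq_le (b : AffineBasis ι ℝ (E d)) (hd : 2 < Fintype.card ι) :
    ∃ C : ℝ, 0 < C ∧ ∀ (c : ι → ℝ) (g : E d →L[ℝ] ℝ) (i : ι),
      c i ^ 2 ≤ C * ∫ x in convexHull ℝ (Set.range b), ‖faceGrad b c g x‖ ^ 2 := by
  -- The domain is finite-dimensional, so injectivity into L² already gives a lower bound, with the
  -- antilipschitz constant as constant.
  let Φ : ((ι → ℝ) × (E d →L[ℝ] ℝ)) →ₗ[ℝ]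
      Lp (E d →L[ℝ] ℝ) 2 (volume.restrict (convexHull ℝ (Set.range b))) :=
    { toFun := fun p => (memLp_faceGrad b p.1 p.2).toLp _
      map_add' := by
        intro p q
        rw [← MemLp.toLp_add]
        congr 1
        funext x
        simp only [faceGrad, Pi.add_apply, Prod.fst_add, Prod.snd_add, add_smul,
          Finset.sum_add_distrib]
        abel
      map_smul' := by
        intro t p
        rw [RingHom.id_apply, ← MemLp.toLp_const_smul]
        congr 1
        funext x
        simp only [faceGrad, Pi.smul_apply, Prod.smul_fst, Prod.smul_snd, smul_add,
          Finset.smul_sum, smul_smul, smul_eq_mul] }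
  have hinj : Function.Injective Φ := by
    rw [← LinearMap.ker_eq_bot, LinearMap.ker_eq_bot']
    rintro ⟨c, g⟩ h
    have h0 : (memLp_faceGrad b c g).toLp _ = 0 := h
    have h1 : faceGrad b c g =ᵐ[volume.restrict (convexHull ℝ (Set.range b))] 0 :=
      ((memLp_faceGrad b c g).coeFn_toLp.symm.trans (by rw [h0])).trans (Lp.coeFn_zero _ _ _)
    -- A continuous function that vanishes almost everywhere vanishes on the whole closed simplex,
    -- which lies in the closure of its interior.
    have h2 := Measure.eqOn_of_ae_eq h1 (continuous_faceGrad b c g).continuousOn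
      continuousOn_const (hull_subset_closure_interior b)
    obtain ⟨hc, hg⟩ := faceGrad_eq_zero b hd h2
    rw [hc, hg]; rfl
  obtain ⟨K, hK, hΦ⟩ := Φ.injective_iff_antilipschitz.1 hinj
  refine ⟨(K : ℝ) ^ 2, by positivity, fun c g i => ?_⟩
  have h1 := hΦ.le_mul_norm (map_zero Φ) (c, g)
  have h2 : |c i| ≤ ‖((c, g) : (ι → ℝ) × (E d →L[ℝ] ℝ))‖ :=
    (norm_le_pi_norm c i).trans (norm_fst_le (c, g))
  rw [← norm_toLp_sq (memLp_faceGrad b c g), ← mul_pow, ← sq_abs]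
  exact pow_le_pow_left₀ (abs_nonneg _) (h2.trans h1) 2

/-- The affine map between two simplices. -/
def simplexMap (b b' : AffineBasis ι ℝ (E d)) (x : E d) : E d := ∑ j, b.coord j x • b' j

theorem coord_simplexMap (b b' : AffineBasis ι ℝ (E d)) (x : E d) (j : ι) :
    b'.coord j (simplexMap b b' x) = b.coord j x := by
  rw [simplexMap, ← Finset.affineCombination_eq_linear_combination _ _ _
    (b.sum_coord_apply_eq_one x)]
  exact b'.coord_apply_combination_of_mem (Finset.mem_univ j) (b.sum_coord_apply_eq_one x)

theorem simplexMap_simplexMap (b b' : AffineBasis ι ℝ (E d)) (x : E d) :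
    simplexMap b' b (simplexMap b b' x) = x :=
  b.ext_elem fun j => by rw [coord_simplexMap, coord_simplexMap]

theorem image_simplexMap (b b' : AffineBasis ι ℝ (E d)) :
    simplexMap b b' '' convexHull ℝ (Set.range b) = convexHull ℝ (Set.range b') := by
  rw [b.convexHull_eq_nonneg_coord, b'.convexHull_eq_nonneg_coord]
  ext y
  constructor
  · rintro ⟨x, hx, rfl⟩ i
    rw [coord_simplexMap]; exact hx i
  · intro hy
    refine ⟨simplexMap b' b y, fun i => ?_, simplexMap_simplexMap b' b y⟩
    rw [coord_simplexMap]; exact hy i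

/-- The gradient of a barycentric coordinate. -/
def coordGrad (b : AffineBasis ι ℝ (E d)) (i : ι) : E d →L[ℝ] ℝ :=
  LinearMap.toContinuousLinearMap (b.coord i).linear

theorem coord_sub (b : AffineBasis ι ℝ (E d)) (i : ι) (x y : E d) :
    b.coord i x - b.coord i y = coordGrad b i (x - y) := by
  have := (b.coord i).linearMap_vsub x y
  simpa [coordGrad] using this.symm

theorem hasFDerivAt_coord (b : AffineBasis ι ℝ (E d)) (i : ι) (x : E d) :
    HasFDerivAt (b.coord i) (coordGrad b i) x := by
  have h : (b.coord i : E d → ℝ) = fun y => coordGrad b i y + b.coord i 0 := by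
    funext y
    have := coord_sub b i y 0
    rw [sub_zero] at this
    linarith
  rw [h]
  exact (coordGrad b i).hasFDerivAt.add_const _

theorem sum_coordGrad (b : AffineBasis ι ℝ (E d)) : ∑ i, coordGrad b i = 0 := by
  ext t
  have h : ∀ i, coordGrad b i t = b.coord i t - b.coord i 0 := fun i => by
    rw [coord_sub, sub_zero]
  simp [h, Finset.sum_sub_distrib, b.sum_coord_apply_eq_one]

/-- The linear part of `simplexMap`. -/
def simplexJac (b b' : AffineBasis ι ℝ (E d)) : E d →L[ℝ] E d :=
  ∑ j, (coordGrad b j).smulRight (b' j)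

theorem hasFDerivAt_simplexMap (b b' : AffineBasis ι ℝ (E d)) (x : E d) :
    HasFDerivAt (simplexMap b b') (simplexJac b b') x :=
  HasFDerivAt.fun_sum fun j _ => (hasFDerivAt_coord b j x).smul_const (b' j)

/-- The coordinate gradients sum to zero, so every vertex `b' j` may be replaced by `b' j - b' k`.
The bound then involves the size of the target simplex and not its position. -/
theorem norm_simplexJac_le (b b' : AffineBasis ι ℝ (E d)) {D : ℝ} (k : ι)
    (hD : ∀ i, dist (b' i) (b' k) ≤ D) :
    ‖simplexJac b b'‖ ≤ (∑ j, ‖coordGrad b j‖) * D := by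
  have hD0 : 0 ≤ D := dist_nonneg.trans (hD k)
  have e : simplexJac b b' = ∑ j, (coordGrad b j).smulRight (b' j - b' k) := by
    ext1 t
    have := congrArg (fun f : E d →L[ℝ] ℝ => f t) (sum_coordGrad b)
    simp only [_root_.sum_apply, _root_.zero_apply] at this
    simp only [simplexJac, _root_.sum_apply, ContinuousLinearMap.smulRight_apply,
      smul_sub, Finset.sum_sub_distrib, ← Finset.sum_smul, this, zero_smul, sub_zero]
  rw [e, Finset.sum_mul]
  refine (norm_sum_le _ _).trans (Finset.sum_le_sum fun j _ => ?_)
  rw [ContinuousLinearMap.norm_smulRight_apply]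
  gcongr
  rw [← dist_eq_norm]
  exact hD j

theorem integral_simplex (b b' : AffineBasis ι ℝ (E d)) (H : E d → ℝ) :
    ∫ y in convexHull ℝ (Set.range b'), H y =
      |(simplexJac b b').det| * ∫ x in convexHull ℝ (Set.range b), H (simplexMap b b' x) := by
  rw [← image_simplexMap b b', integral_image_eq_integral_abs_det_fderiv_smul volume
    (compact_hull b).measurableSet
    (fun x _ => (hasFDerivAt_simplexMap b b' x).hasFDerivWithinAt)
    (Function.LeftInverse.injective (simplexMap_simplexMap b b')).injOn]
  simp only [smul_eq_mul]
  exact integral_const_mul _ _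

/-- The map preserves barycentric coordinates, so face polynomials pull back to face polynomials
with the same coefficients; only the linear part changes. -/
theorem faceGrad_simplexMap (b b' : AffineBasis ι ℝ (E d)) (c : ι → ℝ) (g : E d →L[ℝ] ℝ)
    (x : E d) : faceGrad b c (g.comp (simplexJac b b')) x =
      (faceGrad b' c g (simplexMap b b' x)).comp (simplexJac b b') := by
  have h : ∀ i, fderiv ℝ (facePoly b i) x =
      (fderiv ℝ (facePoly b' i) (simplexMap b b' x)).comp (simplexJac b b') := by
    intro i
    have e : facePoly b i = facePoly b' i ∘ simplexMap b b' := by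
      funext y
      simp [facePoly, coord_simplexMap]
    rw [e]
    exact ((differentiable_facePoly b' i _).hasFDerivAt.comp x
      (hasFDerivAt_simplexMap b b' x)).fderiv
  ext t
  simp [faceGrad, h]

/-- The scaled estimate of the bubble coefficients by the gradient on an arbitrary simplex. -/
theorem exists_coeff_sq_le_of_dist_le (hι : 2 < Fintype.card ι)
    (hd : Fintype.card ι = d + 1) :
    ∃ C : ℝ, 0 < C ∧ ∀ (b : AffineBasis ι ℝ (E d)) (D : ℝ), (∀ i j, dist (b i) (b j) ≤ D) →
      ∀ (c : ι → ℝ) (g : E d →L[ℝ] ℝ) (i : ι),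
      volume.real (convexHull ℝ (Set.range b)) * c i ^ 2 ≤
        C * D ^ 2 * ∫ x in convexHull ℝ (Set.range b), ‖faceGrad b c g x‖ ^ 2 := by
  obtain ⟨b₀⟩ : Nonempty (AffineBasis ι ℝ (E d)) :=
    AffineBasis.exists_affineBasis_of_finiteDimensional (by simpa using hd)
  obtain ⟨C₀, hC₀, hb₀⟩ := exists_coeff_sq_le b₀ hι
  set L := ∑ j, ‖coordGrad b₀ j‖ with hL
  have hL0 : 0 ≤ L := by positivity
  set V := volume.real (convexHull ℝ (Set.range b₀)) with hV
  have hV0 : 0 ≤ V := by positivity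
  -- The summand 1 makes the constant positive without a proof that V and L are.
  refine ⟨V * C₀ * L ^ 2 + 1, by positivity, fun b D hD c g i => ?_⟩
  have hvol : volume.real (convexHull ℝ (Set.range b)) = |(simplexJac b₀ b).det| * V := by
    have := integral_simplex b₀ b fun _ => 1
    simpa using this
  have hJ := norm_simplexJac_le b₀ b i fun j => hD j i
  set J := simplexJac b₀ b
  have h1 := hb₀ c (g.comp J) i
  have hint : ∀ {f : E d → ℝ}, Continuous f →
      IntegrableOn f (convexHull ℝ (Set.range b₀)) volume := fun hf =>
    hf.continuousOn.integrableOn_compact (compact_hull b₀)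
  have hcm : Continuous (simplexMap b₀ b) :=
    continuous_iff_continuousAt.2 fun x => (hasFDerivAt_simplexMap b₀ b x).continuousAt
  have h2 : ∫ x in convexHull ℝ (Set.range b₀), ‖faceGrad b₀ c (g.comp J) x‖ ^ 2 ≤
      (L * D) ^ 2 * ∫ x in convexHull ℝ (Set.range b₀),
        ‖faceGrad b c g (simplexMap b₀ b x)‖ ^ 2 := by
    rw [← integral_const_mul]
    refine setIntegral_mono (hint ((continuous_faceGrad _ _ _).norm.pow 2))
      (hint (continuous_const.mul (((continuous_faceGrad _ _ _).comp hcm).norm.pow 2)))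
      fun x => ?_
    simp only
    rw [faceGrad_simplexMap, ← mul_pow]
    gcongr
    refine (ContinuousLinearMap.opNorm_comp_le _ _).trans ?_
    rw [mul_comm]
    gcongr
  -- Volume and integral scale by the same Jacobian determinant, so the estimate involves only the
  -- diameter and needs no shape regularity.
  rw [hvol, integral_simplex b₀ b]
  set I := ∫ x in convexHull ℝ (Set.range b₀), ‖faceGrad b c g (simplexMap b₀ b x)‖ ^ 2
  have hI : 0 ≤ I := integral_nonneg fun x => by positivity
  calc |J.det| * V * c i ^ 2 ≤ |J.det| * V * (C₀ * ((L * D) ^ 2 * I)) := by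
        gcongr
        exact h1.trans (mul_le_mul_of_nonneg_left h2 hC₀.le)
    _ = (V * C₀ * L ^ 2) * D ^ 2 * (|J.det| * I) := by ring
    _ ≤ (V * C₀ * L ^ 2 + 1) * D ^ 2 * (|J.det| * I) := by gcongr; linarith

end Reference

/-! ### Barycentric coordinates and opposite faces in the simplicial complex -/

section Simplices

variable {K : Geometry.SimplicialComplex ℝ (E d)} {T : Finset (E d)}

theorem exists_affineBasis_range_eq (hT : T ∈ K.faces) (hc : T.card = d + 1) :
    ∃ b : AffineBasis (Fin (d + 1)) ℝ (E d), Set.range b = (T : Set (E d)) := by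
  let e : Fin (d + 1) ≃ T := (Fintype.equivFinOfCardEq (by simpa using hc)).symm
  have hind : AffineIndependent ℝ (fun i : Fin (d + 1) => (e i : E d)) :=
    (K.indep hT).comp_embedding e.toEmbedding
  have hr : Set.range (fun i : Fin (d + 1) => (e i : E d)) = (T : Set (E d)) := by
    have := e.surjective.range_comp (Subtype.val : T → E d)
    simpa [Function.comp_def] using this
  exact ⟨⟨fun i => (e i : E d), hind,
    hind.affineSpan_eq_top_iff_card_eq_finrank_add_one.2 (by simp)⟩, hr⟩

/-- The vertices of a `d`-simplex, as an affine basis. -/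
def vertexBasis (hT : T ∈ K.faces) (hc : T.card = d + 1) : AffineBasis (Fin (d + 1)) ℝ (E d) :=
  (exists_affineBasis_range_eq hT hc).choose

theorem range_vertexBasis (hT : T ∈ K.faces) (hc : T.card = d + 1) :
    Set.range (vertexBasis hT hc) = (T : Set (E d)) :=
  (exists_affineBasis_range_eq hT hc).choose_spec

variable (hT : T ∈ K.faces) (hc : T.card = d + 1)

theorem vertexBasis_mem (i : Fin (d + 1)) : vertexBasis hT hc i ∈ T := by
  have : vertexBasis hT hc i ∈ (T : Set (E d)) := range_vertexBasis hT hc ▸ Set.mem_range_self i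
  exact this

theorem vertexBasis_injective : Function.Injective (vertexBasis hT hc) :=
  (vertexBasis hT hc).ind.injective

theorem hull_vertexBasis : convexHull ℝ (Set.range (vertexBasis hT hc)) =
    convexHull ℝ (T : Set (E d)) := by rw [range_vertexBasis]

theorem coord_nonneg {x : E d} (hx : x ∈ convexHull ℝ (T : Set (E d))) (i : Fin (d + 1)) :
    0 ≤ (vertexBasis hT hc).coord i x := by
  rw [← hull_vertexBasis hT hc, AffineBasis.convexHull_eq_nonneg_coord] at hx
  exact hx i

theorem coord_le_one {x : E d} (hx : x ∈ convexHull ℝ (T : Set (E d))) (i : Fin (d + 1)) :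
    (vertexBasis hT hc).coord i x ≤ 1 := by
  rw [← (vertexBasis hT hc).sum_coord_apply_eq_one x]
  exact Finset.single_le_sum (fun j _ => coord_nonneg hT hc hx j) (Finset.mem_univ i)

open Classical in
theorem isBary_coord {x : E d} (hx : x ∈ convexHull ℝ (T : Set (E d))) :
    IsBary T x (fun u => ∑ i, if vertexBasis hT hc i = u then (vertexBasis hT hc).coord i x
      else 0) := by
  set b := vertexBasis hT hc
  refine ⟨fun u _ => Finset.sum_nonneg fun i _ => ?_, fun u hu => ?_, ?_, ?_⟩
  · split_ifs
    · exact coord_nonneg hT hc hx i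
    · exact le_rfl
  · refine Finset.sum_eq_zero fun i _ => if_neg ?_
    rintro rfl
    exact hu (vertexBasis_mem hT hc i)
  · rw [Finset.sum_comm, ← b.sum_coord_apply_eq_one x]
    refine Finset.sum_congr rfl fun i _ => ?_
    rw [Finset.sum_ite_eq, if_pos (vertexBasis_mem hT hc i)]
  · simp only [Finset.sum_smul, ite_smul, zero_smul]
    rw [Finset.sum_comm]
    conv_rhs => rw [← b.linear_combination_coord_eq_self x]
    refine Finset.sum_congr rfl fun i _ => ?_
    rw [Finset.sum_ite_eq, if_pos (vertexBasis_mem hT hc i)]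

theorem hat_vertexBasis {x : E d} (hx : x ∈ convexHull ℝ (T : Set (E d))) (i : Fin (d + 1)) :
    hat K (vertexBasis hT hc i) x = (vertexBasis hT hc).coord i x := by
  classical
  rw [hat_eq hT (isBary_coord hT hc hx), Finset.sum_eq_single i]
  · rw [if_pos rfl]
  · exact fun j _ hj => if_neg fun h => hj (vertexBasis_injective hT hc h)
  · simp

theorem hat_eq_zero (hT : T ∈ K.faces) (hc : T.card = d + 1) {x : E d} (hx : x ∈ convexHull ℝ (T : Set (E d))) {v : E d} (hv : v ∉ T) :
    hat K v x = 0 := by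
  classical
  rw [hat_eq hT (isBary_coord hT hc hx)]
  refine Finset.sum_eq_zero fun i _ => if_neg ?_
  rintro rfl
  exact hv (vertexBasis_mem hT hc i)

open Classical in
/-- The face opposite to the vertex `i`. -/
def oppFace (i : Fin (d + 1)) : Finset (E d) := (Finset.univ.erase i).image (vertexBasis hT hc)

theorem oppFace_injective : Function.Injective (oppFace hT hc) := by
  classical
  intro i j h
  by_contra hij
  have h1 : vertexBasis hT hc j ∈ oppFace hT hc i :=
    Finset.mem_image_of_mem _ (Finset.mem_erase.2 ⟨fun h => hij h.symm, Finset.mem_univ j⟩)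
  rw [h] at h1
  obtain ⟨k, hk, hk'⟩ := Finset.mem_image.1 h1
  exact (Finset.mem_erase.1 hk).1 (vertexBasis_injective hT hc hk')

theorem oppFace_subset (i : Fin (d + 1)) : oppFace hT hc i ⊆ T := by
  classical
  intro u hu
  obtain ⟨k, _, rfl⟩ := Finset.mem_image.1 hu
  exact vertexBasis_mem hT hc k

theorem exists_eq_oppFace {F : Finset (E d)} (hF : F ⊆ T) (hFc : F.card = d) :
    ∃ i, F = oppFace hT hc i := by
  classical
  obtain ⟨v, hvT, hvF⟩ : ∃ v ∈ T, v ∉ F := by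
    by_contra! h
    have := Finset.card_le_card (Finset.subset_iff.2 h)
    omega
  obtain ⟨i, rfl⟩ : v ∈ Set.range (vertexBasis hT hc) := by
    rw [range_vertexBasis]; exact hvT
  refine ⟨i, Finset.eq_of_subset_of_card_le (fun u hu => ?_) ?_⟩
  · obtain ⟨k, rfl⟩ : u ∈ Set.range (vertexBasis hT hc) := by
      rw [range_vertexBasis]; exact hF hu
    refine Finset.mem_image_of_mem _ (Finset.mem_erase.2 ⟨?_, Finset.mem_univ k⟩)
    rintro rfl
    exact hvF hu
  · rw [hFc, oppFace, Finset.card_image_of_injective _ (vertexBasis_injective hT hc),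
      Finset.card_erase_of_mem (Finset.mem_univ i)]
    simp

theorem bubble_oppFace {x : E d} (hx : x ∈ convexHull ℝ (T : Set (E d))) (i : Fin (d + 1)) :
    bubble K (oppFace hT hc i) x = facePoly (vertexBasis hT hc) i x := by
  classical
  rw [bubble, oppFace, Finset.prod_image fun i _ j _ h => vertexBasis_injective hT hc h, facePoly]
  exact Finset.prod_congr rfl fun j _ => hat_vertexBasis hT hc hx j

theorem bubble_eq_zero (hT : T ∈ K.faces) (hc : T.card = d + 1) {x : E d} (hx : x ∈ convexHull ℝ (T : Set (E d))) {F : Finset (E d)}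
    (hF : ¬ F ⊆ T) : bubble K F x = 0 := by
  obtain ⟨v, hv, hvT⟩ := Finset.not_subset.1 hF
  exact Finset.prod_eq_zero hv (hat_eq_zero hT hc hx hvT)

theorem interior_hull_eq :
    interior (convexHull ℝ (T : Set (E d))) = {x | ∀ i, 0 < (vertexBasis hT hc).coord i x} := by
  rw [← hull_vertexBasis hT hc, AffineBasis.interior_convexHull]

/-- Some vertex of T is not in T'. Its nodal function is positive in the interior of T and zero on
T'. -/
theorem disjoint_interior_hull (hT : T ∈ K.faces) (hc : T.card = d + 1) {T' : Finset (E d)} (hT' : T' ∈ K.faces) (hc' : T'.card = d + 1)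
    (hne : T ≠ T') : Disjoint (interior (convexHull ℝ (T : Set (E d))))
      (interior (convexHull ℝ (T' : Set (E d)))) := by
  rw [Set.disjoint_left]
  intro x hx hx'
  refine hne (Finset.eq_of_subset_of_card_le (fun v hv => ?_) (by rw [hc, hc']))
  by_contra hvT'
  obtain ⟨i, rfl⟩ : v ∈ Set.range (vertexBasis hT hc) := by
    rw [range_vertexBasis]; exact hv
  have h1 := hat_vertexBasis hT hc (interior_subset hx) i
  rw [hat_eq_zero hT' hc' (interior_subset hx') hvT'] at h1
  rw [interior_hull_eq hT hc] at hx
  exact (hx i).ne h1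

theorem interior_hull_nonempty (hT : T ∈ K.faces) (hc : T.card = d + 1) : (interior (convexHull ℝ (T : Set (E d)))).Nonempty := by
  rw [← hull_vertexBasis hT hc]
  exact interior_convexHull_nonempty_iff_affineSpan_eq_top.2 (vertexBasis hT hc).tot

end Simplices

/-! ### Decomposition of the domain and piecewise C¹ fields -/

namespace MeshedDomain

variable (m : MeshedDomain d)

/-- The `d`-simplices of the mesh. -/
def tops : Finset (Finset (E d)) := m.finite_faces.toFinset.filter fun T => T.card = d + 1

theorem mem_tops {T : Finset (E d)} : T ∈ m.tops ↔ T ∈ m.tri.faces ∧ T.card = d + 1 := by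
  simp [tops]

theorem space_eq : m.tri.space = ⋃ T ∈ m.tops, convexHull ℝ (T : Set (E d)) := by
  ext x
  rw [Geometry.SimplicialComplex.mem_space_iff]
  simp only [Set.mem_iUnion, exists_prop]
  constructor
  · rintro ⟨s, hs, hx⟩
    obtain ⟨t, ht, hst, htc⟩ := m.pure s hs
    exact ⟨t, m.mem_tops.2 ⟨ht, htc⟩, convexHull_mono (by exact_mod_cast hst) hx⟩
  · rintro ⟨T, hT, hx⟩
    exact ⟨T, (m.mem_tops.1 hT).1, hx⟩

theorem isCompact_hull (T : Finset (E d)) : IsCompact (convexHull ℝ (T : Set (E d))) :=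
  T.finite_toSet.isCompact_convexHull ℝ

theorem isCompact_space : IsCompact m.tri.space := by
  rw [space_eq]
  exact m.tops.isCompact_biUnion fun T _ => isCompact_hull T

theorem Ω_subset : m.Ω ⊆ m.tri.space := m.interior_space ▸ interior_subset

theorem isOpen_Ω : IsOpen m.Ω := m.interior_space ▸ isOpen_interior

instance : IsFiniteMeasure (volume.restrict m.Ω) :=
  ⟨by rw [Measure.restrict_apply_univ]
      exact (measure_mono m.Ω_subset).trans_lt m.isCompact_space.measure_lt_top⟩

theorem interior_hull_subset {T : Finset (E d)} (hT : T ∈ m.tops) :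
    interior (convexHull ℝ (T : Set (E d))) ⊆ m.Ω := by
  rw [← m.interior_space]
  exact interior_mono (Geometry.SimplicialComplex.convexHull_subset_space (m.mem_tops.1 hT).1)

/-- The difference lies in the frontiers of finitely many convex sets, which are null sets. -/
theorem Ω_ae_eq : (⋃ T ∈ m.tops, interior (convexHull ℝ (T : Set (E d)))) =ᵐ[volume] m.Ω := by
  refine Filter.EventuallyLE.antisymm
    (LE.le.eventuallyLE (Set.iUnion₂_subset fun T hT => m.interior_hull_subset hT)) ?_
  rw [ae_le_set]
  refine measure_mono_null (t := ⋃ T ∈ m.tops, frontier (convexHull ℝ (T : Set (E d)))) ?_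
    ((measure_biUnion_null_iff m.tops.countable_toSet).2 fun T _ =>
      (convex_convexHull ℝ _).addHaar_frontier volume)
  rintro x ⟨hx, hx'⟩
  have hs := m.Ω_subset hx
  rw [space_eq] at hs
  simp only [Set.mem_iUnion, exists_prop, not_exists, not_and] at hs hx' ⊢
  obtain ⟨T, hT, hxT⟩ := hs
  exact ⟨T, hT, subset_closure hxT, hx' T hT⟩

theorem ae_mem_interior : ∀ᵐ x ∂volume.restrict m.Ω,
    ∃ T ∈ m.tops, x ∈ interior (convexHull ℝ (T : Set (E d))) := by
  rw [← Measure.restrict_congr_set m.Ω_ae_eq]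
  have hmeas : MeasurableSet (⋃ T ∈ m.tops, interior (convexHull ℝ (T : Set (E d)))) :=
    (isOpen_biUnion fun _ _ => isOpen_interior).measurableSet
  refine (ae_restrict_iff' hmeas).2 (ae_of_all _ fun x hx => ?_)
  simpa using hx

theorem integral_eq_sum {f : E d → ℝ} (hf : Integrable f (volume.restrict m.Ω)) :
    ∫ x in m.Ω, f x = ∑ T ∈ m.tops, ∫ x in interior (convexHull ℝ (T : Set (E d))), f x := by
  rw [← Measure.restrict_congr_set m.Ω_ae_eq]
  refine integral_biUnion_finset _ (fun T _ => isOpen_interior.measurableSet) ?_ fun T hT =>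
    IntegrableOn.mono_set (show IntegrableOn f m.Ω volume from hf) (m.interior_hull_subset hT)
  intro T hT T' hT' hne
  obtain ⟨h1, h2⟩ := m.mem_tops.1 hT
  obtain ⟨h1', h2'⟩ := m.mem_tops.1 hT'
  exact disjoint_interior_hull h1 h2 h1' h2' hne

/-- Fields that are continuously differentiable on every `d`-simplex. -/
def piecewiseC1 : Submodule ℝ (E d → E d) where
  carrier := {v | ∀ T ∈ m.tops, ∃ p : E d → E d, ContDiff ℝ 1 p ∧
    Set.EqOn v p (convexHull ℝ (T : Set (E d)))}
  add_mem' := by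
    intro u v hu hv T hT
    obtain ⟨p, hp, hup⟩ := hu T hT
    obtain ⟨q, hq, hvq⟩ := hv T hT
    exact ⟨p + q, hp.add hq, fun x hx => by simp [hup hx, hvq hx]⟩
  zero_mem' := fun _ _ => ⟨0, contDiff_const, fun _ _ => rfl⟩
  smul_mem' := by
    intro c u hu T hT
    obtain ⟨p, hp, hup⟩ := hu T hT
    exact ⟨c • p, hp.const_smul c, fun x hx => by simp [hup hx]⟩

theorem bubbleField_eqOn_zero {T : Finset (E d)} (hT : T ∈ m.tops) (F : m.BubbleFace)
    (hF : ¬ F.1 ⊆ T) : Set.EqOn (m.bubbleField F) 0 (convexHull ℝ (T : Set (E d))) := by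
  intro x hx
  obtain ⟨h1, h2⟩ := m.mem_tops.1 hT
  simp [bubbleField, bubble_eq_zero h1 h2 hx hF]

theorem bubbleField_mem (F : m.BubbleFace) : m.bubbleField F ∈ m.piecewiseC1 := by
  intro T hT
  obtain ⟨h1, h2⟩ := m.mem_tops.1 hT
  by_cases hF : F.1 ⊆ T
  · obtain ⟨i, hi⟩ := exists_eq_oppFace h1 h2 hF F.2.2.1
    refine ⟨fun x => facePoly (vertexBasis h1 h2) i x • m.normal F.1,
      ((contDiff_facePoly _ i).of_le (by simp)).smul contDiff_const, fun x hx => ?_⟩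
    rw [bubbleField, hi, bubble_oppFace h1 h2 hx]
  · exact ⟨0, contDiff_const, m.bubbleField_eqOn_zero hT F hF⟩

theorem contDiff_affine {n : WithTop ℕ∞} (A : E d →ᵃ[ℝ] E d) : ContDiff ℝ n A := by
  have h : (A : E d → E d) = fun x => LinearMap.toContinuousLinearMap A.linear x + A 0 := by
    funext x
    have := A.linearMap_vsub x 0
    simp at this
    simp [this]
  rw [h]
  exact (ContinuousLinearMap.contDiff _).add contDiff_const

theorem P1_le : m.P1 ≤ m.piecewiseC1 := by
  intro v hv T hT
  obtain ⟨A, hA⟩ := hv.2.1 T (m.mem_tops.1 hT).1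
  exact ⟨A, contDiff_affine A, hA⟩

end MeshedDomain

/-! ### Pointwise inequalities between forms on gradient matrices -/

section MatrixForms

/-- `contract` as a bilinear form. -/
def frobForm (d : ℕ) : LinearMap.BilinForm ℝ (Matrix (Fin d) (Fin d) ℝ) :=
  LinearMap.mk₂ ℝ contract
    (fun A B C => by simp [contract, add_mul, Finset.sum_add_distrib])
    (fun c A B => by simp [contract, Finset.mul_sum, mul_assoc])
    (fun A B C => by simp [contract, mul_add, Finset.sum_add_distrib])
    (fun c A B => by simp [contract, Finset.mul_sum, mul_left_comm])

/-- The symmetric part of a matrix. -/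
def symPart (d : ℕ) : Matrix (Fin d) (Fin d) ℝ →ₗ[ℝ] Matrix (Fin d) (Fin d) ℝ where
  toFun A := (1 / 2 : ℝ) • (A + Aᵀ)
  map_add' A B := by rw [Matrix.transpose_add, ← smul_add]; congr 1; abel
  map_smul' c A := by
    rw [Matrix.transpose_smul, ← smul_add, smul_comm, RingHom.id_apply]

/-- The contraction of the symmetric parts. -/
def symForm (d : ℕ) : LinearMap.BilinForm ℝ (Matrix (Fin d) (Fin d) ℝ) :=
  (frobForm d).compl₁₂ (symPart d) (symPart d)

/-- The product of the traces. -/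
def traceForm (d : ℕ) : LinearMap.BilinForm ℝ (Matrix (Fin d) (Fin d) ℝ) :=
  (LinearMap.mul ℝ ℝ).compl₁₂ (Matrix.traceLinearMap (Fin d) ℝ ℝ)
    (Matrix.traceLinearMap (Fin d) ℝ ℝ)

/-- The density of the elasticity form. -/
def energyForm (d : ℕ) (lam mu : ℝ) : LinearMap.BilinForm ℝ (Matrix (Fin d) (Fin d) ℝ) :=
  (2 * mu) • symForm d + lam • traceForm d

theorem frobForm_apply (A B : Matrix (Fin d) (Fin d) ℝ) : frobForm d A B = contract A B := rfl

theorem frobForm_self (A : Matrix (Fin d) (Fin d) ℝ) :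
    frobForm d A A = ∑ i, ∑ j, A i j ^ 2 := by
  simp [frobForm_apply, contract, sq]

theorem frobForm_nonneg (A : Matrix (Fin d) (Fin d) ℝ) : 0 ≤ frobForm d A A := by
  rw [frobForm_self]; positivity

theorem energyForm_apply (lam mu : ℝ) (A B : Matrix (Fin d) (Fin d) ℝ) :
    energyForm d lam mu A B =
      2 * mu * frobForm d (symPart d A) (symPart d B) + lam * (A.trace * B.trace) := rfl

theorem energyForm_nonneg {lam mu : ℝ} (hl : 0 ≤ lam) (hm : 0 ≤ mu)
    (A : Matrix (Fin d) (Fin d) ℝ) : 0 ≤ energyForm d lam mu A A := by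
  rw [energyForm_apply]
  have := frobForm_nonneg (symPart d A)
  have := mul_self_nonneg A.trace
  positivity

theorem energyForm_comm (lam mu : ℝ) (A B : Matrix (Fin d) (Fin d) ℝ) :
    energyForm d lam mu A B = energyForm d lam mu B A := by
  have h : ∀ A B, frobForm d A B = frobForm d B A := fun A B => by
    simp [frobForm_apply, contract, mul_comm]
  rw [energyForm_apply, energyForm_apply, h, mul_comm A.trace]

theorem trace_sq_le (A : Matrix (Fin d) (Fin d) ℝ) :
    A.trace ^ 2 ≤ d * frobForm d A A := by
  have h1 : A.trace ^ 2 ≤ d * ∑ i, A i i ^ 2 := by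
    have := sq_sum_le_card_mul_sum_sq (s := Finset.univ) (f := fun i : Fin d => A i i)
    simpa [Matrix.trace] using this
  refine h1.trans ?_
  rw [frobForm_self]
  gcongr with i
  exact Finset.single_le_sum (f := fun j => A i j ^ 2) (fun j _ => sq_nonneg _) (Finset.mem_univ i)

theorem trace_symPart (A : Matrix (Fin d) (Fin d) ℝ) : (symPart d A).trace = A.trace := by
  simp [symPart]; ring

theorem frobForm_symPart_le (A : Matrix (Fin d) (Fin d) ℝ) :
    frobForm d (symPart d A) (symPart d A) ≤ frobForm d A A := by
  have hT : ∑ i, ∑ j, (A j i) ^ 2 = ∑ i, ∑ j, A i j ^ 2 := Finset.sum_comm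
  rw [frobForm_self, frobForm_self]
  calc _ ≤ ∑ i, ∑ j, (1 / 2 * A i j ^ 2 + 1 / 2 * A j i ^ 2) := by
        gcongr with i _ j _
        simp only [symPart, LinearMap.coe_mk, AddHom.coe_mk, Matrix.smul_apply, Matrix.add_apply,
          Matrix.transpose_apply, smul_eq_mul]
        nlinarith [sq_nonneg (A i j - A j i)]
    _ = _ := by
        simp only [Finset.sum_add_distrib, ← Finset.mul_sum]
        rw [hT]; ring

/-- The factor 2μ + dλ equals dζ², so this bound and the lower bound `le_energyForm` carry the same
parameter weight. That is what makes the final constants independent of λ and μ. -/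
theorem energyForm_le {lam mu : ℝ} (hl : 0 ≤ lam) (hm : 0 ≤ mu) (A : Matrix (Fin d) (Fin d) ℝ) :
    energyForm d lam mu A A ≤ (2 * mu + d * lam) * frobForm d A A := by
  rw [energyForm_apply]
  have h1 := mul_le_mul_of_nonneg_left (frobForm_symPart_le A) (by positivity : 0 ≤ 2 * mu)
  have h2 := mul_le_mul_of_nonneg_left (trace_sq_le A) hl
  linarith

/-- Symmetrizing does not change the trace, so Cauchy–Schwarz on the diagonal of the symmetric part
gives the share 2μ/d. This is the origin of ζ² = λ + 2μ/d. -/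
theorem le_energyForm {lam mu : ℝ} (hm : 0 ≤ mu) (hd : 0 < d)
    (A : Matrix (Fin d) (Fin d) ℝ) :
    (lam + 2 * mu / d) * A.trace ^ 2 ≤ energyForm d lam mu A A := by
  rw [energyForm_apply]
  have hd' : (0 : ℝ) < d := by exact_mod_cast hd
  have h := trace_sq_le (symPart d A)
  rw [trace_symPart] at h
  have h1 : 2 * mu / d * A.trace ^ 2 ≤ 2 * mu * frobForm d (symPart d A) (symPart d A) := by
    calc _ ≤ 2 * mu / d * (d * frobForm d (symPart d A) (symPart d A)) := by gcongr
      _ = _ := by field_simp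
  linarith

/-- Reduces integrability of any form of two gradients to products of square integrable entries. -/
theorem form_eq_sum (B : LinearMap.BilinForm ℝ (Matrix (Fin d) (Fin d) ℝ))
    (A A' : Matrix (Fin d) (Fin d) ℝ) :
    B A A' = ∑ i, ∑ j, ∑ k, ∑ l,
      A i j * A' k l * B (Matrix.single i j 1) (Matrix.single k l 1) := by
  have h : ∀ A : Matrix (Fin d) (Fin d) ℝ,
      A = ∑ i, ∑ j, A i j • (Matrix.single i j 1 : Matrix (Fin d) (Fin d) ℝ) := by
    intro A
    conv_lhs => rw [Matrix.matrix_eq_sum_single A]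
    simp
  conv_lhs => rw [h A]
  simp only [map_sum, LinearMap.sum_apply, map_smul, LinearMap.smul_apply, smul_eq_mul]
  refine Finset.sum_congr rfl fun i _ => Finset.sum_congr rfl fun j _ => ?_
  conv_lhs => rw [h A']
  simp only [map_sum, map_smul, smul_eq_mul, Finset.mul_sum, mul_assoc]

theorem form_sum_le {V ι : Type*} [AddCommGroup V] [Module ℝ V] (f : LinearMap.BilinForm ℝ V)
    (hf : ∀ x, 0 ≤ f x x) (hs : ∀ x y, f x y = f y x) (s : Finset ι) (x : ι → V) :
    f (∑ i ∈ s, x i) (∑ i ∈ s, x i) ≤ s.card * ∑ i ∈ s, f (x i) (x i) := by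
  have h : ∀ i j, f (x i) (x j) ≤ 1 / 2 * f (x i) (x i) + 1 / 2 * f (x j) (x j) := by
    intro i j
    have := hf (x i - x j)
    simp only [map_sub, LinearMap.sub_apply] at this
    linarith [hs (x i) (x j)]
  simp only [map_sum, LinearMap.sum_apply]
  calc _ ≤ ∑ i ∈ s, ∑ j ∈ s, (1 / 2 * f (x j) (x j) + 1 / 2 * f (x i) (x i)) := by
        gcongr with i _ j _
        exact h _ _
    _ = _ := by
        simp only [Finset.sum_add_distrib, Finset.sum_const, nsmul_eq_mul, ← Finset.mul_sum]
        ring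

end MatrixForms

/-! ### Integrated forms of gradients and the divergence pairing -/

namespace MeshedDomain

variable (m : MeshedDomain d)

theorem differentiableAt_of_mem_interior {v : E d → E d} (hv : v ∈ m.piecewiseC1)
    {T : Finset (E d)} (hT : T ∈ m.tops) {x : E d}
    (hx : x ∈ interior (convexHull ℝ (T : Set (E d)))) : DifferentiableAt ℝ v x := by
  obtain ⟨p, hp, hvp⟩ := hv T hT
  exact (hp.differentiable (by simp) x).congr_of_eventuallyEq
    (hvp.eventuallyEq_of_mem (mem_interior_iff_mem_nhds.1 hx))

/-- The gradient at an interior point of a `d`-simplex, as a linear map. -/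
def gradAt (x : E d) (hx : ∃ T ∈ m.tops, x ∈ interior (convexHull ℝ (T : Set (E d)))) :
    m.piecewiseC1 →ₗ[ℝ] Matrix (Fin d) (Fin d) ℝ where
  toFun v := grad v.1 x
  map_add' u v := by
    obtain ⟨T, hT, hxT⟩ := hx
    ext i j
    simp [grad, fderiv_add (m.differentiableAt_of_mem_interior u.2 hT hxT)
      (m.differentiableAt_of_mem_interior v.2 hT hxT)]
  map_smul' c u := by
    obtain ⟨T, hT, hxT⟩ := hx
    ext i j
    simp [grad, fderiv_const_smul (m.differentiableAt_of_mem_interior u.2 hT hxT)]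

theorem measurable_grad (v : E d → E d) (i j : Fin d) : Measurable fun x => grad v x i j := by
  have h1 : Measurable fun x => fderiv ℝ v x (EuclideanSpace.single j 1) :=
    measurable_fderiv_apply_const ℝ v _
  exact (EuclideanSpace.proj (𝕜 := ℝ) i).continuous.measurable.comp h1

theorem grad_bounded {v : E d → E d} (hv : v ∈ m.piecewiseC1) (i j : Fin d) :
    ∃ C : ℝ, ∀ᵐ x ∂volume.restrict m.Ω, ‖grad v x i j‖ ≤ C := by
  have h : ∀ T : Finset (E d), ∃ C : ℝ, T ∈ m.tops →
      ∀ x ∈ interior (convexHull ℝ (T : Set (E d))), ‖grad v x i j‖ ≤ C := by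
    intro T
    by_cases hT : T ∈ m.tops
    · obtain ⟨p, hp, hvp⟩ := hv T hT
      have hc : Continuous fun x => grad p x i j :=
        (EuclideanSpace.proj (𝕜 := ℝ) i).continuous.comp
          ((hp.continuous_fderiv (by simp)).clm_apply continuous_const)
      obtain ⟨C, hC⟩ := (isCompact_hull T).exists_bound_of_continuousOn hc.continuousOn
      refine ⟨C, fun _ x hx => ?_⟩
      have : fderiv ℝ v x = fderiv ℝ p x := Filter.EventuallyEq.fderiv_eq
        (hvp.eventuallyEq_of_mem (mem_interior_iff_mem_nhds.1 hx))
      have h2 := hC x (interior_subset hx)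
      simpa [grad, this] using h2
    · exact ⟨0, fun h => absurd h hT⟩
  choose C hC using h
  obtain ⟨C', hC'⟩ := (m.tops.image C).exists_le
  refine ⟨C', m.ae_mem_interior.mono fun x ⟨T, hT, hx⟩ => (hC T hT x hx).trans
    (hC' _ (Finset.mem_image_of_mem C hT))⟩

theorem memLp_grad {v : E d → E d} (hv : v ∈ m.piecewiseC1) (i j : Fin d) :
    MemLp (fun x => grad v x i j) 2 (volume.restrict m.Ω) := by
  obtain ⟨C, hC⟩ := m.grad_bounded hv i j
  exact MemLp.of_bound (measurable_grad v i j).aestronglyMeasurable C hC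

theorem integrable_form (B : LinearMap.BilinForm ℝ (Matrix (Fin d) (Fin d) ℝ)) {u v : E d → E d}
    (hu : u ∈ m.piecewiseC1) (hv : v ∈ m.piecewiseC1) :
    Integrable (fun x => B (grad u x) (grad v x)) (volume.restrict m.Ω) := by
  have h : (fun x => B (grad u x) (grad v x)) = fun x => ∑ i, ∑ j, ∑ k, ∑ l,
      grad u x i j * grad v x k l * B (Matrix.single i j 1) (Matrix.single k l 1) := by
    funext x; exact form_eq_sum B _ _
  rw [h]
  refine integrable_finsetSum _ fun i _ => integrable_finsetSum _ fun j _ =>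
    integrable_finsetSum _ fun k _ => integrable_finsetSum _ fun l _ => Integrable.mul_const ?_ _
  exact (m.memLp_grad hu i j).integrable_mul (m.memLp_grad hv k l)

/-- The integral of a bilinear form of the gradients. -/
def intForm (B : LinearMap.BilinForm ℝ (Matrix (Fin d) (Fin d) ℝ)) :
    LinearMap.BilinForm ℝ m.piecewiseC1 :=
  LinearMap.mk₂ ℝ (fun u v => ∫ x in m.Ω, B (grad u.1 x) (grad v.1 x))
    (fun u u' v => by
      rw [← integral_add (m.integrable_form B u.2 v.2) (m.integrable_form B u'.2 v.2)]
      refine integral_congr_ae (m.ae_mem_interior.mono fun x hx => ?_)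
      have := (m.gradAt x hx).map_add u u'
      simp only [gradAt, LinearMap.coe_mk, AddHom.coe_mk] at this
      simp only [this, map_add, LinearMap.add_apply])
    (fun c u v => by
      rw [smul_eq_mul, ← integral_const_mul]
      refine integral_congr_ae (m.ae_mem_interior.mono fun x hx => ?_)
      have := (m.gradAt x hx).map_smul c u
      simp only [gradAt, LinearMap.coe_mk, AddHom.coe_mk] at this
      simp only [this, map_smul, LinearMap.smul_apply, smul_eq_mul])
    (fun u v v' => by
      rw [← integral_add (m.integrable_form B u.2 v.2) (m.integrable_form B u.2 v'.2)]
      refine integral_congr_ae (m.ae_mem_interior.mono fun x hx => ?_)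
      have := (m.gradAt x hx).map_add v v'
      simp only [gradAt, LinearMap.coe_mk, AddHom.coe_mk] at this
      simp only [this, map_add])
    (fun c u v => by
      rw [smul_eq_mul, ← integral_const_mul]
      refine integral_congr_ae (m.ae_mem_interior.mono fun x hx => ?_)
      have := (m.gradAt x hx).map_smul c v
      simp only [gradAt, LinearMap.coe_mk, AddHom.coe_mk] at this
      simp only [this, map_smul, smul_eq_mul])

theorem intForm_apply (B : LinearMap.BilinForm ℝ (Matrix (Fin d) (Fin d) ℝ))
    (u v : m.piecewiseC1) : m.intForm B u v = ∫ x in m.Ω, B (grad u.1 x) (grad v.1 x) := rfl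

theorem intForm_nonneg {B : LinearMap.BilinForm ℝ (Matrix (Fin d) (Fin d) ℝ)}
    (hB : ∀ A, 0 ≤ B A A) (u : m.piecewiseC1) : 0 ≤ m.intForm B u u :=
  integral_nonneg fun _ => hB _

theorem elasticity_eq (lam mu : ℝ) (u v : m.piecewiseC1) :
    elasticity m.Ω lam mu u.1 v.1 = m.intForm (energyForm d lam mu) u v := by
  have h1 := (m.integrable_form (symForm d) u.2 v.2).const_mul (2 * mu)
  have h2 := (m.integrable_form (traceForm d) u.2 v.2).const_mul lam
  rw [intForm_apply]
  have h := integral_add h1 h2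
  rw [integral_const_mul, integral_const_mul] at h
  exact h.symm

theorem memLp_divergence {v : E d → E d} (hv : v ∈ m.piecewiseC1) :
    MemLp (divergence v) 2 (volume.restrict m.Ω) := by
  have : divergence v = fun x => ∑ i, grad v x i i := by
    funext x; simp [divergence, Matrix.trace]
  rw [this]
  exact memLp_finsetSum _ fun i _ => m.memLp_grad hv i i

theorem integrable_divergence_mul {v : E d → E d} (hv : v ∈ m.piecewiseC1) (q : L2 m.Ω) :
    Integrable (fun x => divergence v x * q x) (volume.restrict m.Ω) :=
  (m.memLp_divergence hv).integrable_mul (Lp.memLp q)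

/-- The pairing of the divergence with a square integrable function. -/
def divForm : m.piecewiseC1 →ₗ[ℝ] L2 m.Ω →ₗ[ℝ] ℝ :=
  LinearMap.mk₂ ℝ (fun v q => ∫ x in m.Ω, divergence v.1 x * q x)
    (fun v v' q => by
      rw [← integral_add (m.integrable_divergence_mul v.2 q)
        (m.integrable_divergence_mul v'.2 q)]
      refine integral_congr_ae (m.ae_mem_interior.mono fun x hx => ?_)
      have := (m.gradAt x hx).map_add v v'
      simp only [gradAt, LinearMap.coe_mk, AddHom.coe_mk] at this
      simp only [divergence, this, Matrix.trace_add, add_mul])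
    (fun c v q => by
      rw [smul_eq_mul, ← integral_const_mul]
      refine integral_congr_ae (m.ae_mem_interior.mono fun x hx => ?_)
      have := (m.gradAt x hx).map_smul c v
      simp only [gradAt, LinearMap.coe_mk, AddHom.coe_mk] at this
      simp only [divergence, this, Matrix.trace_smul, smul_eq_mul, mul_assoc])
    (fun v q q' => by
      rw [← integral_add (m.integrable_divergence_mul v.2 q)
        (m.integrable_divergence_mul v.2 q')]
      refine integral_congr_ae ((Lp.coeFn_add q q').mono fun x hx => ?_)
      simp only [hx, Pi.add_apply, mul_add])
    (fun c v q => by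
      rw [smul_eq_mul, ← integral_const_mul]
      refine integral_congr_ae ((Lp.coeFn_smul c q).mono fun x hx => ?_)
      simp only [hx, Pi.smul_apply, smul_eq_mul, mul_left_comm])

theorem divForm_apply (v : m.piecewiseC1) (q : L2 m.Ω) :
    m.divForm v q = ∫ x in m.Ω, divergence v.1 x * q x := rfl

theorem divForm_sq_le (v : m.piecewiseC1) (q : L2 m.Ω) :
    m.divForm v q ^ 2 ≤ m.intForm (traceForm d) v v * ‖q‖ ^ 2 := by
  have hv := m.memLp_divergence v.2
  have h1 : m.divForm v q = inner ℝ (hv.toLp _) q := by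
    rw [L2.inner_def, divForm_apply]
    refine integral_congr_ae (hv.coeFn_toLp.mono fun x hx => ?_)
    simp [hx, mul_comm]
  have h2 : m.intForm (traceForm d) v v = ‖hv.toLp _‖ ^ 2 := by
    rw [norm_toLp_sq, intForm_apply]
    refine integral_congr_ae (ae_of_all _ fun x => ?_)
    simp [traceForm, divergence, sq]
  rw [h1, h2, ← mul_pow, ← sq_abs]
  exact pow_le_pow_left₀ (abs_nonneg _) (abs_real_inner_le_norm _ _) 2

theorem zeta_sq_mul_divForm_sq_le {lam mu : ℝ} (hm : 0 ≤ mu) (hl : 0 ≤ lam) (hd : 0 < d)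
    (v : m.piecewiseC1) (q : L2 m.Ω) :
    (lam + 2 * mu / d) * m.divForm v q ^ 2 ≤
      m.intForm (energyForm d lam mu) v v * ‖q‖ ^ 2 := by
  have h : (lam + 2 * mu / d) * m.intForm (traceForm d) v v ≤
      m.intForm (energyForm d lam mu) v v := by
    rw [intForm_apply, intForm_apply, ← integral_const_mul]
    refine integral_mono ((m.integrable_form _ v.2 v.2).const_mul _)
      (m.integrable_form _ v.2 v.2) fun x => ?_
    have := le_energyForm (lam := lam) hm hd (grad v.1 x)
    rw [sq] at this
    exact this
  calc _ ≤ (lam + 2 * mu / d) * (m.intForm (traceForm d) v v * ‖q‖ ^ 2) := by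
        gcongr; exact m.divForm_sq_le v q
    _ = (lam + 2 * mu / d) * m.intForm (traceForm d) v v * ‖q‖ ^ 2 := by ring
    _ ≤ _ := by gcongr

theorem intForm_energyForm_le {lam mu : ℝ} (hm : 0 ≤ mu) (hl : 0 ≤ lam) (v : m.piecewiseC1) :
    m.intForm (energyForm d lam mu) v v ≤ (2 * mu + d * lam) * m.intForm (frobForm d) v v := by
  rw [intForm_apply, intForm_apply, ← integral_const_mul]
  exact integral_mono (m.integrable_form _ v.2 v.2)
    ((m.integrable_form _ v.2 v.2).const_mul _) fun x => energyForm_le hl hm _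

end MeshedDomain

/-! ### Gradient bounds for coordinates and face polynomials -/

theorem norm_sq_le_sum_sq (L : E d →L[ℝ] ℝ) :
    ‖L‖ ^ 2 ≤ ∑ j, (L (EuclideanSpace.single j 1)) ^ 2 := by
  have h : ‖L‖ ≤ √(∑ j, (L (EuclideanSpace.single j 1)) ^ 2) := by
    refine L.opNorm_le_bound (Real.sqrt_nonneg _) fun t => ?_
    have ht : L t = ∑ j, L (EuclideanSpace.single j 1) * t j := by
      have e : t = ∑ j, t j • EuclideanSpace.single j (1 : ℝ) := by
        ext k
        simp [Finset.sum_apply, Pi.single_apply]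
      conv_lhs => rw [e]
      simp [mul_comm]
    rw [ht, EuclideanSpace.norm_eq, ← Real.sqrt_mul (by positivity)]
    simp only [Real.norm_eq_abs, sq_abs]
    exact Real.abs_le_sqrt (Finset.sum_mul_sq_le_sq_mul_sq _ _ _)
  calc ‖L‖ ^ 2 ≤ √(∑ j, (L (EuclideanSpace.single j 1)) ^ 2) ^ 2 := by gcongr
    _ = _ := Real.sq_sqrt (by positivity)

theorem apply_single_sq_le (L : E d →L[ℝ] ℝ) (j : Fin d) :
    (L (EuclideanSpace.single j 1)) ^ 2 ≤ ‖L‖ ^ 2 := by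
  rw [← sq_abs]
  refine pow_le_pow_left₀ (abs_nonneg _) ?_ 2
  simpa using L.le_opNorm (EuclideanSpace.single j 1)

theorem grad_apply_of_eventuallyEq {v : E d → E d} {x : E d} {k : Fin d} {f : E d → ℝ}
    {L : E d →L[ℝ] ℝ} (hv : DifferentiableAt ℝ v x) (hf : HasFDerivAt f L x)
    (h : (fun y => v y k) =ᶠ[nhds x] f) (j : Fin d) :
    grad v x k j = L (EuclideanSpace.single j 1) := by
  have h1 : HasFDerivAt (fun y => v y k) ((EuclideanSpace.proj (𝕜 := ℝ) k).comp (fderiv ℝ v x)) x :=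
    (EuclideanSpace.proj (𝕜 := ℝ) k).hasFDerivAt.comp x hv.hasFDerivAt
  have h2 := h1.unique (hf.congr_of_eventuallyEq h)
  rw [← h2]
  rfl

theorem sum_coord_sq (n : E d) : ∑ k, n k ^ 2 = ‖n‖ ^ 2 := by
  rw [EuclideanSpace.norm_sq_eq]
  simp

/-- A barycentric coordinate of a simplex that contains a ball of radius `r` has a gradient of
norm at most `1 / r`. -/
theorem norm_coordGrad_le {ι : Type*} [Fintype ι] [DecidableEq ι] (b : AffineBasis ι ℝ (E d))
    (i : ι) {z : E d} {r : ℝ} (hr : 0 < r)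
    (h : ∀ x ∈ Metric.closedBall z r, 0 ≤ b.coord i x ∧ b.coord i x ≤ 1) :
    ‖coordGrad b i‖ ≤ 1 / r := by
  refine ContinuousLinearMap.opNorm_le_of_unit_norm (by positivity) fun t ht => ?_
  -- Both this point and the centre lie in the ball, where the coordinate has values in [0, 1]; it
  -- changes by at most 1 over a step of length r.
  have h1 : z + r • t ∈ Metric.closedBall z r := by
    simp [norm_smul, ht, abs_of_pos hr]
  have h2 := h z (Metric.mem_closedBall_self hr.le)
  have h3 := h _ h1
  have h4 := coord_sub b i (z + r • t) z
  rw [add_sub_cancel_left, map_smul, smul_eq_mul] at h4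
  have h5 : coordGrad b i t = (b.coord i (z + r • t) - b.coord i z) / r := by
    rw [h4]; field_simp
  rw [h5, norm_div, Real.norm_of_nonneg hr.le]
  gcongr
  rw [Real.norm_eq_abs, abs_le]
  constructor <;> linarith [h2.1, h2.2, h3.1, h3.2]

/-- By the product rule there is one term per factor, namely the gradient of that coordinate times a
product of numbers in [0, 1]. -/
theorem norm_fderiv_facePoly_le {ι : Type*} [Fintype ι] [DecidableEq ι]
    (b : AffineBasis ι ℝ (E d)) (i : ι) {x : E d} {a : ℝ} (ha : ∀ j, ‖coordGrad b j‖ ≤ a)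
    (hx : ∀ j, 0 ≤ b.coord j x ∧ b.coord j x ≤ 1) :
    ‖fderiv ℝ (facePoly b i) x‖ ≤ (Fintype.card ι - 1 : ℕ) * a := by
  have h : HasFDerivAt (facePoly b i) _ x :=
    HasFDerivAt.finsetProd (u := Finset.univ.erase i) fun j _ => hasFDerivAt_coord b j x
  rw [h.fderiv]
  refine (norm_sum_le _ _).trans ((Finset.sum_le_card_nsmul _ _ a fun j _ => ?_).trans_eq ?_)
  · rw [norm_smul]
    refine (mul_le_of_le_one_left (norm_nonneg _) ?_).trans (ha j)
    rw [Real.norm_of_nonneg (Finset.prod_nonneg fun k _ => (hx k).1)]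
    exact Finset.prod_le_one (fun k _ => (hx k).1) fun k _ => (hx k).2
  · rw [Finset.card_erase_of_mem (Finset.mem_univ i), Finset.card_univ, nsmul_eq_mul]

/-! ### Overlap of bubbles and the local estimates -/

namespace MeshedDomain

variable (m : MeshedDomain d)

/-- The bubble fields as piecewise smooth fields. -/
def bubblePC (F : m.BubbleFace) : m.piecewiseC1 := ⟨m.bubbleField F, m.bubbleField_mem F⟩

/-- Linear combinations of the bubble fields. -/
def bubbleSum (c : m.BubbleFace → ℝ) : m.piecewiseC1 := ∑ F, c F • m.bubblePC F

theorem bubbleSum_apply (c : m.BubbleFace → ℝ) (x : E d) :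
    (m.bubbleSum c).1 x = ∑ F, c F • m.bubbleField F x := by
  simp [bubbleSum, bubblePC]

theorem grad_bubbleField_eq_zero {T : Finset (E d)} (hT : T ∈ m.tops) (F : m.BubbleFace)
    (hF : ¬ F.1 ⊆ T) {x : E d} (hx : x ∈ interior (convexHull ℝ (T : Set (E d)))) :
    grad (m.bubbleField F) x = 0 := by
  have h : m.bubbleField F =ᶠ[nhds x] 0 :=
    (m.bubbleField_eqOn_zero hT F hF).eventuallyEq_of_mem (mem_interior_iff_mem_nhds.1 hx)
  ext i j
  simp [grad, h.fderiv_eq]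

-- Bubble faces inside T are distinct d-element subsets of a set of d+1 vertices.
open Classical in
theorem card_bubbleFace_subset_le {T : Finset (E d)} (hT : T ∈ m.tops) :
    (Finset.univ.filter fun F : m.BubbleFace => F.1 ⊆ T).card ≤ d + 1 := by
  obtain ⟨_, hc⟩ := m.mem_tops.1 hT
  have hinj : Function.Injective fun F : m.BubbleFace => F.1 := fun _ _ h => Subtype.ext h
  have h := Finset.card_le_card_of_injOn (s := Finset.univ.filter fun F : m.BubbleFace => F.1 ⊆ T)
    (t := T.powersetCard d) (fun F : m.BubbleFace => F.1)
    (fun F hF => Finset.mem_powersetCard.2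
      ⟨(Finset.mem_filter.1 (Finset.mem_coe.1 hF)).2, F.2.2.1⟩) hinj.injOn
  rw [Finset.card_powersetCard, hc] at h
  simpa using h

/-- The diagonal of the bubble block dominates it up to the factor `d + 1`. -/
theorem intForm_bubbleSum_le {B : LinearMap.BilinForm ℝ (Matrix (Fin d) (Fin d) ℝ)}
    (hB : ∀ A, 0 ≤ B A A) (hs : ∀ A A', B A A' = B A' A) (c : m.BubbleFace → ℝ) :
    m.intForm B (m.bubbleSum c) (m.bubbleSum c) ≤
      (d + 1) * ∑ F, c F ^ 2 * m.intForm B (m.bubblePC F) (m.bubblePC F) := by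
  classical
  simp only [intForm_apply, ← integral_const_mul]
  rw [← integral_finsetSum _ fun F _ => (m.integrable_form B (m.bubblePC F).2
    (m.bubblePC F).2).const_mul _, ← integral_const_mul]
  refine integral_mono_ae (m.integrable_form B (m.bubbleSum c).2 (m.bubbleSum c).2)
    ((integrable_finsetSum _ fun F _ => (m.integrable_form B (m.bubblePC F).2
      (m.bubblePC F).2).const_mul _).const_mul _) (m.ae_mem_interior.mono fun x hx => ?_)
  have h1 : grad (m.bubbleSum c).1 x = ∑ F, c F • grad (m.bubbleField F) x := by
    have := map_sum (m.gradAt x hx) (fun F => c F • m.bubblePC F) Finset.univ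
    simp only [map_smul] at this
    exact this
  obtain ⟨T, hT, hxT⟩ := hx
  -- Only the faces of the simplex around x contribute, so the inequality (∑ of n terms)² ≤ n ∑
  -- (terms)² applies with n ≤ d+1. This explains the factor in D_bb.
  have h2 : grad (m.bubbleSum c).1 x =
      ∑ F ∈ Finset.univ.filter (fun F : m.BubbleFace => F.1 ⊆ T),
        c F • grad (m.bubbleField F) x := by
    rw [h1, Finset.sum_filter_of_ne]
    intro F _ hF
    by_contra h
    rw [m.grad_bubbleField_eq_zero hT F h hxT, smul_zero] at hF
    exact hF rfl
  simp only
  rw [h2]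
  refine (form_sum_le B hB hs _ _).trans ?_
  have h3 : ∀ F, B (c F • grad (m.bubbleField F) x) (c F • grad (m.bubbleField F) x) =
      c F ^ 2 * B (grad (m.bubblePC F).1 x) (grad (m.bubblePC F).1 x) := by
    intro F
    simp only [map_smul, LinearMap.smul_apply, smul_eq_mul, bubblePC]
    ring
  simp only [h3]
  refine mul_le_mul (by exact_mod_cast m.card_bubbleFace_subset_le hT)
    (Finset.sum_le_sum_of_subset_of_nonneg (Finset.filter_subset _ _)
      fun F _ _ => mul_nonneg (sq_nonneg _) (hB _))
    (Finset.sum_nonneg fun F _ => mul_nonneg (sq_nonneg _) (hB _)) (by positivity)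

section Local

variable {m}
variable {T : Finset (E d)} (hT : T ∈ m.tri.faces) (hc : T.card = d + 1)

open Classical in
/-- The bubble coefficients on a simplex, indexed by the opposite vertices. -/
def localCoeff (c : m.BubbleFace → ℝ) (i : Fin (d + 1)) : ℝ :=
  ∑ F : m.BubbleFace, if F.1 = oppFace hT hc i then c F else 0

theorem localCoeff_eq (c : m.BubbleFace → ℝ) (F : m.BubbleFace) {i : Fin (d + 1)}
    (hF : F.1 = oppFace hT hc i) : localCoeff hT hc c i = c F := by
  classical
  rw [localCoeff, Finset.sum_eq_single F, if_pos hF]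
  · intro G _ hG
    exact if_neg fun h => hG (Subtype.ext (h.trans hF.symm))
  · simp

/-- On T only bubbles of faces of T survive, and these are indexed by their opposite vertices. A
face of T that carries no bubble gets the local coefficient zero. -/
theorem bubbleSum_eq (c : m.BubbleFace → ℝ) {x : E d}
    (hx : x ∈ convexHull ℝ (T : Set (E d))) :
    (m.bubbleSum c).1 x = ∑ i, (localCoeff hT hc c i * facePoly (vertexBasis hT hc) i x) •
      m.normal (oppFace hT hc i) := by
  classical
  have hF : ∀ F : m.BubbleFace, c F • m.bubbleField F x = ∑ i,
      ((if F.1 = oppFace hT hc i then c F else 0) * facePoly (vertexBasis hT hc) i x) •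
      m.normal (oppFace hT hc i) := by
    intro F
    by_cases h : F.1 ⊆ T
    · obtain ⟨i, hi⟩ := exists_eq_oppFace hT hc h F.2.2.1
      rw [Finset.sum_eq_single i, if_pos hi, bubbleField, hi, bubble_oppFace hT hc hx, smul_smul]
      · intro j _ hj
        rw [if_neg, zero_mul, zero_smul]
        rw [hi]
        exact fun h' => hj (oppFace_injective hT hc h').symm
      · simp
    · rw [bubbleField, bubble_eq_zero hT hc hx h, zero_smul, smul_zero]
      refine (Finset.sum_eq_zero fun i _ => ?_).symm
      rw [if_neg, zero_mul, zero_smul]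
      intro h'
      exact h (h' ▸ oppFace_subset hT hc i)
  rw [bubbleSum_apply, Finset.sum_congr rfl fun F _ => hF F, Finset.sum_comm]
  refine Finset.sum_congr rfl fun i _ => ?_
  rw [localCoeff, Finset.sum_mul, Finset.sum_smul]

/-- Inside T, component k of the field is a combination of face polynomials with coefficients c_F
n_k, plus a linear functional and a constant. The scalar estimate therefore applies row by row. -/
theorem grad_bubbleSum_add (c : m.BubbleFace → ℝ) {l : m.piecewiseC1} {A : E d →ᵃ[ℝ] E d}
    (hA : Set.EqOn l.1 A (convexHull ℝ (T : Set (E d)))) {x : E d}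
    (hx : x ∈ interior (convexHull ℝ (T : Set (E d)))) (k j : Fin d) :
    grad (m.bubbleSum c + l).1 x k j =
      faceGrad (vertexBasis hT hc) (fun i => localCoeff hT hc c i * m.normal (oppFace hT hc i) k)
        ((EuclideanSpace.proj (𝕜 := ℝ) k).comp (LinearMap.toContinuousLinearMap A.linear)) x
        (EuclideanSpace.single j 1) := by
  refine grad_apply_of_eventuallyEq
    (m.differentiableAt_of_mem_interior (m.bubbleSum c + l).2 (m.mem_tops.2 ⟨hT, hc⟩) hx)
    ((hasFDerivAt_faceSum _ _ _ x).add_const (A 0 k)) ?_ j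
  filter_upwards [mem_interior_iff_mem_nhds.1 hx] with y hy
  have h1 : (m.bubbleSum c + l).1 y = (m.bubbleSum c).1 y + A y := by
    rw [← hA hy]; rfl
  have h2 : A y k = A.linear y k + A 0 k := by
    have := A.linearMap_vsub y 0
    simp at this
    simp [this]
  rw [h1, bubbleSum_eq hT hc c hy, PiLp.add_apply, h2]
  simp [Finset.sum_apply, mul_right_comm, add_assoc]

theorem interior_ae_eq_hull : interior (convexHull ℝ (T : Set (E d))) =ᵐ[volume]
    convexHull ℝ (T : Set (E d)) :=
  interior_ae_eq_of_null_frontier ((convex_convexHull ℝ _).addHaar_frontier volume)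

/-- The scalar estimate bounds (c_F n_k)² for each component k; summing over k recovers c_F² because
the normal is a unit vector. -/
theorem volume_mul_coeff_sq_le {C D : ℝ} (hC : 0 ≤ C)
    (hest : ∀ (c : Fin (d + 1) → ℝ) (g : E d →L[ℝ] ℝ) (i : Fin (d + 1)),
      volume.real (convexHull ℝ (Set.range (vertexBasis hT hc))) * c i ^ 2 ≤
        C * D ^ 2 * ∫ x in convexHull ℝ (Set.range (vertexBasis hT hc)),
          ‖faceGrad (vertexBasis hT hc) c g x‖ ^ 2)
    (c : m.BubbleFace → ℝ) {l : m.piecewiseC1} {A : E d →ᵃ[ℝ] E d}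
    (hA : Set.EqOn l.1 A (convexHull ℝ (T : Set (E d)))) (F : m.BubbleFace) (hF : F.1 ⊆ T) :
    volume.real (convexHull ℝ (T : Set (E d))) * c F ^ 2 ≤ C * D ^ 2 *
      ∫ x in interior (convexHull ℝ (T : Set (E d))),
        frobForm d (grad (m.bubbleSum c + l).1 x) (grad (m.bubbleSum c + l).1 x) := by
  obtain ⟨i, hi⟩ := exists_eq_oppFace hT hc hF F.2.2.1
  set b := vertexBasis hT hc with hb
  let n : Fin (d + 1) → E d := fun i => m.normal (oppFace hT hc i)
  let cc : Fin d → Fin (d + 1) → ℝ := fun k i => localCoeff hT hc c i * n i k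
  let g : Fin d → E d →L[ℝ] ℝ := fun k =>
    (EuclideanSpace.proj (𝕜 := ℝ) k).comp (LinearMap.toContinuousLinearMap A.linear)
  have hn : ‖n i‖ = 1 := by
    simp only [n]
    rw [← hi]
    exact m.normal_norm F.1 F.2.1 F.2.2.1
  have hK : IsCompact (convexHull ℝ (T : Set (E d))) := isCompact_hull T
  have hint : ∀ k, IntegrableOn (fun x => ‖faceGrad b (cc k) (g k) x‖ ^ 2)
      (interior (convexHull ℝ (T : Set (E d)))) volume := fun k =>
    ((((continuous_faceGrad b (cc k) (g k)).norm.pow 2).continuousOn.integrableOn_compact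
      hK).mono_set interior_subset)
  have h1 : ∀ k, volume.real (convexHull ℝ (T : Set (E d))) * (c F * n i k) ^ 2 ≤
      C * D ^ 2 * ∫ x in interior (convexHull ℝ (T : Set (E d))),
        ‖faceGrad b (cc k) (g k) x‖ ^ 2 := by
    intro k
    have := hest (cc k) (g k) i
    rw [hb, hull_vertexBasis, ← setIntegral_congr_set interior_ae_eq_hull] at this
    simp only [cc] at this
    rwa [localCoeff_eq hT hc c F hi] at this
  have h2 : volume.real (convexHull ℝ (T : Set (E d))) * c F ^ 2 =
      ∑ k, volume.real (convexHull ℝ (T : Set (E d))) * (c F * n i k) ^ 2 := by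
    simp only [mul_pow, ← Finset.mul_sum, sum_coord_sq, hn]
    ring
  rw [h2]
  refine (Finset.sum_le_sum fun k _ => h1 k).trans ?_
  rw [← Finset.mul_sum, ← integral_finsetSum _ fun k _ => hint k]
  refine mul_le_mul_of_nonneg_left ?_ (by positivity)
  refine setIntegral_mono_on (integrable_finsetSum _ fun k _ => hint k)
    (IntegrableOn.mono_set (show IntegrableOn _ m.Ω volume from
      m.integrable_form (frobForm d) (m.bubbleSum c + l).2 (m.bubbleSum c + l).2)
      (m.interior_hull_subset (m.mem_tops.2 ⟨hT, hc⟩))) isOpen_interior.measurableSet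
    fun x hx => ?_
  rw [frobForm_self]
  refine Finset.sum_le_sum fun k _ => (norm_sq_le_sum_sq _).trans_eq ?_
  exact Finset.sum_congr rfl fun j _ => by rw [grad_bubbleSum_add hT hc c hA hx k j]

/-- The coordinate gradients are at most 1/r, so the scalar bubble, a product of d coordinates, has
gradient at most d/r. The normal has length one, and the outer factor d counts the columns of the
gradient matrix. -/
theorem setIntegral_bubble_le (hT : T ∈ m.tri.faces) (hc : T.card = d + 1) {z : E d} {r : ℝ} (hr : 0 < r)
    (hball : Metric.closedBall z r ⊆ convexHull ℝ (T : Set (E d))) (F : m.BubbleFace)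
    (hF : F.1 ⊆ T) :
    ∫ x in interior (convexHull ℝ (T : Set (E d))),
        frobForm d (grad (m.bubblePC F).1 x) (grad (m.bubblePC F).1 x) ≤
      volume.real (convexHull ℝ (T : Set (E d))) * (d * (d / r) ^ 2) := by
  obtain ⟨i, hi⟩ := exists_eq_oppFace hT hc hF F.2.2.1
  set b := vertexBasis hT hc with hb
  have hn := m.normal_norm F.1 F.2.1 F.2.2.1
  have h01 : ∀ x ∈ convexHull ℝ (T : Set (E d)), ∀ j, 0 ≤ b.coord j x ∧ b.coord j x ≤ 1 :=
    fun x hx j => ⟨coord_nonneg hT hc hx j, coord_le_one hT hc hx j⟩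
  have hpt : ∀ x ∈ interior (convexHull ℝ (T : Set (E d))),
      frobForm d (grad (m.bubblePC F).1 x) (grad (m.bubblePC F).1 x) ≤ d * (d / r) ^ 2 := by
    intro x hx
    have hder : ∀ k j, grad (m.bubblePC F).1 x k j =
        (m.normal F.1 k • fderiv ℝ (facePoly b i) x) (EuclideanSpace.single j 1) := by
      intro k j
      refine grad_apply_of_eventuallyEq
        (m.differentiableAt_of_mem_interior (m.bubblePC F).2 (m.mem_tops.2 ⟨hT, hc⟩) hx)
        ((differentiable_facePoly b i x).hasFDerivAt.const_mul (m.normal F.1 k)) ?_ j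
      filter_upwards [mem_interior_iff_mem_nhds.1 hx] with y hy
      have : (m.bubblePC F).1 y = facePoly b i y • m.normal F.1 := by
        simp only [bubblePC, bubbleField]
        rw [hi, bubble_oppFace hT hc hy]
      rw [this, PiLp.smul_apply, smul_eq_mul, mul_comm]
    have hgrad := norm_fderiv_facePoly_le b i (a := 1 / r)
      (fun j => norm_coordGrad_le b j hr fun y hy => h01 y (hball hy) j)
      (h01 x (interior_subset hx))
    rw [Fintype.card_fin, Nat.add_sub_cancel, mul_one_div] at hgrad
    rw [frobForm_self]
    have hder_le : ∀ j, (fderiv ℝ (facePoly b i) x) (EuclideanSpace.single j 1) ^ 2 ≤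
        (d / r) ^ 2 := fun j => (apply_single_sq_le _ j).trans (by gcongr)
    calc ∑ k, ∑ j, grad (m.bubblePC F).1 x k j ^ 2
        ≤ ∑ k, ∑ _j : Fin d, m.normal F.1 k ^ 2 * (d / r) ^ 2 := by
          gcongr with k _ j _
          rw [hder, _root_.smul_apply, smul_eq_mul, mul_pow]
          exact mul_le_mul_of_nonneg_left (hder_le j) (sq_nonneg _)
      _ = d * (d / r) ^ 2 := by
          simp only [Finset.sum_const, Finset.card_univ, Fintype.card_fin, nsmul_eq_mul,
            ← Finset.mul_sum, ← Finset.sum_mul, sum_coord_sq, hn]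
          ring
  have hfin : volume (interior (convexHull ℝ (T : Set (E d)))) ≠ ⊤ :=
    ((measure_mono interior_subset).trans_lt (isCompact_hull T).measure_lt_top).ne
  have hmono := setIntegral_mono_on
    (IntegrableOn.mono_set (show IntegrableOn _ m.Ω volume from
      m.integrable_form (frobForm d) (m.bubblePC F).2 (m.bubblePC F).2)
      (m.interior_hull_subset (m.mem_tops.2 ⟨hT, hc⟩)))
    (integrableOn_const hfin (C := (d : ℝ) * (d / r) ^ 2)) isOpen_interior.measurableSet hpt
  refine hmono.trans_eq ?_
  rw [setIntegral_const, smul_eq_mul, measureReal_congr interior_ae_eq_hull]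

end Local

end MeshedDomain

/-! ### From one simplex to the whole mesh -/

/-- The constant of the local coefficient estimate. -/
theorem exists_volume_mul_coeff_sq_le (hd : 2 ≤ d) :
    ∃ C : ℝ, 0 < C ∧ ∀ (m : MeshedDomain d) (T : Finset (E d)), T ∈ m.tops →
      ∀ (c : m.BubbleFace → ℝ) (l : m.piecewiseC1), l.1 ∈ m.P1 → ∀ F : m.BubbleFace, F.1 ⊆ T →
      volume.real (convexHull ℝ (T : Set (E d))) * c F ^ 2 ≤
        C * Metric.diam (convexHull ℝ (T : Set (E d))) ^ 2 *
        ∫ x in interior (convexHull ℝ (T : Set (E d))),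
          frobForm d (grad (m.bubbleSum c + l).1 x) (grad (m.bubbleSum c + l).1 x) := by
  obtain ⟨C, hC, h⟩ := exists_coeff_sq_le_of_dist_le (ι := Fin (d + 1)) (d := d)
    (by rw [Fintype.card_fin]; omega) (Fintype.card_fin _)
  refine ⟨C, hC, fun m T hT c l hl F hF => ?_⟩
  obtain ⟨hT1, hT2⟩ := m.mem_tops.1 hT
  obtain ⟨A, hA⟩ := hl.2.1 T hT1
  refine MeshedDomain.volume_mul_coeff_sq_le hT1 hT2 hC.le ?_ c hA F hF
  refine h _ _ fun i j => ?_
  exact Metric.dist_le_diam_of_mem (MeshedDomain.isCompact_hull T).isBounded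
    (subset_convexHull ℝ _ (vertexBasis_mem hT1 hT2 i))
    (subset_convexHull ℝ _ (vertexBasis_mem hT1 hT2 j))

namespace MeshedDomain

variable (m : MeshedDomain d)

theorem exists_tops_superset (F : m.BubbleFace) : ∃ T ∈ m.tops, F.1 ⊆ T := by
  obtain ⟨T, hT, hFT, hc⟩ := m.pure F.1 F.2.1
  exact ⟨T, m.mem_tops.2 ⟨hT, hc⟩, hFT⟩

theorem volume_hull_pos {T : Finset (E d)} (hT : T ∈ m.tops) :
    0 < volume.real (convexHull ℝ (T : Set (E d))) := by
  obtain ⟨hT1, hT2⟩ := m.mem_tops.1 hT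
  rw [measureReal_def, ENNReal.toReal_pos_iff]
  exact ⟨(isOpen_interior.measure_pos volume (interior_hull_nonempty hT1 hT2)).trans_le
    (measure_mono interior_subset), (isCompact_hull T).measure_lt_top⟩

theorem setIntegral_le_intForm {B : LinearMap.BilinForm ℝ (Matrix (Fin d) (Fin d) ℝ)}
    (hB : ∀ A, 0 ≤ B A A) (u : m.piecewiseC1) {T : Finset (E d)} (hT : T ∈ m.tops) :
    ∫ x in interior (convexHull ℝ (T : Set (E d))), B (grad u.1 x) (grad u.1 x) ≤
      m.intForm B u u :=
  setIntegral_mono_set (m.integrable_form B u.2 u.2) (ae_of_all _ fun _ => hB _)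
    (m.interior_hull_subset hT).eventuallyLE

/-- Qualitative form of the local estimate, valid on any mesh: each bubble face lies in a simplex of
positive volume. It serves definiteness, where no uniform constant is required. -/
theorem bubble_coeff_eq_zero (hd : 2 ≤ d) (c : m.BubbleFace → ℝ) (l : m.piecewiseC1)
    (hl : l.1 ∈ m.P1) (h : m.intForm (frobForm d) (m.bubbleSum c + l) (m.bubbleSum c + l) ≤ 0) :
    c = 0 := by
  obtain ⟨C, hC, hest⟩ := exists_volume_mul_coeff_sq_le hd
  funext F
  obtain ⟨T, hT, hF⟩ := m.exists_tops_superset F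
  have h1 := hest m T hT c l hl F hF
  have h2 := (m.setIntegral_le_intForm frobForm_nonneg (m.bubbleSum c + l) hT).trans h
  have h3 := m.volume_hull_pos hT
  have h4 := h1.trans (mul_nonpos_of_nonneg_of_nonpos (by positivity) h2)
  have h5 : c F ^ 2 ≤ 0 := by
    by_contra! hc
    exact absurd h4 (not_le.2 (mul_pos h3 hc))
  exact pow_eq_zero_iff (two_ne_zero) |>.1 (le_antisymm h5 (sq_nonneg _))

end MeshedDomain

/-- The bubble part is controlled by the whole field in the `H¹` seminorm. -/
theorem exists_sum_bubble_le (hd : 2 ≤ d) (σ : ℝ) :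
    ∃ C : ℝ, 0 < C ∧ ∀ (m : MeshedDomain d), m.ShapeRegular σ → ∀ (c : m.BubbleFace → ℝ)
      (l : m.piecewiseC1), l.1 ∈ m.P1 →
      ∑ F, c F ^ 2 * m.intForm (frobForm d) (m.bubblePC F) (m.bubblePC F) ≤
        C * m.intForm (frobForm d) (m.bubbleSum c + l) (m.bubbleSum c + l) := by
  classical
  obtain ⟨C, hC, hest⟩ := exists_volume_mul_coeff_sq_le hd
  -- A simplex has at most d+1 bubbles, (2σ)² comes from diam² ≤ (2σr)², and d³ from d(d/r)², with r
  -- cancelling. The summand 1 only ensures positivity.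
  refine ⟨(d + 1) * (C * (2 * σ) ^ 2 * d ^ 3) + 1, by positivity, fun m hσ c l hl => ?_⟩
  set u := m.bubbleSum c + l with hu
  have hI := m.integrable_form (frobForm d) u.2 u.2
  let I : Finset (E d) → ℝ := fun T => ∫ x in interior (convexHull ℝ (T : Set (E d))),
    frobForm d (grad u.1 x) (grad u.1 x)
  let J : m.BubbleFace → Finset (E d) → ℝ := fun F T =>
    ∫ x in interior (convexHull ℝ (T : Set (E d))),
      frobForm d (grad (m.bubblePC F).1 x) (grad (m.bubblePC F).1 x)
  have hI0 : ∀ T, 0 ≤ I T := fun T => integral_nonneg fun _ => frobForm_nonneg _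
  have hIs : m.intForm (frobForm d) u u = ∑ T ∈ m.tops, I T := m.integral_eq_sum hI
  have hJs : ∀ F, m.intForm (frobForm d) (m.bubblePC F) (m.bubblePC F) =
      ∑ T ∈ m.tops, J F T := fun F =>
    m.integral_eq_sum (m.integrable_form (frobForm d) (m.bubblePC F).2 (m.bubblePC F).2)
  have hloc : ∀ T ∈ m.tops, ∑ F, c F ^ 2 * J F T ≤
      (d + 1) * (C * (2 * σ) ^ 2 * d ^ 3) * I T := by
    intro T hT
    obtain ⟨hT1, hT2⟩ := m.mem_tops.1 hT
    obtain ⟨z, r, hr, hball, hdiam⟩ := hσ T hT1 hT2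
    have hJ0 : ∀ F : m.BubbleFace, ¬ F.1 ⊆ T → J F T = 0 := by
      intro F hF
      refine setIntegral_eq_zero_of_forall_eq_zero fun x hx => ?_
      have : grad (m.bubblePC F).1 x = 0 := m.grad_bubbleField_eq_zero hT F hF hx
      rw [this, map_zero]
    have hF : ∀ F : m.BubbleFace, F.1 ⊆ T → c F ^ 2 * J F T ≤
        C * (2 * σ) ^ 2 * d ^ 3 * I T := by
      intro F hF
      set V := volume.real (convexHull ℝ (T : Set (E d)))
      set D := Metric.diam (convexHull ℝ (T : Set (E d)))
      have h1 : J F T ≤ V * (d * (d / r) ^ 2) :=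
        MeshedDomain.setIntegral_bubble_le hT1 hT2 hr hball F hF
      have h2 : V * c F ^ 2 ≤ C * D ^ 2 * I T := hest m T hT c l hl F hF
      have h3 : D ^ 2 ≤ (σ * (2 * r)) ^ 2 := pow_le_pow_left₀ Metric.diam_nonneg hdiam 2
      have hIT := hI0 T
      have h4 : V * c F ^ 2 ≤ C * (σ * (2 * r)) ^ 2 * I T := h2.trans (by gcongr)
      calc c F ^ 2 * J F T ≤ c F ^ 2 * (V * (d * (d / r) ^ 2)) := by gcongr
        _ = V * c F ^ 2 * (d * (d / r) ^ 2) := by ring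
        _ ≤ C * (σ * (2 * r)) ^ 2 * I T * (d * (d / r) ^ 2) :=
            mul_le_mul_of_nonneg_right h4 (by positivity)
        _ = _ := by field_simp
    have hcard := m.card_bubbleFace_subset_le hT
    have hnn : 0 ≤ C * (2 * σ) ^ 2 * d ^ 3 * I T := mul_nonneg (by positivity) (hI0 T)
    calc ∑ F, c F ^ 2 * J F T
        = ∑ F ∈ Finset.univ.filter (fun F : m.BubbleFace => F.1 ⊆ T), c F ^ 2 * J F T := by
          rw [Finset.sum_filter_of_ne]
          intro F _ hne
          by_contra h
          rw [hJ0 F h, mul_zero] at hne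
          exact hne rfl
      _ ≤ (Finset.univ.filter fun F : m.BubbleFace => F.1 ⊆ T).card •
          (C * (2 * σ) ^ 2 * d ^ 3 * I T) :=
          Finset.sum_le_card_nsmul _ _ _ fun F hF' => hF F (Finset.mem_filter.1 hF').2
      _ ≤ ((d + 1 : ℕ) : ℝ) * (C * (2 * σ) ^ 2 * d ^ 3 * I T) := by
          rw [nsmul_eq_mul]
          gcongr
      _ = _ := by push_cast; ring
  have hsum : ∑ F, c F ^ 2 * m.intForm (frobForm d) (m.bubblePC F) (m.bubblePC F) =
      ∑ T ∈ m.tops, ∑ F, c F ^ 2 * J F T := by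
    simp only [hJs, Finset.mul_sum]
    exact Finset.sum_comm
  rw [hsum, hIs]
  refine (Finset.sum_le_sum hloc).trans ?_
  rw [← Finset.mul_sum]
  have : 0 ≤ ∑ T ∈ m.tops, I T := Finset.sum_nonneg fun T _ => hI0 T
  nlinarith

/-! ### Coefficient vectors and displacement fields -/

section Fields

variable {m : MeshedDomain d} (P : BiotParameters m) (X : BiotSpaces m)

/-- The piecewise linear field with given coefficients. -/
def linSum (y : Fin X.nl → ℝ) : m.piecewiseC1 :=
  ∑ j, y j • (⟨(X.basisL j : E d → E d), m.P1_le (X.basisL j).2⟩ : m.piecewiseC1)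

theorem linSum_eq (y : Fin X.nl → ℝ) : (linSum X y).1 = ((∑ j, y j • X.basisL j : m.P1) : E d → E d) := by
  simp [linSum]

theorem linSum_mem (y : Fin X.nl → ℝ) : (linSum X y).1 ∈ m.P1 := by
  rw [linSum_eq]; exact Subtype.prop _

/-- The displacement field with given coefficients. -/
def dispField (x : m.BubbleFace ⊕ Fin X.nl → ℝ) : m.piecewiseC1 :=
  m.bubbleSum (x ∘ Sum.inl) + linSum X (x ∘ Sum.inr)

theorem dispField_mem (x : m.BubbleFace ⊕ Fin X.nl → ℝ) : (dispField X x).1 ∈ m.Vh := by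
  have h1 : (m.bubbleSum (x ∘ Sum.inl)).1 ∈ m.Vb := by
    have : (m.bubbleSum (x ∘ Sum.inl)).1 = ∑ F, (x ∘ Sum.inl) F • m.bubbleField F := by
      simp [MeshedDomain.bubbleSum, MeshedDomain.bubblePC]
    rw [this]
    exact Submodule.sum_mem _ fun F _ => Submodule.smul_mem _ _
      (Submodule.subset_span (Set.mem_range_self F))
  exact Submodule.add_mem _ (Submodule.mem_sup_right h1)
    (Submodule.mem_sup_left (linSum_mem X _))

theorem exists_dispField_eq {v : E d → E d} (hv : v ∈ m.Vh) : ∃ x, (dispField X x).1 = v := by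
  obtain ⟨l, hl, b, hb, rfl⟩ := Submodule.mem_sup.1 hv
  obtain ⟨c, hc⟩ := (Submodule.mem_span_range_iff_exists_fun ℝ).1 hb
  refine ⟨Sum.elim c (X.basisL.repr ⟨l, hl⟩), ?_⟩
  have h1 : (m.bubbleSum c).1 = b := by
    rw [← hc]; simp [MeshedDomain.bubbleSum, MeshedDomain.bubblePC]
  have h2 : (linSum X (X.basisL.repr ⟨l, hl⟩)).1 = l := by
    rw [linSum_eq, X.basisL.sum_repr]
  rw [dispField, Sum.elim_comp_inl, Sum.elim_comp_inr, Submodule.coe_add, h1, h2, add_comm]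

/-- A field with zero L² norm vanishes in Ω by continuity, on closed simplices by density of their
interiors, and outside the mesh by convention. It is then the zero function, and independence of the
basis applies. -/
theorem linSum_eq_zero {y : Fin X.nl → ℝ}
    (h : ∫ x in m.Ω, ‖(linSum X y).1 x‖ ^ 2 ≤ 0) : y = 0 := by
  have hmem := linSum_mem X y
  set l := (linSum X y).1 with hl
  have hcont : ContinuousOn l m.tri.space := hmem.1
  have hint : IntegrableOn (fun x => ‖l x‖ ^ 2) m.Ω volume :=
    ((hcont.norm.pow 2).integrableOn_compact m.isCompact_space).mono_set m.Ω_subset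
  have h0 : ∫ x in m.Ω, ‖l x‖ ^ 2 = 0 := le_antisymm h (integral_nonneg fun _ => by positivity)
  rw [integral_eq_zero_iff_of_nonneg (fun _ => by positivity) hint] at h0
  have hae : l =ᵐ[volume.restrict m.Ω] 0 := h0.mono fun x hx => by simpa using hx
  have hΩ : ∀ x ∈ m.Ω, l x = 0 := Measure.eqOn_open_of_ae_eq hae m.isOpen_Ω
    (hcont.mono m.Ω_subset) continuousOn_const
  have hspace : ∀ x ∈ m.tri.space, l x = 0 := by
    intro x hx
    rw [m.space_eq] at hx
    simp only [Set.mem_iUnion, exists_prop] at hx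
    obtain ⟨T, hT, hxT⟩ := hx
    obtain ⟨hT1, hT2⟩ := m.mem_tops.1 hT
    have hsub := hull_subset_closure_interior (vertexBasis hT1 hT2)
    rw [hull_vertexBasis] at hsub
    obtain ⟨A, hA⟩ := hmem.2.1 T hT1
    have hz : Set.EqOn l 0 (interior (convexHull ℝ (T : Set (E d)))) := fun y hy =>
      hΩ y (m.interior_hull_subset hT hy)
    exact hz.of_subset_closure (hcont.mono
      (Geometry.SimplicialComplex.convexHull_subset_space hT1)) continuousOn_const
      interior_subset hsub hxT
  have hzero : l = 0 := by
    funext x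
    by_cases hx : x ∈ m.tri.space
    · exact hspace x hx
    · exact hmem.2.2.1 x hx
  have hsum : (∑ j, y j • X.basisL j : m.P1) = 0 := by
    rw [hl, linSum_eq] at hzero
    exact Subtype.ext hzero
  have := Fintype.linearIndependent_iff.1 X.basisL.linearIndependent y hsum
  exact funext this

/-- This contains the directness of V_{h,1} ⊕ V_b. The vanishing seminorm kills the bubble
coefficients, and the vanishing L² norm then kills the linear ones. -/
theorem dispField_coeff_eq_zero (hd : 2 ≤ d) {x : m.BubbleFace ⊕ Fin X.nl → ℝ}
    (h : H1norm m.Ω (dispField X x).1 = 0) : x = 0 := by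
  set v := (dispField X x).1 with hv
  have h1 : 0 ≤ ∫ x in m.Ω, ‖v x‖ ^ 2 := integral_nonneg fun _ => by positivity
  have h2 : 0 ≤ m.intForm (frobForm d) (dispField X x) (dispField X x) :=
    m.intForm_nonneg frobForm_nonneg _
  have h3 : (∫ x in m.Ω, ‖v x‖ ^ 2) + m.intForm (frobForm d) (dispField X x) (dispField X x) ≤ 0 :=
    Real.sqrt_eq_zero'.1 h
  have hc : x ∘ Sum.inl = 0 := m.bubble_coeff_eq_zero hd _ _ (linSum_mem X _)
    (by rw [← dispField]; linarith)
  have hv' : v = (linSum X (x ∘ Sum.inr)).1 := by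
    rw [hv, dispField, hc]
    simp [MeshedDomain.bubbleSum]
  have hl : x ∘ Sum.inr = 0 := linSum_eq_zero X (by rw [← hv']; linarith)
  funext i
  cases i with
  | inl F => exact congrFun hc F
  | inr j => exact congrFun hl j

end Fields

theorem bilin_sum_eq_dotProduct {V W ι κ : Type*} [AddCommGroup V] [Module ℝ V] [AddCommGroup W]
    [Module ℝ W] [Fintype ι] [Fintype κ] (f : V →ₗ[ℝ] W →ₗ[ℝ] ℝ) (ψ : κ → V) (φ : ι → W)
    (y : κ → ℝ) (c : ι → ℝ) :
    f (∑ j, y j • ψ j) (∑ i, c i • φ i) =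
      c ⬝ᵥ ((Matrix.of fun i j => f (ψ j) (φ i)) *ᵥ y) := by
  simp only [map_sum, LinearMap.sum_apply, map_smul, LinearMap.smul_apply, smul_eq_mul,
    dotProduct, Matrix.mulVec, Matrix.of_apply, Finset.mul_sum]
  refine Finset.sum_congr rfl fun i _ => Finset.sum_congr rfl fun j _ => by ring

/-! ### The product weighted by the inverse permeability -/

section Perm

variable {m : MeshedDomain d} (P : BiotParameters m)

theorem measurable_perm_inv (i j : Fin d) : Measurable fun x => (P.perm x)⁻¹ i j := by
  have hK : Measurable fun x => (fun i j => P.perm x i j : Fin d → Fin d → ℝ) :=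
    measurable_pi_iff.2 fun i => measurable_pi_iff.2 fun j => P.perm_measurable i j
  have hdet : Continuous fun A : Fin d → Fin d → ℝ => (Matrix.of A).det :=
    Continuous.matrix_det continuous_id
  have hadj : Continuous fun A : Fin d → Fin d → ℝ => (Matrix.of A).adjugate i j :=
    (Continuous.matrix_adjugate continuous_id).matrix_elem i j
  have h : (fun x => (P.perm x)⁻¹ i j) =
      fun x => ((P.perm x).det)⁻¹ * (P.perm x).adjugate i j := by
    funext x
    rw [Matrix.inv_def, Matrix.smul_apply, smul_eq_mul, Ring.inverse_eq_inv']
  rw [h]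
  exact (hdet.measurable.comp hK).inv.mul (hadj.measurable.comp hK)

theorem isUnit_det_perm {x : E d} (hx : x ∈ m.Ω) : IsUnit (P.perm x).det := by
  obtain ⟨k₀, k₁, hk₀, h⟩ := P.perm_bounds
  rw [← Matrix.isUnit_iff_isUnit_det, ← Matrix.mulVec_injective_iff_isUnit]
  intro ξ η hξη
  have h1 : P.perm x *ᵥ (ξ - η) = 0 := by
    rw [Matrix.mulVec_sub]; exact sub_eq_zero.2 hξη
  have h2 := (h x hx (ξ - η)).1
  rw [h1, dotProduct_zero] at h2
  have h3 : 0 ≤ (ξ - η) ⬝ᵥ (ξ - η) := by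
    rw [dotProduct]; exact Finset.sum_nonneg fun i _ => mul_self_nonneg _
  have h4 : (ξ - η) ⬝ᵥ (ξ - η) = 0 := by nlinarith
  exact sub_eq_zero.1 (dotProduct_self_eq_zero.1 h4)

/-- With ξ = K⁻¹η the quantity is ξ·Kξ ≥ k₀|ξ|². -/
theorem perm_inv_lower {x : E d} (hx : x ∈ m.Ω) (η : Fin d → ℝ) :
    0 ≤ ((P.perm x)⁻¹ *ᵥ η) ⬝ᵥ η ∧ (((P.perm x)⁻¹ *ᵥ η) ⬝ᵥ η = 0 → η = 0) := by
  obtain ⟨k₀, k₁, hk₀, h⟩ := P.perm_bounds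
  set ξ := (P.perm x)⁻¹ *ᵥ η with hξ
  have hη : P.perm x *ᵥ ξ = η := by
    rw [hξ, Matrix.mulVec_mulVec, Matrix.mul_nonsing_inv _ (isUnit_det_perm P hx),
      Matrix.one_mulVec]
  have h2 := (h x hx ξ).1
  rw [hη] at h2
  have h3 : 0 ≤ ξ ⬝ᵥ ξ := by
    rw [dotProduct]; exact Finset.sum_nonneg fun i _ => mul_self_nonneg _
  refine ⟨(mul_nonneg hk₀.le h3).trans h2, fun h0 => ?_⟩
  have h4 : ξ ⬝ᵥ ξ = 0 := by nlinarith
  rw [← hη, dotProduct_self_eq_zero.1 h4, Matrix.mulVec_zero]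

/-- For the column ξ = K⁻¹e_j, ellipticity gives k₀|ξ|² ≤ ξ_j. Hence ξ_j ≤ 1/k₀, and then |ξ| ≤
1/k₀. -/
theorem exists_perm_inv_entry_le (i j : Fin d) : ∃ C : ℝ, ∀ x ∈ m.Ω, |(P.perm x)⁻¹ i j| ≤ C := by
  obtain ⟨k₀, k₁, hk₀, h⟩ := P.perm_bounds
  refine ⟨1 / k₀, fun x hx => ?_⟩
  set ξ := (P.perm x)⁻¹ *ᵥ Pi.single j 1 with hξ
  have hη : P.perm x *ᵥ ξ = Pi.single j 1 := by
    rw [hξ, Matrix.mulVec_mulVec, Matrix.mul_nonsing_inv _ (isUnit_det_perm P hx),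
      Matrix.one_mulVec]
  have h2 := (h x hx ξ).1
  rw [hη, dotProduct_single_one] at h2
  have hsq : ∀ k, ξ k ^ 2 ≤ ξ ⬝ᵥ ξ := fun k => by
    rw [dotProduct, sq]
    exact Finset.single_le_sum (f := fun k => ξ k * ξ k) (fun l _ => mul_self_nonneg _)
      (Finset.mem_univ k)
  have h3 : (P.perm x)⁻¹ i j = ξ i := by
    rw [hξ, Matrix.mulVec_single_one, Matrix.col_apply]
  have hj : ξ j ≤ 1 / k₀ := by
    rw [le_div_iff₀ hk₀]
    by_contra! hlt
    nlinarith [hsq j, mul_le_mul_of_nonneg_left (hsq j) hk₀.le]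
  have hi : ξ i ^ 2 ≤ (1 / k₀) ^ 2 := by
    calc ξ i ^ 2 ≤ ξ ⬝ᵥ ξ := hsq i
      _ ≤ ξ j / k₀ := by rw [le_div_iff₀ hk₀]; linarith
      _ ≤ (1 / k₀) / k₀ := by gcongr
      _ = _ := by ring
  rw [h3]
  exact abs_le_of_sq_le_sq hi (by positivity)

theorem integrable_perm (u v : L2vec m.Ω) :
    Integrable (fun x => P.muf * (((P.perm x)⁻¹ *ᵥ (u x).ofLp) ⬝ᵥ (v x).ofLp))
      (volume.restrict m.Ω) := by
  refine Integrable.const_mul ?_ _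
  have h : (fun x => ((P.perm x)⁻¹ *ᵥ (u x).ofLp) ⬝ᵥ (v x).ofLp) =
      fun x => ∑ i, ∑ j, (P.perm x)⁻¹ i j * (u x j * v x i) := by
    funext x
    simp only [dotProduct, Matrix.mulVec, Finset.sum_mul, mul_assoc]
  rw [h]
  refine integrable_finsetSum _ fun i _ => integrable_finsetSum _ fun j _ => ?_
  obtain ⟨C, hC⟩ := exists_perm_inv_entry_le P i j
  have hmem : ∀ (w : L2vec m.Ω) k, MemLp (fun x => w x k) 2 (volume.restrict m.Ω) :=
    fun w k => (EuclideanSpace.proj (𝕜 := ℝ) k).comp_memLp' (Lp.memLp w)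
  refine Integrable.bdd_mul (c := C) ((hmem u j).integrable_mul (hmem v i))
    (measurable_perm_inv P i j).aestronglyMeasurable ?_
  exact (ae_restrict_iff' m.isOpen_Ω.measurableSet).2 (ae_of_all _ hC)

/-- The weighted `L²` product `(K⁻¹ μ_f u, v)`. -/
def permForm : LinearMap.BilinForm ℝ (L2vec m.Ω) :=
  LinearMap.mk₂ ℝ
    (fun u v => ∫ x in m.Ω, P.muf * (((P.perm x)⁻¹ *ᵥ (u x).ofLp) ⬝ᵥ (v x).ofLp))
    (fun u u' v => by
      rw [← integral_add (integrable_perm P u v) (integrable_perm P u' v)]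
      refine integral_congr_ae ((Lp.coeFn_add u u').mono fun x hx => ?_)
      simp only [hx, Pi.add_apply, WithLp.ofLp_add, Matrix.mulVec_add, add_dotProduct, mul_add])
    (fun c u v => by
      rw [smul_eq_mul, ← integral_const_mul]
      refine integral_congr_ae ((Lp.coeFn_smul c u).mono fun x hx => ?_)
      simp only [hx, Pi.smul_apply, WithLp.ofLp_smul, Matrix.mulVec_smul, smul_dotProduct,
        smul_eq_mul]
      ring)
    (fun u v v' => by
      rw [← integral_add (integrable_perm P u v) (integrable_perm P u v')]
      refine integral_congr_ae ((Lp.coeFn_add v v').mono fun x hx => ?_)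
      simp only [hx, Pi.add_apply, WithLp.ofLp_add, dotProduct_add, mul_add])
    (fun c u v => by
      rw [smul_eq_mul, ← integral_const_mul]
      refine integral_congr_ae ((Lp.coeFn_smul c v).mono fun x hx => ?_)
      simp only [hx, Pi.smul_apply, WithLp.ofLp_smul, dotProduct_smul, smul_eq_mul]
      ring)

theorem permForm_apply (u v : L2vec m.Ω) : permForm P u v =
    ∫ x in m.Ω, P.muf * (((P.perm x)⁻¹ *ᵥ (u x).ofLp) ⬝ᵥ (v x).ofLp) := rfl

theorem permForm_comm (u v : L2vec m.Ω) : permForm P u v = permForm P v u := by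
  rw [permForm_apply, permForm_apply]
  refine setIntegral_congr_fun m.isOpen_Ω.measurableSet fun x hx => ?_
  have hs : ((P.perm x)⁻¹)ᵀ = (P.perm x)⁻¹ := by
    rw [Matrix.transpose_nonsing_inv, (P.perm_symm x hx).eq]
  simp only
  rw [dotProduct_comm, Matrix.dotProduct_mulVec, ← Matrix.mulVec_transpose, hs]

theorem permForm_self_nonneg (u : L2vec m.Ω) : 0 ≤ permForm P u u :=
  setIntegral_nonneg m.isOpen_Ω.measurableSet fun _ hx =>
    mul_nonneg P.muf_pos.le (perm_inv_lower P hx _).1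

theorem eq_zero_of_permForm_self {u : L2vec m.Ω} (h : permForm P u u = 0) : u = 0 := by
  have hpos : ∀ᵐ x ∂volume.restrict m.Ω,
      0 ≤ P.muf * (((P.perm x)⁻¹ *ᵥ (u x).ofLp) ⬝ᵥ (u x).ofLp) :=
    (ae_restrict_iff' m.isOpen_Ω.measurableSet).2 (ae_of_all _ fun x hx =>
      mul_nonneg P.muf_pos.le (perm_inv_lower P hx _).1)
  rw [permForm_apply, integral_eq_zero_iff_of_nonneg_ae hpos (integrable_perm P u u)] at h
  refine (Lp.eq_zero_iff_ae_eq_zero).2 ?_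
  filter_upwards [h, ae_restrict_mem m.isOpen_Ω.measurableSet] with x hx hxΩ
  have h1 := (mul_eq_zero.1 hx).resolve_left P.muf_pos.ne'
  have h2 := (perm_inv_lower P hxΩ _).2 h1
  ext i
  exact congrFun h2 i

end Perm

/-- The weak divergence of the zero field vanishes. -/
theorem MemHdiv.eq_zero (m : MeshedDomain d) {g : L2 m.Ω} (h : MemHdiv m.Ω m.Γt 0 g) : g = 0 := by
  have hloc : LocallyIntegrableOn (fun x => g x) m.Ω (volume.restrict m.Ω) :=
    ((Lp.memLp g).integrable (by norm_num)).locallyIntegrable.locallyIntegrableOn _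
  have hae := m.isOpen_Ω.ae_eq_zero_of_integral_contDiff_smul_eq_zero hloc
    fun φ hφ hcs hsub => by
      -- Functions supported in the open set Ω are admissible in Green's formula, since the closure
      -- of Γt lies in the frontier of Ω.
      have hdisj : Disjoint (tsupport φ) (closure m.Γt) := by
        have h1 : closure m.Γt ⊆ frontier m.Ω := by
          rw [← m.closure_union]; exact Set.subset_union_right
        have h2 : Disjoint m.Ω (frontier m.Ω) := (disjoint_frontier_iff_isOpen.2 m.isOpen_Ω).symm
        exact h2.mono hsub h1
      have h3 := h φ hφ hcs hdisj
      have h4 : ∫ x in m.Ω, fderiv ℝ φ x ((0 : L2vec m.Ω) x) = 0 := by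
        rw [integral_eq_zero_of_ae]
        filter_upwards [Lp.coeFn_zero (E d) 2 (volume.restrict m.Ω)] with x hx
        rw [hx]; simp
      rw [h4, neg_zero] at h3
      rw [← h3]
      exact integral_congr_ae (ae_of_all _ fun x => by simp [mul_comm])
  refine (Lp.eq_zero_iff_ae_eq_zero).2 ?_
  filter_upwards [hae, ae_restrict_mem m.isOpen_Ω.measurableSet] with x hx hxΩ
  exact hx hxΩ

/-! ### Quadratic forms of the matrices in terms of fields -/

section Matrices

variable {m : MeshedDomain d} (P : BiotParameters m) (X : BiotSpaces m)

/-- The pressure with given coefficients. -/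
def presField (q : Fin X.nq → ℝ) : L2 m.Ω := ∑ i, q i • (X.basisQ i : L2 m.Ω)

/-- The Darcy velocity with given coefficients, with its divergence. -/
def fluxField (w : Fin X.nw → ℝ) : L2vec m.Ω × L2 m.Ω :=
  ∑ i, w i • (X.basisW i : L2vec m.Ω × L2 m.Ω)

theorem presField_mem (q : Fin X.nq → ℝ) : presField X q ∈ X.Qh :=
  Submodule.sum_mem _ fun i _ => Submodule.smul_mem _ _ (X.basisQ i).2

theorem presField_eq_zero {q : Fin X.nq → ℝ} (h : presField X q = 0) : q = 0 := by
  have h1 : (∑ i, q i • X.basisQ i) = 0 := by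
    apply Subtype.ext
    simpa [presField] using h
  exact funext (Fintype.linearIndependent_iff.1 X.basisQ.linearIndependent q h1)

/-- The basis consists of pairs (w, div w), so the second component must vanish too; conformity
gives this, because the weak divergence of the zero field is zero. -/
theorem fluxField_eq_zero {w : Fin X.nw → ℝ} (h : (fluxField X w).1 = 0) : w = 0 := by
  have hmem : fluxField X w ∈ X.Wh :=
    Submodule.sum_mem _ fun i _ => Submodule.smul_mem _ _ (X.basisW i).2
  have h2 : (fluxField X w).2 = 0 := by
    have := X.Wh_conforming _ hmem
    rw [h] at this
    exact this.eq_zero m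
  have h3 : fluxField X w = 0 := Prod.ext h h2
  have h1 : (∑ i, w i • X.basisW i) = 0 := by
    apply Subtype.ext
    simpa [fluxField] using h3
  exact funext (Fintype.linearIndependent_iff.1 X.basisW.linearIndependent w h1)

theorem inner_eq_integral (p q : L2 m.Ω) : inner ℝ p q = ∫ x in m.Ω, p x * q x := by
  rw [L2.inner_def]
  exact integral_congr_ae (ae_of_all _ fun x => mul_comm _ _)

theorem dotProduct_Mp (p q : Fin X.nq → ℝ) :
    q ⬝ᵥ (Mp X *ᵥ p) = inner ℝ (presField X p) (presField X q) := by
  have h := bilin_sum_eq_dotProduct (innerₗ (L2 m.Ω)) (fun i => (X.basisQ i : L2 m.Ω))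
    (fun i => (X.basisQ i : L2 m.Ω)) p q
  have hM : Mp X = Matrix.of fun i j =>
      innerₗ (L2 m.Ω) (X.basisQ j : L2 m.Ω) (X.basisQ i : L2 m.Ω) := by
    ext i j
    rw [Matrix.of_apply, innerₗ_apply_apply, inner_eq_integral]
    rfl
  rw [hM, ← h]
  rfl

theorem dotProduct_Mw (w r : Fin X.nw → ℝ) :
    r ⬝ᵥ (Mw P X *ᵥ w) = permForm P (fluxField X w).1 (fluxField X r).1 := by
  have h := bilin_sum_eq_dotProduct (permForm P)
    (fun i => (X.basisW i : L2vec m.Ω × L2 m.Ω).1)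
    (fun i => (X.basisW i : L2vec m.Ω × L2 m.Ω).1) w r
  have e : ∀ w : Fin X.nw → ℝ, (fluxField X w).1 =
      ∑ i, w i • (X.basisW i : L2vec m.Ω × L2 m.Ω).1 := fun w => by
    simp [fluxField, Prod.fst_sum]
  rw [e, e, h]
  rfl

/-- The coupling of pressure and displacement. -/
def couplingMatrix : Matrix (Fin X.nq) (m.BubbleFace ⊕ Fin X.nl) ℝ :=
  Matrix.fromCols (Bb X) (Bl X)

theorem dotProduct_coupling (u : m.BubbleFace ⊕ Fin X.nl → ℝ) (q : Fin X.nq → ℝ) :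
    q ⬝ᵥ (couplingMatrix X *ᵥ u) = - m.divForm (dispField X u) (presField X q) := by
  have h1 := bilin_sum_eq_dotProduct m.divForm m.bubblePC (fun i => (X.basisQ i : L2 m.Ω))
    (u ∘ Sum.inl) q
  have h2 := bilin_sum_eq_dotProduct m.divForm
    (fun j => (⟨(X.basisL j : E d → E d), m.P1_le (X.basisL j).2⟩ : m.piecewiseC1))
    (fun i => (X.basisQ i : L2 m.Ω)) (u ∘ Sum.inr) q
  have e1 : Bb X = - Matrix.of fun i j => m.divForm (m.bubblePC j) (X.basisQ i : L2 m.Ω) := rfl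
  have e2 : Bl X = - Matrix.of fun i j =>
      m.divForm ⟨(X.basisL j : E d → E d), m.P1_le (X.basisL j).2⟩ (X.basisQ i : L2 m.Ω) := rfl
  rw [couplingMatrix, Matrix.fromCols_mulVec, dotProduct_add, e1, e2, Matrix.neg_mulVec,
    Matrix.neg_mulVec, dotProduct_neg, dotProduct_neg, ← h1, ← h2, dispField, map_add,
    LinearMap.add_apply, neg_add]
  rfl

theorem isSymm_AuD : (AuD P X)ᵀ = AuD P X := by
  have h : (All P X)ᵀ = All P X := by
    ext i j
    have := m.elasticity_eq P.lam P.mu ⟨_, m.P1_le (X.basisL i).2⟩ ⟨_, m.P1_le (X.basisL j).2⟩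
    have h2 := m.elasticity_eq P.lam P.mu ⟨_, m.P1_le (X.basisL j).2⟩ ⟨_, m.P1_le (X.basisL i).2⟩
    simp only [Matrix.transpose_apply, All]
    rw [this, h2, m.intForm_apply, m.intForm_apply]
    exact integral_congr_ae (ae_of_all _ fun x => energyForm_comm _ _ _ _)
  rw [AuD, Matrix.fromBlocks_transpose, h, Matrix.transpose_transpose, Dbb,
    Matrix.transpose_smul, Matrix.diagonal_transpose]

/-- A_u^D differs from the elasticity matrix only in the bubble block, so its form is the energy of
the whole field corrected by D_bb - A_bb. The sign of the correction gives the lower bound; dropping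
the A_bb part gives the upper bound. -/
theorem dotProduct_AuD (x : m.BubbleFace ⊕ Fin X.nl → ℝ) :
    x ⬝ᵥ (AuD P X *ᵥ x) =
      (d + 1) * ∑ F, x (Sum.inl F) ^ 2 *
        m.intForm (energyForm d P.lam P.mu) (m.bubblePC F) (m.bubblePC F)
      - m.intForm (energyForm d P.lam P.mu) (m.bubbleSum (x ∘ Sum.inl))
          (m.bubbleSum (x ∘ Sum.inl))
      + m.intForm (energyForm d P.lam P.mu) (dispField X x) (dispField X x) := by
  set f := m.intForm (energyForm d P.lam P.mu) with hf
  set c := x ∘ Sum.inl with hc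
  set y := x ∘ Sum.inr with hy
  have hx : x = Sum.elim c y := (Sum.elim_comp_inl_inr x).symm
  let ψ : Fin X.nl → m.piecewiseC1 := fun j => ⟨(X.basisL j : E d → E d), m.P1_le (X.basisL j).2⟩
  have e1 : Abl P X = Matrix.of fun i j => f (ψ j) (m.bubblePC i) := by
    ext i j; exact m.elasticity_eq P.lam P.mu (ψ j) (m.bubblePC i)
  have e2 : All P X = Matrix.of fun i j => f (ψ j) (ψ i) := by
    ext i j; exact m.elasticity_eq P.lam P.mu (ψ j) (ψ i)
  have h1 := bilin_sum_eq_dotProduct f ψ m.bubblePC y c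
  have h2 := bilin_sum_eq_dotProduct f ψ ψ y y
  have hD : c ⬝ᵥ (Dbb P *ᵥ c) = (d + 1) * ∑ F, c F ^ 2 * f (m.bubblePC F) (m.bubblePC F) := by
    rw [Dbb, Matrix.smul_mulVec, dotProduct_smul, smul_eq_mul, dotProduct]
    congr 1
    refine Finset.sum_congr rfl fun F _ => ?_
    have : (Abb P).diag F = f (m.bubblePC F) (m.bubblePC F) :=
      m.elasticity_eq P.lam P.mu (m.bubblePC F) (m.bubblePC F)
    rw [Matrix.mulVec_diagonal, this]
    ring
  have hfs : ∀ u v, f u v = f v u := fun u v => by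
    rw [hf, m.intForm_apply, m.intForm_apply]
    exact integral_congr_ae (ae_of_all _ fun x => energyForm_comm _ _ _ _)
  have hcl : y ⬝ᵥ ((Abl P X)ᵀ *ᵥ c) = c ⬝ᵥ (Abl P X *ᵥ y) := by
    rw [Matrix.mulVec_transpose, dotProduct_comm, Matrix.dotProduct_mulVec]
  have hdisp : f (dispField X x) (dispField X x) = f (m.bubbleSum c) (m.bubbleSum c) +
      2 * f (linSum X y) (m.bubbleSum c) + f (linSum X y) (linSum X y) := by
    rw [dispField, ← hc, ← hy]
    simp only [map_add, LinearMap.add_apply]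
    rw [hfs (m.bubbleSum c) (linSum X y)]
    ring
  have h1' : f (linSum X y) (m.bubbleSum c) = c ⬝ᵥ (Abl P X *ᵥ y) := by rw [e1, ← h1]; rfl
  have h2' : f (linSum X y) (linSum X y) = y ⬝ᵥ (All P X *ᵥ y) := by rw [e2, ← h2]; rfl
  have hexp : x ⬝ᵥ (AuD P X *ᵥ x) = c ⬝ᵥ (Dbb P *ᵥ c) + 2 * (c ⬝ᵥ (Abl P X *ᵥ y)) +
      y ⬝ᵥ (All P X *ᵥ y) := by
    rw [AuD, Matrix.fromBlocks_mulVec, ← hc, ← hy]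
    conv_lhs => rw [hx]
    rw [sumElim_dotProduct_sumElim, dotProduct_add, dotProduct_add, hcl]
    ring
  rw [hexp, hD, hdisp, h1', h2']
  simp only [hc, Function.comp_apply]
  ring

end Matrices

/-! ### Verification of the abstract hypotheses -/

section Estimates

variable {m : MeshedDomain d} (P : BiotParameters m) (X : BiotSpaces m)

/-- The pressure-displacement coupling as a bilinear map. -/
def couplingForm : (m.BubbleFace ⊕ Fin X.nl → ℝ) →ₗ[ℝ] (Fin X.nq → ℝ) →ₗ[ℝ] ℝ :=
  LinearMap.mk₂ ℝ (fun u q => q ⬝ᵥ (couplingMatrix X *ᵥ u))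
    (fun u u' q => by rw [Matrix.mulVec_add, dotProduct_add])
    (fun c u q => by rw [Matrix.mulVec_smul, dotProduct_smul])
    (fun u q q' => by rw [add_dotProduct])
    (fun c u q => by rw [smul_dotProduct])

theorem couplingForm_apply (u : m.BubbleFace ⊕ Fin X.nl → ℝ) (q : Fin X.nq → ℝ) :
    couplingForm X u q = q ⬝ᵥ (couplingMatrix X *ᵥ u) := rfl

/-- The discrete divergence `M_p⁻¹ B_w`. -/
def discreteDiv : (Fin X.nw → ℝ) →ₗ[ℝ] (Fin X.nq → ℝ) := ((Mp X)⁻¹ * Bw X).mulVecLin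

theorem toBilin'_comm {n : Type*} [Fintype n] [DecidableEq n] {A : Matrix n n ℝ}
    (h : Aᵀ = A) (u v : n → ℝ) : Matrix.toBilin' A u v = Matrix.toBilin' A v u := by
  rw [Matrix.toBilin'_apply', Matrix.toBilin'_apply',
    Matrix.dotProduct_mulVec, ← Matrix.mulVec_transpose, h, dotProduct_comm]

theorem isSymm_toBilin' {n : Type*} [Fintype n] [DecidableEq n] {A : Matrix n n ℝ}
    (h : Aᵀ = A) : LinearMap.IsSymm (Matrix.toBilin' A) :=
  ⟨fun u v => toBilin'_comm h u v⟩

theorem Mp_self (q : Fin X.nq → ℝ) : Matrix.toBilin' (Mp X) q q = ‖presField X q‖ ^ 2 := by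
  rw [Matrix.toBilin'_apply', dotProduct_Mp, real_inner_self_eq_norm_sq]

theorem Mw_self (w : Fin X.nw → ℝ) :
    Matrix.toBilin' (Mw P X) w w = permForm P (fluxField X w).1 (fluxField X w).1 := by
  rw [Matrix.toBilin'_apply', dotProduct_Mw]

theorem isSymm_Mp : (Mp X)ᵀ = Mp X := by
  ext i j
  exact integral_congr_ae (ae_of_all _ fun x => mul_comm _ _)

theorem isSymm_Mw : (Mw P X)ᵀ = Mw P X := by
  ext i j
  exact permForm_comm P (X.basisW i : L2vec m.Ω × L2 m.Ω).1 (X.basisW j : L2vec m.Ω × L2 m.Ω).1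

theorem isUnit_det_Mp : IsUnit (Mp X).det := by
  rw [← Matrix.isUnit_iff_isUnit_det, ← Matrix.mulVec_injective_iff_isUnit]
  intro p q hpq
  have h1 : Mp X *ᵥ (p - q) = 0 := by rw [Matrix.mulVec_sub]; exact sub_eq_zero.2 hpq
  have h2 := Mp_self X (p - q)
  rw [Matrix.toBilin'_apply', h1, dotProduct_zero] at h2
  exact sub_eq_zero.1 (presField_eq_zero X (norm_eq_zero.1 (pow_eq_zero_iff two_ne_zero |>.1 h2.symm)))

theorem Mp_mulVec_discreteDiv (w : Fin X.nw → ℝ) :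
    Mp X *ᵥ (discreteDiv X w) = Bw X *ᵥ w := by
  rw [discreteDiv, Matrix.mulVecLin_apply, Matrix.mulVec_mulVec, ← Matrix.mul_assoc,
    Matrix.mul_nonsing_inv _ (isUnit_det_Mp X), Matrix.one_mul]

theorem Mp_discreteDiv (w : Fin X.nw → ℝ) (q : Fin X.nq → ℝ) :
    Matrix.toBilin' (Mp X) (discreteDiv X w) q = q ⬝ᵥ (Bw X *ᵥ w) := by
  rw [toBilin'_comm (isSymm_Mp X) , Matrix.toBilin'_apply', Mp_mulVec_discreteDiv]

/-- A_w = Sᵀ M_p S for S = M_p⁻¹ B_w, so the last block of 𝒟 contains the norm of the discrete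
divergence. -/
theorem Aw_self (w : Fin X.nw → ℝ) :
    w ⬝ᵥ (Aw X *ᵥ w) = Matrix.toBilin' (Mp X) (discreteDiv X w) (discreteDiv X w) := by
  rw [Mp_discreteDiv, Aw, Matrix.mul_assoc, ← Matrix.mulVec_mulVec, Matrix.mulVec_transpose,
    dotProduct_comm, ← Matrix.dotProduct_mulVec]
  rfl

theorem isSymm_Aw : (Aw X)ᵀ = Aw X := by
  rw [Aw, Matrix.transpose_mul, Matrix.transpose_mul, Matrix.transpose_transpose,
    Matrix.transpose_nonsing_inv, isSymm_Mp, Matrix.mul_assoc]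

theorem energy_le_AuD (x : m.BubbleFace ⊕ Fin X.nl → ℝ) :
    m.intForm (energyForm d P.lam P.mu) (dispField X x) (dispField X x) ≤
      Matrix.toBilin' (AuD P X) x x := by
  rw [Matrix.toBilin'_apply', dotProduct_AuD]
  have := m.intForm_bubbleSum_le (energyForm_nonneg P.lam_nonneg P.mu_pos.le)
    (energyForm_comm P.lam P.mu) (x ∘ Sum.inl)
  simp only [Function.comp_apply] at this
  linarith

theorem AuD_nonneg (x : m.BubbleFace ⊕ Fin X.nl → ℝ) : 0 ≤ Matrix.toBilin' (AuD P X) x x :=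
  (m.intForm_nonneg (energyForm_nonneg P.lam_nonneg P.mu_pos.le) _).trans (energy_le_AuD P X x)

theorem frob_le_H1norm_sq (v : m.piecewiseC1) :
    m.intForm (frobForm d) v v ≤ H1norm m.Ω v.1 ^ 2 := by
  have h1 : 0 ≤ ∫ x in m.Ω, ‖v.1 x‖ ^ 2 := integral_nonneg fun _ => by positivity
  have h2 : 0 ≤ m.intForm (frobForm d) v v := m.intForm_nonneg frobForm_nonneg v
  rw [H1norm, Real.sq_sqrt]
  · exact le_add_of_nonneg_left h1
  · exact add_nonneg h1 h2

theorem zeta_sq (hd : 0 < d) : P.zeta ^ 2 = P.lam + 2 * P.mu / d := by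
  have hd' : (0 : ℝ) < d := by exact_mod_cast hd
  have := P.lam_nonneg
  have := P.mu_pos
  exact Real.sq_sqrt (by positivity)

theorem zeta_pos (hd : 0 < d) : 0 < P.zeta := by
  have hd' : (0 : ℝ) < d := by exact_mod_cast hd
  have := P.lam_nonneg
  have := P.mu_pos
  exact Real.sqrt_pos.2 (by positivity)

/-- The displacement block is bounded in the `H¹` norm, uniformly up to the factor `ζ²`. -/
theorem AuD_le (hd : 0 < d) {C : ℝ} (hC : 0 ≤ C)
    (hbub : ∀ (c : m.BubbleFace → ℝ) (l : m.piecewiseC1), l.1 ∈ m.P1 →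
      ∑ F, c F ^ 2 * m.intForm (frobForm d) (m.bubblePC F) (m.bubblePC F) ≤
        C * m.intForm (frobForm d) (m.bubbleSum c + l) (m.bubbleSum c + l))
    (x : m.BubbleFace ⊕ Fin X.nl → ℝ) :
    Matrix.toBilin' (AuD P X) x x ≤
      d * ((d + 1) * C + 1) * P.zeta ^ 2 * H1norm m.Ω (dispField X x).1 ^ 2 := by
  have hd' : (0 : ℝ) < d := by exact_mod_cast hd
  have hl := P.lam_nonneg
  have hm := P.mu_pos
  set N := m.intForm (frobForm d) (dispField X x) (dispField X x) with hN
  have hζ : 2 * P.mu + d * P.lam = d * P.zeta ^ 2 := by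
    rw [zeta_sq P hd]; field_simp; ring
  have h1 := hbub (x ∘ Sum.inl) (linSum X (x ∘ Sum.inr)) (linSum_mem X _)
  have h2 : ∑ F, x (Sum.inl F) ^ 2 *
      m.intForm (energyForm d P.lam P.mu) (m.bubblePC F) (m.bubblePC F) ≤
      d * P.zeta ^ 2 * (C * N) := by
    refine le_trans ?_ (mul_le_mul_of_nonneg_left h1 (by positivity))
    rw [Finset.mul_sum]
    refine Finset.sum_le_sum fun F _ => ?_
    have := m.intForm_energyForm_le hm.le hl (m.bubblePC F)
    rw [hζ] at this
    calc _ ≤ x (Sum.inl F) ^ 2 * (d * P.zeta ^ 2 *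
          m.intForm (frobForm d) (m.bubblePC F) (m.bubblePC F)) := by gcongr
      _ = _ := by simp only [Function.comp_apply]; ring
  have h3 := m.intForm_energyForm_le hm.le hl (dispField X x)
  rw [hζ] at h3
  -- The bubble energy enters `dotProduct_AuD` with a minus sign and can be discarded.
  have h4 : 0 ≤ m.intForm (energyForm d P.lam P.mu) (m.bubbleSum (x ∘ Sum.inl))
      (m.bubbleSum (x ∘ Sum.inl)) := m.intForm_nonneg (energyForm_nonneg hl hm.le) _
  have h5 := mul_le_mul_of_nonneg_left h2 (by positivity : (0 : ℝ) ≤ d + 1)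
  rw [Matrix.toBilin'_apply', dotProduct_AuD]
  calc _ ≤ d * ((d + 1) * C + 1) * P.zeta ^ 2 * N := by linarith
    _ ≤ _ := by gcongr; exact frob_le_H1norm_sq _

theorem zeta_sq_mul_coupling_sq_le (hd : 0 < d) (u : m.BubbleFace ⊕ Fin X.nl → ℝ)
    (q : Fin X.nq → ℝ) :
    P.zeta ^ 2 * couplingForm X u q ^ 2 ≤
      Matrix.toBilin' (AuD P X) u u * Matrix.toBilin' (Mp X) q q := by
  rw [couplingForm_apply, dotProduct_coupling, neg_sq, Mp_self, zeta_sq P hd]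
  refine (m.zeta_sq_mul_divForm_sq_le P.mu_pos.le P.lam_nonneg hd _ _).trans ?_
  gcongr
  exact energy_le_AuD P X u

/-- A field realizing the Stokes inf-sup bound is rescaled to have pairing ‖q‖² with q. Its H¹ norm
is then at most ‖q‖/γ, and the bound on A_u^D converts this into the energy with the factor ζ². -/
theorem exists_stokes_lift (hd : 2 ≤ d) {C γ : ℝ} (hC : 0 ≤ C) (hγ : 0 < γ)
    (hbound : ∀ x : m.BubbleFace ⊕ Fin X.nl → ℝ, Matrix.toBilin' (AuD P X) x x ≤
      C * P.zeta ^ 2 * H1norm m.Ω (dispField X x).1 ^ 2)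
    (hS : StokesStable m.Ω m.Vh X.Qh γ) (q : Fin X.nq → ℝ) :
    ∃ u, -couplingForm X u q = Matrix.toBilin' (Mp X) q q ∧
      Matrix.toBilin' (AuD P X) u u ≤
        ((1 + C / γ ^ 2) * P.zeta) ^ 2 * Matrix.toBilin' (Mp X) q q := by
  by_cases hq : presField X q = 0
  · refine ⟨0, ?_, ?_⟩
    · simp [Mp_self, hq]
    · rw [Mp_self, hq]; simp
  obtain ⟨v, hv, hv0, hle⟩ := hS _ (presField_mem X q) hq
  obtain ⟨x, rfl⟩ := exists_dispField_eq X hv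
  set n := ‖presField X q‖ with hn
  have hnpos : 0 < n := norm_pos_iff.2 hq
  set H := H1norm m.Ω (dispField X x).1 with hH
  have hHpos : 0 < H := by
    refine lt_of_le_of_ne (Real.sqrt_nonneg _) fun h => hv0 ?_
    rw [dispField_coeff_eq_zero X hd h.symm, dispField]
    simp [MeshedDomain.bubbleSum, linSum]
  set D := m.divForm (dispField X x) (presField X q) with hD
  have hle' : γ * n * H ≤ D := hle
  have hDpos : 0 < D := lt_of_lt_of_le (by positivity) hle'
  have hcpl : couplingForm X x q = -D := by rw [couplingForm_apply, dotProduct_coupling]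
  refine ⟨(n ^ 2 / D) • x, ?_, ?_⟩
  · rw [map_smul, LinearMap.smul_apply, hcpl, Mp_self, smul_eq_mul]
    field_simp
    rw [hn]
  · rw [map_smul, map_smul, LinearMap.smul_apply, smul_eq_mul, smul_eq_mul, Mp_self, ← hn]
    have h1 : n ^ 2 / D * H ≤ n / γ := by
      rw [div_mul_eq_mul_div, div_le_div_iff₀ hDpos hγ]
      calc n ^ 2 * H * γ = n * (γ * n * H) := by ring
        _ ≤ n * D := by gcongr
    -- Using 1 + C/γ² instead of √C/γ avoids a root and gives the constant ≥ 1 that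
    -- `exists_le_sysForm` requires.
    have h2 : C / γ ^ 2 ≤ (1 + C / γ ^ 2) ^ 2 := by
      have : 0 ≤ C / γ ^ 2 := by positivity
      nlinarith
    calc n ^ 2 / D * (n ^ 2 / D * Matrix.toBilin' (AuD P X) x x)
        ≤ n ^ 2 / D * (n ^ 2 / D * (C * P.zeta ^ 2 * H ^ 2)) := by
          gcongr
          exact hbound x
      _ = C * P.zeta ^ 2 * (n ^ 2 / D * H) ^ 2 := by ring
      _ ≤ C * P.zeta ^ 2 * (n / γ) ^ 2 := by gcongr
      _ = C / γ ^ 2 * (P.zeta ^ 2 * n ^ 2) := by ring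
      _ ≤ (1 + C / γ ^ 2) ^ 2 * (P.zeta ^ 2 * n ^ 2) := by gcongr
      _ = _ := by ring

theorem AuD_pos (hd : 2 ≤ d) {γ : ℝ} (hS : StokesBiotStable P X γ)
    {x : m.BubbleFace ⊕ Fin X.nl → ℝ} (hx : x ≠ 0) : 0 < Matrix.toBilin' (AuD P X) x x := by
  obtain ⟨a, ha, h⟩ := hS.coercive
  have h1 := h _ (dispField_mem X x)
  rw [m.elasticity_eq] at h1
  refine lt_of_lt_of_le (mul_pos ha (pow_pos ?_ 2)) (h1.trans (energy_le_AuD P X x))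
  exact lt_of_le_of_ne (Real.sqrt_nonneg _) fun h0 => hx (dispField_coeff_eq_zero X hd h0.symm)

theorem Mw_nonneg (w : Fin X.nw → ℝ) : 0 ≤ Matrix.toBilin' (Mw P X) w w := by
  rw [Mw_self]; exact permForm_self_nonneg P _

theorem Mw_pos {w : Fin X.nw → ℝ} (hw : w ≠ 0) : 0 < Matrix.toBilin' (Mw P X) w w := by
  refine lt_of_le_of_ne (Mw_nonneg P X w) fun h => hw ?_
  rw [Mw_self] at h
  exact fluxField_eq_zero X (eq_zero_of_permForm_self P h.symm)

theorem Mp_nonneg (q : Fin X.nq → ℝ) : 0 ≤ Matrix.toBilin' (Mp X) q q := by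
  rw [Mp_self]; positivity

theorem Mp_pos {q : Fin X.nq → ℝ} (hq : q ≠ 0) : 0 < Matrix.toBilin' (Mp X) q q := by
  rw [Mp_self]
  exact pow_pos (norm_pos_iff.2 fun h => hq (presField_eq_zero X h)) 2

/-- The identity M_p S = B_w lets the flux coupling be written with the pressure product, as the
abstract form requires. -/
theorem systemD_dotProduct (u v : m.BubbleFace ⊕ Fin X.nl → ℝ) (p q : Fin X.nq → ℝ)
    (w r : Fin X.nw → ℝ) :
    (systemD P X *ᵥ Sum.elim u (Sum.elim p w)) ⬝ᵥ Sum.elim v (Sum.elim q r) =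
      sysForm (Matrix.toBilin' (AuD P X)) (Matrix.toBilin' (Mp X)) (Matrix.toBilin' (Mw P X))
        (couplingForm X) (discreteDiv X) P.alpha P.M P.tau u p w v q r := by
  have hb : ∀ (v : m.BubbleFace ⊕ Fin X.nl → ℝ) (p : Fin X.nq → ℝ), couplingForm X v p =
      p ⬝ᵥ (Bb X *ᵥ (v ∘ Sum.inl)) + p ⬝ᵥ (Bl X *ᵥ (v ∘ Sum.inr)) := fun v p => by
    rw [couplingForm_apply, couplingMatrix, Matrix.fromCols_mulVec, dotProduct_add]
  have h1 : (Matrix.fromBlocks (P.alpha • (Bb X)ᵀ) (0 : Matrix m.BubbleFace (Fin X.nw) ℝ)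
      (P.alpha • (Bl X)ᵀ) 0 *ᵥ Sum.elim p w) ⬝ᵥ v = P.alpha * couplingForm X v p := by
    conv_lhs => rw [← Sum.elim_comp_inl_inr v]
    rw [Matrix.fromBlocks_mulVec, Sum.elim_comp_inl, Sum.elim_comp_inr,
      sumElim_dotProduct_sumElim, hb]
    simp only [Matrix.zero_mulVec, add_zero, Matrix.smul_mulVec, smul_dotProduct, smul_eq_mul,
      Matrix.mulVec_transpose, ← Matrix.dotProduct_mulVec]
    ring
  have h2 : (Matrix.fromBlocks (-(P.alpha • Bb X)) (-(P.alpha • Bl X))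
      (0 : Matrix (Fin X.nw) m.BubbleFace ℝ) 0 *ᵥ u) ⬝ᵥ Sum.elim q r =
      - (P.alpha * couplingForm X u q) := by
    rw [Matrix.fromBlocks_mulVec, sumElim_dotProduct_sumElim, hb]
    simp only [Matrix.zero_mulVec, add_zero, Matrix.smul_mulVec, smul_dotProduct, smul_eq_mul,
      Matrix.neg_mulVec, add_dotProduct, neg_dotProduct, zero_dotProduct]
    rw [dotProduct_comm q, dotProduct_comm q]
    ring
  have h3 : (Matrix.fromBlocks ((1 / P.M) • Mp X) (-(P.tau • Bw X)) (P.tau • (Bw X)ᵀ)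
      (P.tau • Mw P X) *ᵥ Sum.elim p w) ⬝ᵥ Sum.elim q r =
      1 / P.M * Matrix.toBilin' (Mp X) p q - P.tau * Matrix.toBilin' (Mp X) (discreteDiv X w) q +
        P.tau * Matrix.toBilin' (Mp X) (discreteDiv X r) p +
        P.tau * Matrix.toBilin' (Mw P X) w r := by
    rw [Matrix.fromBlocks_mulVec, Sum.elim_comp_inl, Sum.elim_comp_inr,
      sumElim_dotProduct_sumElim, Mp_discreteDiv, Mp_discreteDiv,
      toBilin'_comm (isSymm_Mp X) p q, toBilin'_comm (isSymm_Mw P X) w r,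
      Matrix.toBilin'_apply', Matrix.toBilin'_apply']
    simp only [Matrix.smul_mulVec, smul_dotProduct, smul_eq_mul,
      Matrix.neg_mulVec, add_dotProduct, neg_dotProduct, Matrix.mulVec_transpose,
      ← Matrix.dotProduct_mulVec]
    rw [dotProduct_comm q, dotProduct_comm q, dotProduct_comm r]
    ring
  rw [systemD, Matrix.fromBlocks_mulVec, Sum.elim_comp_inl, Sum.elim_comp_inr,
    sumElim_dotProduct_sumElim, add_dotProduct, add_dotProduct, h1, h2, h3, sysForm,
    toBilin'_comm (isSymm_AuD P X) u v, Matrix.toBilin'_apply' (AuD P X), dotProduct_comm v]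
  ring

theorem normD_dotProduct (u : m.BubbleFace ⊕ Fin X.nl → ℝ) (p : Fin X.nq → ℝ)
    (w : Fin X.nw → ℝ) :
    (normD P X *ᵥ Sum.elim u (Sum.elim p w)) ⬝ᵥ Sum.elim u (Sum.elim p w) =
      sqNorm (Matrix.toBilin' (AuD P X)) (Matrix.toBilin' (Mp X)) (Matrix.toBilin' (Mw P X))
        (discreteDiv X) (P.alpha ^ 2 / P.zeta ^ 2 + 1 / P.M) P.tau u p w := by
  rw [normD, Matrix.fromBlocks_mulVec, Sum.elim_comp_inl, Sum.elim_comp_inr,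
    sumElim_dotProduct_sumElim, Matrix.fromBlocks_mulVec, Sum.elim_comp_inl, Sum.elim_comp_inr]
  simp only [Matrix.zero_mulVec, add_zero, zero_add]
  rw [sumElim_dotProduct_sumElim, sqNorm, ← Aw_self, BiotParameters.cp,
    Matrix.toBilin'_apply', Matrix.toBilin'_apply', Matrix.toBilin'_apply']
  simp only [Matrix.add_mulVec, Matrix.smul_mulVec, smul_dotProduct, add_dotProduct, smul_eq_mul]
  rw [dotProduct_comm u, dotProduct_comm p, dotProduct_comm w, dotProduct_comm w]
  ring

theorem elim_parts (x : Index X → ℝ) : Sum.elim (x ∘ Sum.inl)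
    (Sum.elim (x ∘ Sum.inr ∘ Sum.inl) (x ∘ Sum.inr ∘ Sum.inr)) = x := by
  funext i
  rcases i with i | i | i <;> rfl

theorem posDef_normD (hd : 2 ≤ d) {γ : ℝ} (hS : StokesBiotStable P X γ) :
    (normD P X).PosDef := by
  refine Matrix.PosDef.of_dotProduct_mulVec_pos ?_ fun x hx => ?_
  · rw [Matrix.IsHermitian, Matrix.conjTranspose_eq_transpose_of_trivial, normD,
      Matrix.fromBlocks_transpose, Matrix.fromBlocks_transpose, isSymm_AuD,
      Matrix.transpose_smul, isSymm_Mp, Matrix.transpose_add, Matrix.transpose_smul,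
      Matrix.transpose_smul, isSymm_Mw, isSymm_Aw]
    simp only [Matrix.transpose_zero]
  · have hζ := zeta_pos P (by omega : 0 < d)
    have hM := P.M_pos
    have hτ := P.tau_pos
    have hk : 0 < P.alpha ^ 2 / P.zeta ^ 2 + 1 / P.M := by positivity
    rw [star_trivial, dotProduct_comm]
    conv_rhs => rw [← elim_parts X x]
    rw [normD_dotProduct, sqNorm]
    set u := x ∘ Sum.inl
    set p := x ∘ Sum.inr ∘ Sum.inl
    set w := x ∘ Sum.inr ∘ Sum.inr
    have h1 := AuD_nonneg P X u
    have h2 := mul_nonneg hk.le (Mp_nonneg X p)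
    have h3 := mul_nonneg hτ.le (Mw_nonneg P X w)
    have h4 := mul_nonneg (by positivity : 0 ≤ P.tau ^ 2 *
      (P.alpha ^ 2 / P.zeta ^ 2 + 1 / P.M)⁻¹) (Mp_nonneg X (discreteDiv X w))
    by_cases hu : u = 0
    · by_cases hp : p = 0
      · by_cases hw : w = 0
        · refine absurd ?_ hx
          rw [← elim_parts X x]
          change Sum.elim u (Sum.elim p w) = 0
          rw [hu, hp, hw]
          funext i
          rcases i with i | i | i <;> rfl
        · have := mul_pos hτ (Mw_pos P X hw)
          linarith
      · have := mul_pos hk (Mp_pos X hp)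
        linarith
    · have := AuD_pos P X hd hS hu
      linarith

theorem weightedNorm_eq (x : Index X → ℝ) : weightedNorm P X x =
    √(sqNorm (Matrix.toBilin' (AuD P X)) (Matrix.toBilin' (Mp X)) (Matrix.toBilin' (Mw P X))
      (discreteDiv X) (P.alpha ^ 2 / P.zeta ^ 2 + 1 / P.M) P.tau (x ∘ Sum.inl)
      (x ∘ Sum.inr ∘ Sum.inl) (x ∘ Sum.inr ∘ Sum.inr)) := by
  rw [weightedNorm, ← normD_dotProduct, elim_parts]

end Estimates

end Biot

end

/-! ### Choice of the uniform constants and conclusion -/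

theorem theorem3p1 (d : ℕ) (hd : d = 2 ∨ d = 3) (σ γB : ℝ) (hσ : 0 < σ) (hγB : 0 < γB) :
    ∃ ςD γD : ℝ, 0 < ςD ∧ 0 < γD ∧
      ∀ (m : Biot.MeshedDomain d) (P : Biot.BiotParameters m) (X : Biot.BiotSpaces m),
        m.ShapeRegular σ → Biot.StokesBiotStable P X γB →
        (Biot.normD P X).PosDef ∧
        (∀ x y : Biot.Index X → ℝ,
          (Biot.systemD P X *ᵥ x) ⬝ᵥ y ≤ ςD * Biot.weightedNorm P X x * Biot.weightedNorm P X y) ∧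
        (∀ y : Biot.Index X → ℝ, y ≠ 0 → ∃ x : Biot.Index X → ℝ, x ≠ 0 ∧
          γD * Biot.weightedNorm P X x * Biot.weightedNorm P X y
            ≤ (Biot.systemD P X *ᵥ x) ⬝ᵥ y) := by
  have hd2 : 2 ≤ d := by omega
  have hd0 : 0 < d := by omega
  obtain ⟨C, hC, hbub⟩ := Biot.exists_sum_bubble_le hd2 σ
  -- `C₁` is the factor in `AuD_le`, and `C₂` below is the lift constant of `exists_stokes_lift`.
  -- Both are fixed before the mesh and the parameters are introduced.
  set C₁ : ℝ := d * ((d + 1) * C + 1) with hC₁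
  have hC₁0 : 0 ≤ C₁ := by positivity
  set C₂ : ℝ := 1 + C₁ / γB ^ 2 with hC₂
  have hC₂1 : 1 ≤ C₂ := le_add_of_nonneg_right (by positivity)
  refine ⟨7, 1 / (8 * C₂ ^ 2), by norm_num, by positivity, fun m P X hreg hS => ?_⟩
  have hζ := Biot.zeta_pos P hd0
  have hpos := Biot.posDef_normD P X hd2 hS
  have hb := Biot.zeta_sq_mul_coupling_sq_le P X hd0
  have ha := Biot.AuD_nonneg P X
  have has := Biot.isSymm_toBilin' (Biot.isSymm_AuD P X)
  have hp := Biot.Mp_nonneg X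
  have hps := Biot.isSymm_toBilin' (Biot.isSymm_Mp X)
  have hw := Biot.Mw_nonneg P X
  have hws := Biot.isSymm_toBilin' (Biot.isSymm_Mw P X)
  refine ⟨hpos, fun x y => ?_, fun y hy => ?_⟩
  · rw [Biot.weightedNorm_eq, Biot.weightedNorm_eq]
    conv_lhs => rw [← Biot.elim_parts X x, ← Biot.elim_parts X y]
    rw [Biot.systemD_dotProduct]
    exact Biot.sysForm_le ha has hp hps hw hws hζ P.M_pos P.tau_pos hb _ _ _ _ _ _
  · obtain ⟨u, p, w, h1, h2⟩ := Biot.exists_le_sysForm hC₂1 ha has hp hps hw hζ P.M_pos P.tau_pos hb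
      (Biot.exists_stokes_lift P X hd2 hC₁0 hγB
        (Biot.AuD_le P X hd0 hC.le (hbub m hreg)) hS.stokes)
      (y ∘ Sum.inl) (y ∘ Sum.inr ∘ Sum.inl) (y ∘ Sum.inr ∘ Sum.inr)
    rw [← Biot.systemD_dotProduct, Biot.elim_parts] at h1 h2
    refine ⟨Sum.elim u (Sum.elim p w), fun h0 => ?_, ?_⟩
    -- If the trial vector were zero, the quadratic bound would give ‖y‖² ≤ 0, against definiteness
    -- of 𝒟.
    · rw [h0, Matrix.mulVec_zero, zero_dotProduct, ← Biot.normD_dotProduct, Biot.elim_parts] at h2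
      have h3 := hpos.dotProduct_mulVec_pos hy
      rw [star_trivial, dotProduct_comm] at h3
      have : 0 < 1 / (4 * C₂ ^ 2) := by positivity
      exact absurd h2 (not_le.2 (mul_pos this h3))
    · rw [Biot.weightedNorm_eq, Biot.weightedNorm_eq]
      exact h1
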